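/- \textbf{Conventions.} Fix $\alpha>1$. A \emph{Lorenz map} is a map $f:[0,1]\setminus\{c\}\to[0,1]$ of the form \[ f(x)=\begin{cases} f_-(x)=\phi_-\Big(u\big(1-(\tfrac{c-x}{c})^{\alpha}\big)\Big), & x\in[0,c),\\[2pt] f_+(x)=\phi_+\Big(1+v\big(-1+(\tfrac{x-c}{1-c})^{\alpha}\big)\Big), & x\in(c,1],\end{cases} \] with $c=\operatorname{crit}(f)\in(0,1)$, $u,v\in[0,1]$, and increasing $C^3$ diffeomorphisms $\phi_\pm$ of $[0,1]$ (the diffeomorphic parts) with Schwarzian derivative $\le 0$. The branches $f_\pm$ are extended continuously to $c$. The map is \emph{nontrivial} if $f_+(c)<c<f_-(c)$ and \emph{full} if $f_-(c)=1$, $f_+(c)=0$. All Lorenz maps have $0$ and $1$ as their only fixed points. The map is $\delta$-close to standard maps if $\phi_\pm$ have $C^2$-distance at most $\delta$ to the identity. The \emph{renormalization} $\mathcal Rf$ is the first-return map of $f$ to $C$, affinely rescaled to $[0,1]$, where $C\subsetneq[0,1]$ is the largest closed interval with $c$ in its interior whose first-return map is (after rescaling) a nontrivial Lorenz map with exponent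 $\alpha$. The map $f$ is \emph{$(a,b)$-renormalizable}, $a,b\ge1$, if such a $C$ exists, the points of $C^-=C\cap[0,c)$ return to $C$ at time $a+1$ and are to the right of $c$ at times $1,\dots,a$, and the points of $C^+=C\cap(c,1]$ return to $C$ at time $b+1$ and are to the left of $c$ at times $1,\dots,b$. A \emph{family} is a map $t\mapsto F_t$ from a compact simply connected set $U\subset\mathbb R^2$ to Lorenz maps, all nontrivial except that on $\partial U$ maps with a trivial branch ($f_-(c)=c$ or $f_+(c)=c$, and $f_+(c)\le c\le f_-(c)$) are allowed. It is \emph{analytic} if $c,u,v$ and $\phi_\pm$ (as elements of $C^3([0,1])$) are real-analytic functions of $t$ which extend analytically to a neighbourhood of $U$. An $(a,b)$-\emph{island} is the closure of a connected component of the interior of $\{t\in U: F_t\text{ is }(a,b)\text{-renormalizable}\}$. A \emph{full vertex} of an $(a,b)$-island $D$ is a map $F_t$, $t\in D$, that is $(a,b)$-renormalizable and whose renormalization is full. \textbf{Statement.} For every $\alpha>1$ there is $\delta>0$ such that the following holds. Let $F$ be an analytic family of Lorenz maps on $U$, all of them $\delta$-close to standard maps, with a unique parameter $\hat t\in U$ for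 which $\hat f=F_{\hat t}$ is full. Assume moreover that this uniqueness persists analytically: near $\hat t$, the set $U$ is contained in a closed semianalytic set $S$ (a finite union of sets $\{g_1\ge0,\dots,g_n\ge0\}$ with $g_j$ real-analytic near $\hat t$) in which $\hat t$ is still the only solution of $u=v=1$, where $u,v$ denote analytic extensions of the parameters $u,v$ to a neighbourhood of $\hat t$. (For instance $U$ itself is semianalytic, such as a rectangle; or $\hat t$ is an isolated solution of $u=v=1$ in the plane.) Put $\hat c=\operatorname{crit}(\hat f)$. Then there is $\gamma>0$ such that for every $\epsilon>0$ and $K>0$ there is $N\ge1$ such that for all $a,b\ge N$ with $\frac1K\le\frac ab\le K$, every $(a,b)$-island $D_{a,b}$ and every full vertex $f_{a,b}$ of $D_{a,b}$, \[ 1-\epsilon\ \le\ \frac{c'}{1-c'}\left(\frac{\hat c}{1-\hat c}\left(\gamma\,\frac{D\hat f(0)^b}{D\hat f(1)^a}\right)^{1/\alpha}\right)^{-1}\le\ 1+\epsilon,\qquad c'=\operatorname{crit}(\mathcal R f_{a,b}). \] -/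

import Mathlib

open Set Filter Topology

noncomputable section

/-- The `k`-th derivative on the interval `[0,1]` (one-sided at the endpoints). -/
def iD (k : ℕ) (φ : ℝ → ℝ) (x : ℝ) : ℝ := iteratedDerivWithin k φ (Icc (0 : ℝ) 1) x

/-- The Schwarzian derivative on `[0,1]`. -/
def schwarzian (φ : ℝ → ℝ) (x : ℝ) : ℝ :=
  iD 3 φ x / iD 1 φ x - 3 / 2 * (iD 2 φ x / iD 1 φ x) ^ 2

/-- Increasing `C^3` diffeomorphisms of `[0,1]` with negative Schwarzian derivative. The
inequality is not strict, so that the identity (the diffeomorphic part of a standard Lorenz map)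
is included. Only the values of `φ` on `[0,1]` matter. -/
structure IsDiffeoPart (φ : ℝ → ℝ) : Prop where
  contDiff : ContDiffOn ℝ 3 φ (Icc 0 1)
  map_zero : φ 0 = 0
  map_one : φ 1 = 1
  deriv_pos : ∀ x ∈ Icc (0 : ℝ) 1, 0 < iD 1 φ x
  schwarzian_nonpos : ∀ x ∈ Icc (0 : ℝ) 1, schwarzian φ x ≤ 0

/-- A Lorenz map on `[0,1]` with critical exponent `α`: a standard Lorenz map with critical point
`c` and critical values `u`, `1 - v`, followed on the two branches by the diffeomorphic parts
`φm` (left) and `φp` (right). -/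
structure LorenzMap (α : ℝ) where
  c : ℝ
  u : ℝ
  v : ℝ
  φm : ℝ → ℝ
  φp : ℝ → ℝ
  c_mem : c ∈ Ioo (0 : ℝ) 1
  u_mem : u ∈ Icc (0 : ℝ) 1
  v_mem : v ∈ Icc (0 : ℝ) 1
  φm_diffeo : IsDiffeoPart φm
  φp_diffeo : IsDiffeoPart φp

namespace LorenzMap

variable {α : ℝ}

/-- The left branch `f₋ : [0,c] → [0,1]`. -/
def left (f : LorenzMap α) (x : ℝ) : ℝ :=
  f.φm (f.u * (1 - ((f.c - x) / f.c) ^ α))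

/-- The right branch `f₊ : [c,1] → [0,1]`. -/
def right (f : LorenzMap α) (x : ℝ) : ℝ :=
  f.φp (1 + f.v * (-1 + ((x - f.c) / (1 - f.c)) ^ α))

/-- The map itself; its domain is `[0,1] \ {c}`, and the value given at `c` is never used. -/
def toFun (f : LorenzMap α) (x : ℝ) : ℝ := if x < f.c then f.left x else f.right x

/-- Both branches contain the critical point in the interior of their image. -/
def Nontrivial (f : LorenzMap α) : Prop := f.right f.c < f.c ∧ f.c < f.left f.c

/-- Both branches are onto `[0,1]`. -/
def IsFull (f : LorenzMap α) : Prop := f.left f.c = 1 ∧ f.right f.c = 0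

/-- At least one branch is trivial (`f₋([0,c]) = [0,c]` or `f₊([c,1]) = [c,1]`), and the map is
otherwise a limit case of a nontrivial map. -/
def HasTrivialBranch (f : LorenzMap α) : Prop :=
  f.right f.c ≤ f.c ∧ f.c ≤ f.left f.c ∧ (f.left f.c = f.c ∨ f.right f.c = f.c)

/-- The only fixed points are `0` and `1`. -/
def OnlyFixesEndpoints (f : LorenzMap α) : Prop :=
  ∀ x ∈ Icc (0 : ℝ) 1, x ≠ f.c → f.toFun x = x → x = 0 ∨ x = 1

/-- `C^2`-distance of both diffeomorphic parts to the identity at most `δ`. -/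
def CloseToStandard (f : LorenzMap α) (δ : ℝ) : Prop :=
  ∀ φ ∈ ({f.φm, f.φp} : Set (ℝ → ℝ)), ∀ x ∈ Icc (0 : ℝ) 1,
    |φ x - x| ≤ δ ∧ |iD 1 φ x - 1| ≤ δ ∧ |iD 2 φ x| ≤ δ

/-- `C = [l,r]` is a closed interval, properly contained in `[0,1]`, with the critical point of `f`
in its interior, and the first-return map of `f` to `C`, affinely rescaled to `[0,1]`, is the
nontrivial Lorenz map `g`. -/
structure IsReturnMap (f : LorenzMap α) (l r : ℝ) (g : LorenzMap α) : Prop where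
  l_nonneg : 0 ≤ l
  r_le_one : r ≤ 1
  proper : ¬ (l = 0 ∧ r = 1)
  l_lt : l < f.c
  lt_r : f.c < r
  nontrivial : g.Nontrivial
  fixes : g.OnlyFixesEndpoints
  crit : g.c = (f.c - l) / (r - l)
  firstReturn : ∀ x ∈ Icc l r, x ≠ f.c → ∃ n : ℕ, 0 < n ∧ f.toFun^[n] x ∈ Icc l r ∧
    (∀ m : ℕ, 0 < m → m < n → f.toFun^[m] x ∉ Icc l r) ∧
    (f.toFun^[n] x - l) / (r - l) = g.toFun ((x - l) / (r - l))

/-- `g` is the renormalization of `f`, with return interval `C = [l,r]`, the largest possible. -/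
def IsRenormalization (f : LorenzMap α) (l r : ℝ) (g : LorenzMap α) : Prop :=
  f.IsReturnMap l r g ∧
    ∀ (l' r' : ℝ) (g' : LorenzMap α), f.IsReturnMap l' r' g' → Icc l' r' ⊆ Icc l r

/-- Monotone type with return times `a + 1`, `b + 1`: after the first step, `[l,c)` stays to the
right of the critical point until it returns at time `a + 1`, and `(c,r]` stays to the left of the
critical point until it returns at time `b + 1`. -/
def IsMonotoneType (f : LorenzMap α) (l r : ℝ) (a b : ℕ) : Prop :=
  1 ≤ a ∧ 1 ≤ b ∧
  (∀ x ∈ Ico l f.c, f.toFun^[a + 1] x ∈ Icc l r ∧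
    ∀ i : ℕ, 1 ≤ i → i ≤ a → f.toFun^[i] x ∉ Icc l r ∧ f.c < f.toFun^[i] x) ∧
  (∀ x ∈ Ioc f.c r, f.toFun^[b + 1] x ∈ Icc l r ∧
    ∀ i : ℕ, 1 ≤ i → i ≤ b → f.toFun^[i] x ∉ Icc l r ∧ f.toFun^[i] x < f.c)

/-- `f` is `(a,b)`-renormalizable with renormalization `g`. -/
def RenormalizesTo (f : LorenzMap α) (a b : ℕ) (g : LorenzMap α) : Prop :=
  ∃ l r : ℝ, f.IsRenormalization l r g ∧ f.IsMonotoneType l r a b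

end LorenzMap

/-- A family of Lorenz maps with parameter set `U`. Maps with a trivial branch are allowed on the
boundary of `U`; all other maps are nontrivial. Only the values of `F` on `U` matter. -/
structure IsLorenzFamily {α : ℝ} (U : Set (ℝ × ℝ)) (F : ℝ × ℝ → LorenzMap α) : Prop where
  compact : IsCompact U
  simplyConnected : SimplyConnectedSpace U
  fixes : ∀ t ∈ U, (F t).OnlyFixesEndpoints
  nontrivial : ∀ t ∈ U, (F t).Nontrivial ∨ (t ∈ frontier U ∧ (F t).HasTrivialBranch)

/-- `t ↦ h t` is real-analytic on `U`, i.e. it extends analytically to a neighbourhood of `U`. -/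
def AnalyticParam {E : Type*} [NormedAddCommGroup E] [NormedSpace ℝ E]
    (U : Set (ℝ × ℝ)) (h : ℝ × ℝ → E) : Prop :=
  ∃ H : ℝ × ℝ → E, AnalyticOnNhd ℝ H U ∧ EqOn H h U

/-- `t ↦ φ t` is real-analytic on `U` as a map into `C^3([0,1])`: the derivatives of order at most
three are analytic as maps into `C([0,1])`. -/
def AnalyticDiffeoParam (U : Set (ℝ × ℝ)) (φ : ℝ × ℝ → ℝ → ℝ) : Prop :=
  ∀ k ≤ 3, ∃ J : ℝ × ℝ → C(Icc (0 : ℝ) 1, ℝ), AnalyticOnNhd ℝ J U ∧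
    ∀ t ∈ U, ∀ x : Icc (0 : ℝ) 1, J t x = iD k (φ t) x

/-- The family depends analytically on the parameter. -/
structure IsAnalyticFamily {α : ℝ} (U : Set (ℝ × ℝ)) (F : ℝ × ℝ → LorenzMap α) : Prop where
  c : AnalyticParam U fun t => (F t).c
  u : AnalyticParam U fun t => (F t).u
  v : AnalyticParam U fun t => (F t).v
  φm : AnalyticDiffeoParam U fun t => (F t).φm
  φp : AnalyticDiffeoParam U fun t => (F t).φp

/-- `p` is the unique parameter in `U` whose map is full. -/
def IsUniqueFull {α : ℝ} (U : Set (ℝ × ℝ)) (F : ℝ × ℝ → LorenzMap α) (p : ℝ × ℝ) : Prop :=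
  p ∈ U ∧ (F p).IsFull ∧ ∀ t ∈ U, (F t).IsFull → t = p

/-- Near `p`, the set `S` is a finite union of sets `{g₁ ≥ 0, …, gₙ ≥ 0}`, `gⱼ` analytic. -/
def IsClosedSemianalyticAt (S : Set (ℝ × ℝ)) (p : ℝ × ℝ) : Prop :=
  ∃ (m n : ℕ) (g : Fin m → Fin n → ℝ × ℝ → ℝ), (∀ i j, AnalyticAt ℝ (g i j) p) ∧
    ∀ᶠ z in 𝓝 p, z ∈ S ↔ ∃ i, ∀ j, 0 ≤ g i j z

/-- The full map is unique in the analytic sense: near `p` the parameter set lies in a closed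
semianalytic set `S` on which `p` is still the only solution of `u = v = 1`, where `u`, `v` are
continued analytically beyond `U`. This holds if `p` is an isolated solution of `u = v = 1` in the
plane (take `S` to be the plane), and also if `p` is the unique full parameter in `U` and `U` itself
is closed semianalytic at `p`, such as a rectangle (take `S = U`). -/
def IsAnalyticallyUniqueFull {α : ℝ} (U : Set (ℝ × ℝ)) (F : ℝ × ℝ → LorenzMap α)
    (p : ℝ × ℝ) : Prop :=
  ∃ (S : Set (ℝ × ℝ)) (u v : ℝ × ℝ → ℝ), U ⊆ S ∧ IsClosedSemianalyticAt S p ∧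
    AnalyticAt ℝ u p ∧ AnalyticAt ℝ v p ∧
    (∀ t ∈ U, u t = (F t).u ∧ v t = (F t).v) ∧
    ∀ᶠ z in 𝓝 p, z ∈ S → u z = 1 → v z = 1 → z = p

/-- The `(a,b)`-archipelago. -/
def archipelago {α : ℝ} (U : Set (ℝ × ℝ)) (F : ℝ × ℝ → LorenzMap α) (a b : ℕ) :
    Set (ℝ × ℝ) :=
  {t ∈ U | ∃ g, (F t).RenormalizesTo a b g}

/-- An `(a,b)`-island: the closure of a connected component of the interior of the archipelago. -/
def IsIsland {α : ℝ} (U : Set (ℝ × ℝ)) (F : ℝ × ℝ → LorenzMap α) (a b : ℕ)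
    (D : Set (ℝ × ℝ)) : Prop :=
  ∃ t ∈ interior (archipelago U F a b),
    D = closure (connectedComponentIn (interior (archipelago U F a b)) t)

/-- `t` is a full vertex of the `(a,b)`-island `D`, and `g` is the renormalization of `F t`, which
is a full map. -/
def IsFullVertex {α : ℝ} (U : Set (ℝ × ℝ)) (F : ℝ × ℝ → LorenzMap α) (a b : ℕ)
    (D : Set (ℝ × ℝ)) (t : ℝ × ℝ) (g : LorenzMap α) : Prop :=
  t ∈ D ∧ t ∈ U ∧ (F t).RenormalizesTo a b g ∧ g.IsFull

end

/-! Let `C = [l, r]` be the return interval of a renormalizable `f` whose renormalization is full.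
Fullness means that `f₊^a` carries `[f₋(l), f₋(c)]` exactly onto `[l, r]`. By the critical exponent,
the first of these intervals has length about `ψ(0) s'^α`, where `s' = (c - l) / c` and `ψ` is the
derivative of the reflected left diffeomorphic part. The `a` iterates of `f₊` run close to the fixed
point `1` and stretch it by `λ^a`, `λ = Df(1)`, times a factor that converges. Hence `r - l ~ A s'^α
λ^a`. By symmetry `r - l ~ A' s^α κ^b`, with `s = (r - c) / (1 - c)` and `κ = Df(0)`. Equating the
two determines `s' / s`, and `c' / (1 - c') = c s' / ((1 - c) s)`; so `γ = A' / A`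
(`Branch.exists_return_factor`, `ratio_eq`).

The constant in the stretching exists because an orbit that ends near `c` after a long stay in `[c,
1]` shadows the backward orbit of `c`. That backward orbit tends to `1` geometrically, so the
product of slopes divided by `λ` converges (`Branch.exists_expansion_factor`).

Two points remain. First, parameters with `a, b → ∞` must converge to the full parameter. By
compactness it is enough that every limit map is full; orbits lingering in one branch force the
other to be full, and two trivial limit branches exclude each other (`tendsto_full_parameter`).

Second, `λ` and `κ` belong to the perturbed map, and replacing `λ^a` by its value at the full map
needs `a ‖t - p‖ → 0`. The geometric approach to the fixed points makes `1 - u` and `1 - v`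
exponentially small in `a` and `b`. A Łojasiewicz inequality `‖t - p‖ ^ m ≤ (1 - u) + (1 - v)` then
makes `‖t - p‖` exponentially small too, since `a` and `b` are comparable.

That inequality comes from `IsClosedSemianalyticAt.lojasiewicz`, a curve selection argument: if it
failed, a function would be flat along a sequence, a Newton–Puiseux process (`exists_arc_of_isFlat`)
would give an arc of zeros in infinite contact with the sequence, and the arc would lie in the
semianalytic set, against the isolation of the zero. -/

/-! ### Analytic functions of two variables: Taylor remainder and implicit functions -/

/-- The partial derivative in the second variable. -/
noncomputable def dSnd (f : ℝ × ℝ → ℝ) (z : ℝ × ℝ) : ℝ := fderiv ℝ f z (0, 1)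

theorem AnalyticAt.dSnd {f : ℝ × ℝ → ℝ} {z : ℝ × ℝ} (hf : AnalyticAt ℝ f z) :
    AnalyticAt ℝ (dSnd f) z :=
  ((ContinuousLinearMap.apply ℝ ℝ ((0, 1) : ℝ × ℝ)).analyticAt _).comp hf.fderiv

theorem AnalyticAt.iterate_dSnd {f : ℝ × ℝ → ℝ} {z : ℝ × ℝ} (hf : AnalyticAt ℝ f z) (n : ℕ) :
    AnalyticAt ℝ (_root_.dSnd^[n] f) z := by
  induction n generalizing f with
  | zero => exact hf
  | succ n ih => exact ih hf.dSnd

theorem AnalyticAt.hasDerivAt_snd {f : ℝ × ℝ → ℝ} {x y : ℝ} (hf : AnalyticAt ℝ f (x, y)) :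
    HasDerivAt (fun w => f (x, w)) (_root_.dSnd f (x, y)) y := by
  have h1 : HasDerivAt (fun w : ℝ => ((x, w) : ℝ × ℝ)) (0, 1) y :=
    (hasDerivAt_const y x).prodMk (hasDerivAt_id y)
  exact hf.differentiableAt.hasFDerivAt.comp_hasDerivAt y h1

/-- Scaling of the second coordinate. -/
noncomputable def scaleSnd (t : ℝ) : ℝ × ℝ →L[ℝ] ℝ × ℝ :=
  (ContinuousLinearMap.fst ℝ ℝ ℝ).prod (t • ContinuousLinearMap.snd ℝ ℝ ℝ)

@[simp] theorem scaleSnd_apply (t : ℝ) (z : ℝ × ℝ) : scaleSnd t z = (z.1, t * z.2) := rfl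

theorem norm_scaleSnd_apply_le {t : ℝ} (ht : |t| ≤ 1) (z : ℝ × ℝ) : ‖scaleSnd t z‖ ≤ ‖z‖ := by
  rw [scaleSnd_apply, Prod.norm_def, Prod.norm_def]
  refine max_le_max le_rfl ?_
  rw [norm_mul]
  exact mul_le_of_le_one_left (norm_nonneg _) ht

theorem norm_scaleSnd_le {t : ℝ} (ht : |t| ≤ 1) : ‖scaleSnd t‖ ≤ 1 :=
  ContinuousLinearMap.opNorm_le_bound _ zero_le_one fun z => by
    simpa using norm_scaleSnd_apply_le ht z

theorem continuous_scaleSnd : Continuous scaleSnd := by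
  have h : scaleSnd = fun t => (ContinuousLinearMap.inl ℝ ℝ ℝ).comp (ContinuousLinearMap.fst ℝ ℝ ℝ)
      + t • (ContinuousLinearMap.inr ℝ ℝ ℝ).comp (ContinuousLinearMap.snd ℝ ℝ ℝ) := by
    funext t
    ext <;> simp [scaleSnd]
  rw [h]
  fun_prop

/-- The power series of `R` is integrated term by term. For `t` in `[0, 1]` the scaling has norm at
most one, so each coefficient stays bounded by `‖p n‖` and the radius of convergence does not
shrink. -/
theorem AnalyticAt.integral_scaleSnd {R : ℝ × ℝ → ℝ} (hR : AnalyticAt ℝ R 0) (d : ℕ) :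
    AnalyticAt ℝ (fun z => ∫ t in (0 : ℝ)..1, t ^ d * R (scaleSnd t z)) 0 := by
  obtain ⟨p, r, hp⟩ := hR
  set Q : (n : ℕ) → ℝ → ContinuousMultilinearMap ℝ (fun _ : Fin n => ℝ × ℝ) ℝ :=
    fun n t => t ^ d • (p n).compContinuousLinearMap (fun _ => scaleSnd t) with hQ
  have hQc : ∀ n, Continuous (Q n) := by
    intro n
    have h1 : Continuous fun t : ℝ =>
        ContinuousMultilinearMap.compContinuousLinearMapContinuousMultilinear ℝ
          (fun _ : Fin n => ℝ × ℝ) (fun _ : Fin n => ℝ × ℝ) ℝ (fun _ => scaleSnd t) (p n) :=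
      ((ContinuousMultilinearMap.cont _).comp
        (continuous_pi fun _ => continuous_scaleSnd)).clm_apply continuous_const
    exact (continuous_id.pow d).smul h1
  have habs : ∀ t ∈ Set.uIoc (0 : ℝ) 1, |t| ≤ 1 := by
    intro t ht
    rw [uIoc_of_le zero_le_one] at ht
    rw [abs_of_pos ht.1]; exact ht.2
  have hQn : ∀ n, ∀ t ∈ Set.uIoc (0 : ℝ) 1, ‖Q n t‖ ≤ ‖p n‖ := by
    intro n t ht
    have h2 : ‖(p n).compContinuousLinearMap (fun _ => scaleSnd t)‖ ≤ ‖p n‖ := by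
      refine (ContinuousMultilinearMap.norm_compContinuousLinearMap_le _ _).trans ?_
      refine mul_le_of_le_one_right (norm_nonneg _) ?_
      exact Finset.prod_le_one (fun _ _ => norm_nonneg _) fun _ _ => norm_scaleSnd_le (habs t ht)
    simp only [hQ, norm_smul]
    calc ‖t ^ d‖ * _ ≤ 1 * ‖p n‖ := by
          refine mul_le_mul ?_ h2 (norm_nonneg _) zero_le_one
          rw [norm_pow]
          exact pow_le_one₀ (norm_nonneg _) (habs t ht)
      _ = ‖p n‖ := one_mul _
  refine ⟨fun n => ∫ t in (0 : ℝ)..1, Q n t, r, ?_, hp.r_pos, ?_⟩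
  · refine hp.r_le.trans ?_
    refine FormalMultilinearSeries.radius_le_of_le fun n => ?_
    simpa using intervalIntegral.norm_integral_le_of_norm_le_const (hQn n)
  · intro y hy
    have hQy : ∀ n t, Q n t (fun _ => y) = t ^ d * p n (fun _ => scaleSnd t y) := by
      intro n t
      simp [hQ, ContinuousMultilinearMap.compContinuousLinearMap_apply]
    have key : HasSum (fun n => ∫ t in (0 : ℝ)..1, Q n t (fun _ => y))
        (∫ t in (0 : ℝ)..1, t ^ d * R (scaleSnd t y)) := by
      have hy' : (‖y‖₊ : ENNReal) < p.radius :=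
        (by simpa [enorm_eq_nnnorm] using hy : (‖y‖₊ : ENNReal) < r).trans_le hp.r_le
      refine intervalIntegral.hasSum_integral_of_dominated_convergence
        (fun n _ => ‖p n‖ * ‖y‖ ^ n) ?_ ?_ ?_ ?_ ?_
      · intro n
        have : Continuous fun t => Q n t (fun _ => y) :=
          (ContinuousMultilinearMap.apply ℝ (fun _ : Fin n => ℝ × ℝ) ℝ
            (fun _ => y)).continuous.comp (hQc n)
        exact this.aestronglyMeasurable
      · intro n
        refine Eventually.of_forall fun t ht => ?_
        refine ((Q n t).le_opNorm _).trans ?_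
        simp only [Finset.prod_const, Finset.card_univ, Fintype.card_fin]
        exact mul_le_mul_of_nonneg_right (hQn n t ht) (by positivity)
      · exact Eventually.of_forall fun t _ => by
          simpa using p.summable_norm_mul_pow hy'
      · simp
      · refine Eventually.of_forall fun t ht => ?_
        simp only [hQy]
        refine HasSum.mul_left _ ?_
        have hmem : scaleSnd t y ∈ Metric.eball (0 : ℝ × ℝ) r := by
          have h3 : ‖scaleSnd t y‖₊ ≤ ‖y‖₊ := norm_scaleSnd_apply_le (habs t ht) y
          have : (‖scaleSnd t y‖₊ : ENNReal) < r :=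
            lt_of_le_of_lt (by exact_mod_cast h3)
              (by simpa [enorm_eq_nnnorm] using hy : (‖y‖₊ : ENNReal) < r)
          simpa [enorm_eq_nnnorm] using this
        simpa using hp.hasSum hmem
    have heq : ∀ n, (∫ t in (0 : ℝ)..1, Q n t) (fun _ => y)
        = ∫ t in (0 : ℝ)..1, Q n t (fun _ => y) := by
      intro n
      exact ((ContinuousMultilinearMap.apply ℝ (fun _ : Fin n => ℝ × ℝ) ℝ
        (fun _ => y)).intervalIntegral_comp_comm ((hQc n).intervalIntegrable _ _)).symm
    simpa [heq] using key

/-- Taylor expansion in the second variable with analytic remainder. -/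
theorem AnalyticAt.taylor_snd {f : ℝ × ℝ → ℝ} (hf : AnalyticAt ℝ f 0) (d : ℕ) :
    ∃ R : ℝ × ℝ → ℝ, AnalyticAt ℝ R 0 ∧ R 0 = (_root_.dSnd^[d] f) 0 / d.factorial ∧
      ∀ᶠ z in 𝓝 (0 : ℝ × ℝ), f z =
        ∑ i ∈ Finset.range d, (_root_.dSnd^[i] f) (z.1, 0) / i.factorial * z.2 ^ i
          + z.2 ^ d * R z := by
  induction d generalizing f with
  | zero => exact ⟨f, hf, by simp, by simp⟩
  | succ d ih =>
    obtain ⟨R, hR, hR0, hRe⟩ := ih hf.dSnd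
    -- The expansion of `dSnd f` is integrated along the segment from `(z.1, 0)` to `z`. Its
    -- remainder `R` turns into `∫ t ^ d * R (z.1, t * z.2)`, whose value at the origin gains the
    -- factor `1 / (d + 1)`.
    refine ⟨_, hR.integral_scaleSnd d, ?_, ?_⟩
    · have : ∀ t : ℝ, scaleSnd t 0 = 0 := fun t => map_zero _
      simp only [this]
      rw [intervalIntegral.integral_mul_const, integral_pow, hR0, Function.iterate_succ_apply]
      rw [Nat.factorial_succ]
      push_cast
      field_simp
      simp
    · have h1 := hRe.and (hf.eventually_analyticAt.and hR.eventually_analyticAt)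
      obtain ⟨ε, hε, hb⟩ := Metric.eventually_nhds_iff_ball.1 h1
      filter_upwards [Metric.ball_mem_nhds 0 hε] with z hz
      have hmem : ∀ t ∈ Icc (0 : ℝ) 1, scaleSnd t z ∈ Metric.ball (0 : ℝ × ℝ) ε := by
        intro t ht
        rw [mem_ball_zero_iff] at hz ⊢
        exact (norm_scaleSnd_apply_le (by rw [abs_of_nonneg ht.1]; exact ht.2) z).trans_lt hz
      have hu : uIcc (0 : ℝ) 1 = Icc 0 1 := uIcc_of_le zero_le_one
      have hRint : IntervalIntegrable (fun t => t ^ d * R (scaleSnd t z))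
          MeasureTheory.volume 0 1 := by
        refine ContinuousOn.intervalIntegrable ?_
        rw [hu]
        refine (continuous_id.pow d).continuousOn.mul fun t ht => ?_
        have h2 : ContinuousAt R (scaleSnd t z) := (hb _ (hmem t ht)).2.2.continuousAt
        have h3 : ContinuousAt (fun t => scaleSnd t z) t :=
          (continuous_scaleSnd.clm_apply continuous_const).continuousAt
        exact (ContinuousAt.comp (f := fun t => scaleSnd t z) h2 h3).continuousWithinAt
      have hder : ∀ t ∈ uIcc (0 : ℝ) 1,
          HasDerivAt (fun t => f (scaleSnd t z)) (z.2 * _root_.dSnd f (scaleSnd t z)) t := by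
        intro t ht
        rw [hu] at ht
        have h2 := (hb _ (hmem t ht)).2.1
        rw [scaleSnd_apply] at h2
        have h3 := h2.hasDerivAt_snd.comp t ((hasDerivAt_id t).mul_const z.2)
        rw [one_mul, mul_comm] at h3
        exact h3
      have hexp : ∀ t ∈ uIcc (0 : ℝ) 1, z.2 * _root_.dSnd f (scaleSnd t z) =
          ∑ i ∈ Finset.range d, (_root_.dSnd^[i + 1] f) (z.1, 0) / i.factorial * z.2 ^ (i + 1)
            * t ^ i + z.2 ^ (d + 1) * (t ^ d * R (scaleSnd t z)) := by
        intro t ht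
        rw [hu] at ht
        rw [(hb _ (hmem t ht)).1, mul_add, Finset.mul_sum]
        congr 1
        · refine Finset.sum_congr rfl fun i _ => ?_
          simp only [scaleSnd_apply, Function.iterate_succ_apply]
          ring
        · simp only [scaleSnd_apply]; ring
      have hInt1 : IntervalIntegrable (fun t : ℝ => ∑ i ∈ Finset.range d,
          (_root_.dSnd^[i + 1] f) (z.1, 0) / i.factorial * z.2 ^ (i + 1) * t ^ i)
          MeasureTheory.volume 0 1 := by
        refine Continuous.intervalIntegrable ?_ _ _
        fun_prop
      have hInt : IntervalIntegrable (fun t => z.2 * _root_.dSnd f (scaleSnd t z))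
          MeasureTheory.volume 0 1 := by
        refine (hInt1.add (hRint.const_mul (z.2 ^ (d + 1)))).congr ?_
        intro t ht
        exact (hexp t (uIoc_subset_uIcc ht)).symm
      have hftc := intervalIntegral.integral_eq_sub_of_hasDerivAt hder hInt
      rw [intervalIntegral.integral_congr hexp, intervalIntegral.integral_add hInt1
        (hRint.const_mul _), intervalIntegral.integral_const_mul,
        intervalIntegral.integral_finsetSum] at hftc
      · rw [Finset.sum_range_succ']
        have h1z : f (scaleSnd 1 z) = f z := by simp
        have h0z : f (scaleSnd 0 z) = f (z.1, 0) := by simp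
        rw [h1z, h0z] at hftc
        have hs : ∀ i ∈ Finset.range d, (∫ t in (0 : ℝ)..1,
            (_root_.dSnd^[i + 1] f) (z.1, 0) / i.factorial * z.2 ^ (i + 1) * t ^ i) =
            (_root_.dSnd^[i + 1] f) (z.1, 0) / (i + 1).factorial * z.2 ^ (i + 1) := by
          intro i _
          rw [intervalIntegral.integral_const_mul, integral_pow, Nat.factorial_succ]
          push_cast
          field_simp
          simp
        rw [Finset.sum_congr rfl hs] at hftc
        simp only [Function.iterate_zero, id_eq, Nat.factorial_zero, Nat.cast_one, div_one, pow_zero, mul_one]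
        linarith
      · intro i _
        refine Continuous.intervalIntegrable ?_ _ _
        fun_prop

/-- Analytic implicit function theorem in the plane. -/
theorem AnalyticAt.exists_implicit {G : ℝ × ℝ → ℝ} (hG : AnalyticAt ℝ G 0) (h0 : G 0 = 0)
    (h1 : _root_.dSnd G 0 ≠ 0) :
    ∃ φ : ℝ → ℝ, AnalyticAt ℝ φ 0 ∧ φ 0 = 0 ∧ ∀ᶠ x in 𝓝 (0 : ℝ), G (x, φ x) = 0 := by
  have hc : ContDiffAt ℝ ⊤ G 0 := hG.contDiffAt
  have hinv : (fderiv ℝ G 0 ∘L .inr ℝ ℝ ℝ).IsInvertible := by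
    refine ⟨ContinuousLinearEquiv.unitsEquivAut ℝ (Units.mk0 _ h1), ?_⟩
    ext
    simp [_root_.dSnd]
  have hne : (⊤ : WithTop ℕ∞) ≠ 0 := by simp
  refine ⟨hc.implicitFunction hne hinv, ?_, ?_, ?_⟩
  · have := hc.contDiffAt_implicitFunction hne hinv
    exact this.analyticAt
  · exact hc.implicitFunction_apply_self hne hinv
  · have := hc.eventually_apply_implicitFunction hne hinv
    simpa [h0] using this

open Asymptotics

/-! ### The Newton polygon -/

theorem dSnd_congr {f g : ℝ × ℝ → ℝ} {z : ℝ × ℝ} (h : f =ᶠ[𝓝 z] g) :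
    dSnd f =ᶠ[𝓝 z] dSnd g := by
  filter_upwards [h.fderiv (𝕜 := ℝ)] with w hw
  rw [dSnd, dSnd, hw]

/-- A shift of the second variable by a function of the first has unit derivative in the second. The
equality is one of germs, because `f` is analytic only near the origin. -/
theorem iterate_dSnd_shift {f : ℝ × ℝ → ℝ} {φ : ℝ → ℝ} (hf : AnalyticAt ℝ f 0)
    (hφ : AnalyticAt ℝ φ 0) (h0 : φ 0 = 0) (n : ℕ) :
    dSnd^[n] (fun z => f (z.1, z.2 + φ z.1)) =ᶠ[𝓝 0]
      fun z => (dSnd^[n] f) (z.1, z.2 + φ z.1) := by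
  have hφ' : AnalyticAt ℝ φ ((0 : ℝ × ℝ).1) := hφ
  have hsh : AnalyticAt ℝ (fun z : ℝ × ℝ => (z.1, z.2 + φ z.1)) 0 :=
    analyticAt_fst.prod (analyticAt_snd.add (hφ'.comp analyticAt_fst))
  induction n with
  | zero => rfl
  | succ n ih =>
    rw [Function.iterate_succ_apply', Function.iterate_succ_apply']
    refine (dSnd_congr ih).trans ?_
    have h1 : ∀ᶠ z in 𝓝 (0 : ℝ × ℝ), AnalyticAt ℝ (dSnd^[n] f) (z.1, z.2 + φ z.1) := by
      have : Tendsto (fun z : ℝ × ℝ => (z.1, z.2 + φ z.1)) (𝓝 0) (𝓝 0) := by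
        have h := hsh.continuousAt.tendsto
        simpa [h0, ← Prod.mk_zero_zero] using h
      exact this.eventually (hf.iterate_dSnd n).eventually_analyticAt
    filter_upwards [h1, hsh.eventually_analyticAt] with z hz1 hz2
    have h2 : AnalyticAt ℝ (fun z : ℝ × ℝ => (dSnd^[n] f) (z.1, z.2 + φ z.1)) z :=
      AnalyticAt.comp (g := dSnd^[n] f) hz1 hz2
    have h3 : HasDerivAt (fun w => (dSnd^[n] f) (z.1, w + φ z.1)) _ z.2 :=
      AnalyticAt.hasDerivAt_snd (x := z.1) (y := z.2) h2
    have h4 : HasDerivAt (fun w => (dSnd^[n] f) (z.1, w + φ z.1)) _ z.2 :=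
      HasDerivAt.comp_add_const z.2 (φ z.1) hz1.hasDerivAt_snd
    exact h3.unique h4

theorem iterate_dSnd_zero_eq {f : ℝ × ℝ → ℝ} (hf : AnalyticAt ℝ f 0) (n : ℕ) :
    (dSnd^[n] f) 0 = iteratedDeriv n (fun w => f (0, w)) 0 := by
  induction n generalizing f with
  | zero => rfl
  | succ n ih =>
    rw [Function.iterate_succ_apply, ih hf.dSnd, iteratedDeriv_succ']
    refine (Filter.EventuallyEq.iteratedDeriv_eq n ?_).symm
    have h : Tendsto (fun w : ℝ => ((0 : ℝ), w)) (𝓝 0) (𝓝 (0 : ℝ × ℝ)) := by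
      have : Continuous fun w : ℝ => ((0 : ℝ), w) := by fun_prop
      exact this.tendsto' _ _ rfl
    filter_upwards [h.eventually hf.eventually_analyticAt] with w hw
    exact hw.hasDerivAt_snd.deriv

/-- The substitution adapted to the steepest edge of the Newton polygon. -/
theorem exists_newton_slope {d : ℕ} {a : ℕ → ℝ → ℝ} (ha : ∀ i < d, AnalyticAt ℝ (a i) 0)
    (ha0 : ∀ i < d, a i 0 = 0) (hne : ∃ i < d, ¬ ∀ᶠ x in 𝓝 (0 : ℝ), a i x = 0) :
    ∃ (p q i₀ : ℕ) (B : ℕ → ℝ → ℝ), 0 < p ∧ 0 < q ∧ i₀ < d ∧ (∀ i < d, AnalyticAt ℝ (B i) 0) ∧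
      (∀ i < d, ∀ᶠ s in 𝓝 (0 : ℝ), a i (s ^ q) = s ^ (p * (d - i)) * B i s) ∧ B i₀ 0 ≠ 0 ∧
      ∀ i < d, (∀ᶠ x in 𝓝 (0 : ℝ), a i x = 0) → B i 0 = 0 := by
  classical
  set I := (Finset.range d).filter (fun i => ¬ ∀ᶠ x in 𝓝 (0 : ℝ), a i x = 0) with hI
  have hIne : I.Nonempty := by
    obtain ⟨i, hi, hi'⟩ := hne
    exact ⟨i, by simp only [hI, Finset.mem_filter, Finset.mem_range]; exact ⟨hi, hi'⟩⟩
  have hfac : ∀ i ∈ I, ∃ (n : ℕ) (b : ℝ → ℝ), AnalyticAt ℝ b 0 ∧ b 0 ≠ 0 ∧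
      ∀ᶠ x in 𝓝 (0 : ℝ), a i x = x ^ n * b x := by
    intro i hi
    simp only [hI, Finset.mem_filter, Finset.mem_range] at hi
    have := (ha i hi.1).exists_eventuallyEq_pow_smul_nonzero_iff.2 hi.2
    simpa using this
  choose! n b hb hb0 hab using hfac
  -- With `n i` the order of `a i`, the slope is the least value of `n i / (d - i)`; `p = n i₀` and
  -- `q = d - i₀` need not be coprime. Minimality is `hle`: after `x = s ^ q` the exponent `q * n i
  -- - p * (d - i)` left over is nonnegative, and it is zero at `i₀`.
  obtain ⟨i₀, hi₀, hmin⟩ := Finset.exists_min_image I (fun i => (n i : ℚ) / ((d - i : ℕ) : ℚ)) hIne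
  have hlt : ∀ i ∈ I, i < d := by
    intro i hi
    simp only [hI, Finset.mem_filter, Finset.mem_range] at hi
    exact hi.1
  have hle : ∀ i ∈ I, n i₀ * (d - i) ≤ (d - i₀) * n i := by
    intro i hi
    have h1 := hmin i hi
    have hpos : ∀ j ∈ I, (0 : ℚ) < ((d - j : ℕ) : ℚ) := fun j hj => by
      have := hlt j hj
      exact_mod_cast (by omega : 0 < d - j)
    rw [div_le_div_iff₀ (hpos _ hi₀) (hpos _ hi)] at h1
    have h2 : n i₀ * (d - i) ≤ n i * (d - i₀) := by exact_mod_cast h1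
    linarith [mul_comm (n i) (d - i₀)]
  have hq : 0 < d - i₀ := by have := hlt _ hi₀; omega
  have hp : 0 < n i₀ := by
    rcases Nat.eq_zero_or_pos (n i₀) with h | h
    · exfalso
      have h1 := (hab _ hi₀).self_of_nhds
      rw [ha0 _ (hlt _ hi₀), h] at h1
      simp at h1
      exact hb0 _ hi₀ h1.symm
    · exact h
  have hpow : Tendsto (fun s : ℝ => s ^ (d - i₀)) (𝓝 0) (𝓝 0) := by
    have : Continuous fun s : ℝ => s ^ (d - i₀) := by fun_prop
    exact this.tendsto' _ _ (by simp [hq.ne'])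
  refine ⟨n i₀, d - i₀, i₀, fun i s => if i ∈ I then
    s ^ ((d - i₀) * n i - n i₀ * (d - i)) * b i (s ^ (d - i₀)) else 0, hp, hq, hlt _ hi₀,
    ?_, ?_, ?_, ?_⟩
  · intro i _
    by_cases hi : i ∈ I
    · simp only [hi, if_true]
      refine (analyticAt_id.pow _).mul ?_
      have h1 : AnalyticAt ℝ (b i) ((fun s : ℝ => s ^ (d - i₀)) 0) := by
        simpa [hq.ne'] using hb i hi
      exact AnalyticAt.comp (f := fun s : ℝ => s ^ (d - i₀)) h1 (analyticAt_id.pow _)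
    · simp only [hi, if_false]
      exact analyticAt_const
  · intro i hi
    by_cases hiI : i ∈ I
    · filter_upwards [hpow.eventually (hab i hiI)] with s hs
      simp only [hiI, if_true]
      rw [hs, ← mul_assoc, ← pow_add, Nat.add_sub_cancel' (hle i hiI), pow_mul]
    · have h0 : ∀ᶠ x in 𝓝 (0 : ℝ), a i x = 0 := by
        by_contra hcon
        exact hiI (by simp only [hI, Finset.mem_filter, Finset.mem_range]; exact ⟨hi, hcon⟩)
      filter_upwards [hpow.eventually h0] with s hs
      simp only [hiI, if_false, hs, mul_zero]
  · simp only [hi₀, if_true]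
    rw [mul_comm (n i₀), Nat.sub_self]
    simpa [hq.ne'] using hb0 _ hi₀
  · intro i _ h0
    have : i ∉ I := by
      simp only [hI, Finset.mem_filter, Finset.mem_range]
      exact fun h => h.2 h0
    simp only [this, if_false]

open Polynomial in
theorem Polynomial.iteratedDeriv_eval_zero (P : ℝ[X]) (k : ℕ) :
    iteratedDeriv k (fun w => P.eval w) 0 = k.factorial * P.coeff k := by
  have h : ∀ P : ℝ[X], iteratedDeriv k (fun w => P.eval w) = fun w => (derivative^[k] P).eval w := by
    induction k with
    | zero => intro P; simp
    | succ k ih =>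
      intro P
      rw [iteratedDeriv_succ', Function.iterate_succ_apply, ← ih]
      congr 1
      funext w
      exact P.deriv
  rw [h]
  beta_reduce
  rw [← Polynomial.coeff_zero_eq_eval_zero, Polynomial.coeff_iterate_derivative]
  simp [Nat.descFactorial_self]

open Polynomial in
/-- A polynomial of degree `d` without term of degree `d - 1` which is not a monomial has no root
of multiplicity `d`. -/
theorem exists_iteratedDeriv_ne_zero {d i₀ : ℕ} {b : ℕ → ℝ} {r c : ℝ} (hr : r ≠ 0) (hd : 0 < d)
    (hb : b (d - 1) = 0) (hi₀ : i₀ < d) (hbi : b i₀ ≠ 0) :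
    ∃ k < d, iteratedDeriv k
      (fun w => ∑ i ∈ Finset.range d, b i * (c + w) ^ i + (c + w) ^ d * r) 0 ≠ 0 := by
  by_contra! hcon
  set Q : ℝ[X] := ∑ i ∈ Finset.range d, C (b i) * X ^ i + C r * X ^ d with hQ
  have hQc : ∀ i < d, Q.coeff i = b i := by
    intro i hi
    simp only [hQ, coeff_add, finsetSum_coeff, coeff_C_mul, coeff_X_pow]
    simp [hi, hi.ne]
  have hQd : Q.coeff d = r := by
    simp only [hQ, coeff_add, finsetSum_coeff, coeff_C_mul, coeff_X_pow]
    simp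
  have hdeg : Q.natDegree ≤ d := by
    refine natDegree_add_le_of_degree_le ?_ (natDegree_C_mul_X_pow_le _ _)
    refine natDegree_sum_le_of_forall_le _ _ fun i hi => ?_
    exact (natDegree_C_mul_X_pow_le _ _).trans (Finset.mem_range.1 hi).le
  have hfun : (fun w => ∑ i ∈ Finset.range d, b i * (c + w) ^ i + (c + w) ^ d * r)
      = fun w => (taylor c Q).eval w := by
    funext w
    simp [taylor_apply, hQ, eval_finsetSum, add_comm w c, mul_comm r]
  rw [hfun] at hcon
  have hc0 : ∀ k < d, (taylor c Q).coeff k = 0 := by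
    intro k hk
    have := hcon k hk
    rw [Polynomial.iteratedDeriv_eval_zero] at this
    simpa [Nat.factorial_ne_zero] using this
  -- Only the top coefficient at `c` survives, so `Q = r' (X - c) ^ d`. The coefficient of degree `d
  -- - 1` is `-d c r'`; its vanishing forces `c = 0`, and then every lower coefficient is zero,
  -- against `b i₀ ≠ 0`.
  have hT : ∃ r' : ℝ, taylor c Q = C r' * X ^ d := by
    refine ⟨(taylor c Q).coeff d, ?_⟩
    ext k
    rw [coeff_C_mul, coeff_X_pow]
    rcases lt_trichotomy k d with h | h | h
    · simp [hc0 k h, h.ne]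
    · simp [h]
    · rw [coeff_eq_zero_of_natDegree_lt (by rw [natDegree_taylor]; omega)]
      simp [h.ne']
  obtain ⟨r', hT⟩ := hT
  have hQ' : Q = C r' * (X + C (-c)) ^ d := by
    have h1 : taylor (-c) (taylor c Q) = Q := by
      rw [taylor_taylor]; simp
    rw [← h1, hT, taylor_apply]
    simp
  have hco : ∀ k, Q.coeff k = r' * ((-c) ^ (d - k) * (d.choose k : ℝ)) := by
    intro k
    rw [hQ', coeff_C_mul, coeff_X_add_C_pow]
  have hrr : r' = r := by
    rw [← hQd, hco]; simp
  have h1 := hco (d - 1)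
  rw [hQc _ (by omega), hb, hrr, Nat.sub_sub_self hd, pow_one] at h1
  have hch : ((d.choose (d - 1) : ℕ) : ℝ) ≠ 0 := by
    exact_mod_cast (Nat.choose_pos (by omega)).ne'
  have hcz : c = 0 := by
    have := h1.symm
    simpa [hr, hch] using this
  have h2 := hco i₀
  rw [hQc _ hi₀, hcz] at h2
  refine hbi ?_
  rw [h2]
  have : d - i₀ ≠ 0 := by omega
  simp [this]

/-! ### Flat sequences and Puiseux arcs -/

/-- `g` is smaller than every power of `x` along the filter `L`. -/
def IsFlat {ι : Type*} (L : Filter ι) (x g : ι → ℝ) : Prop :=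
  ∀ N : ℕ, g =O[L] fun i => x i ^ N

namespace IsFlat

variable {ι : Type*} {L : Filter ι} {x g h : ι → ℝ}

theorem tendsto_zero (hx : Tendsto x L (𝓝[>] 0)) (hg : IsFlat L x g) : Tendsto g L (𝓝 0) := by
  refine (hg 1).trans_tendsto ?_
  simpa using hx.mono_right nhdsWithin_le_nhds

theorem to_pow {s : ι → ℝ} {q : ℕ} (hq : 0 < q) (hs0 : Tendsto s L (𝓝[>] 0))
    (hs : ∀ᶠ i in L, s i ^ q = x i) (hg : IsFlat L x g) : IsFlat L s g := by
  intro N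
  refine (hg N).trans ?_
  refine IsBigO.of_bound 1 ?_
  have h0 : ∀ᶠ i in L, s i ∈ Ioo (0 : ℝ) 1 :=
    hs0.eventually (Ioo_mem_nhdsGT zero_lt_one)
  filter_upwards [hs, h0] with i hi h0
  rw [← hi, ← pow_mul, Real.norm_of_nonneg (pow_nonneg h0.1.le _),
    Real.norm_of_nonneg (pow_nonneg h0.1.le _), one_mul]
  exact pow_le_pow_of_le_one h0.1.le h0.2.le (Nat.le_mul_of_pos_left _ hq)

theorem of_mul_pow {k : ℕ} (hx : Tendsto x L (𝓝[>] 0))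
    (hg : IsFlat L x fun i => x i ^ k * g i) : IsFlat L x g := by
  intro N
  have h0 : ∀ᶠ i in L, 0 < x i := hx.eventually self_mem_nhdsWithin
  obtain ⟨C, hC⟩ := (hg (k + N)).bound
  refine IsBigO.of_bound C ?_
  filter_upwards [hC, h0] with i hi h0
  rw [norm_mul, pow_add, norm_mul] at hi
  have h1 : 0 < ‖x i ^ k‖ := norm_pos_iff.2 (pow_pos h0 _).ne'
  refine le_of_mul_le_mul_left ?_ h1
  linarith [mul_left_comm C ‖x i ^ k‖ ‖x i ^ N‖]

/-- The factor `r` is bounded away from zero, so `g ^ d` is flat; the root is paid for by using the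
exponent `N * d` in place of `N`. -/
theorem of_pow_mul {d : ℕ} {r : ι → ℝ} {r₀ : ℝ} (hd : 0 < d) (hr : Tendsto r L (𝓝 r₀))
    (hr₀ : r₀ ≠ 0) (hg : IsFlat L x fun i => g i ^ d * r i) : IsFlat L x g := by
  intro N
  have h1 : (fun i => g i ^ d) =O[L] fun i => (x i ^ N) ^ d := by
    have h2 := hg (N * d)
    have h3 : (fun i => (r i)⁻¹) =O[L] fun _ => (1 : ℝ) := (hr.inv₀ hr₀).isBigO_one ℝ
    refine (h2.mul h3).congr' ?_ ?_
    · have h4 : ∀ᶠ i in L, r i ≠ 0 := hr.eventually_ne hr₀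
      filter_upwards [h4] with i hi
      field_simp
    · refine Eventually.of_forall fun i => ?_
      simp [pow_mul]
  exact IsBigO.of_pow hd.ne' h1

theorem mul_left {k : ι → ℝ} {k₀ : ℝ} (hk : Tendsto k L (𝓝 k₀)) (hg : IsFlat L x g) :
    IsFlat L x fun i => k i * g i := by
  intro N
  simpa using (hk.isBigO_one ℝ).mul (hg N)

theorem congr' (hg : IsFlat L x g) (h' : g =ᶠ[L] h) : IsFlat L x h :=
  fun N => (hg N).congr' h' EventuallyEq.rfl

end IsFlat

/-- Along an ultrafilter, compactness yields limits without passing to subsequences, so successive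
extractions cost nothing. -/
theorem Ultrafilter.exists_tendsto_of_eventually_mem {ι X : Type*} [TopologicalSpace X]
    (L : Ultrafilter ι) {K : Set X} (hK : IsCompact K) {f : ι → X} (h : ∀ᶠ i in L, f i ∈ K) :
    ∃ x ∈ K, Tendsto f L (𝓝 x) := by
  have : ((L.map f : Ultrafilter X) : Filter X) ≤ 𝓟 K := by
    rw [le_principal_iff]; exact h
  exact hK.ultrafilter_le_nhds (L.map f) this

/-- Sequences on which a monic-like polynomial expression tends to zero are bounded. -/
theorem exists_tendsto_of_newton {ι : Type*} (L : Ultrafilter ι) {d : ℕ} {β : ℕ → ι → ℝ}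
    {β₀ : ℕ → ℝ} (hβ : ∀ i < d, Tendsto (β i) L (𝓝 (β₀ i))) {ρ : ι → ℝ} {r : ℝ} (hr : r ≠ 0)
    (hρ : Tendsto ρ L (𝓝 r)) {Y : ι → ℝ}
    (hH : Tendsto (fun k => ∑ i ∈ Finset.range d, β i k * Y k ^ i + Y k ^ d * ρ k) L (𝓝 0)) :
    ∃ c, Tendsto Y L (𝓝 c) := by
  by_cases hbd : ∃ M : ℝ, ∀ᶠ k in L, |Y k| ≤ M
  · obtain ⟨M, hM⟩ := hbd
    obtain ⟨c, -, hc⟩ := L.exists_tendsto_of_eventually_mem (isCompact_Icc (a := -M) (b := M))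
      (hM.mono fun k hk => abs_le.1 hk)
    exact ⟨c, hc⟩
  · exfalso
    push Not at hbd
    -- Along an ultrafilter an unbounded `Y` tends to infinity in absolute value. Division by `Y ^
    -- d` then leaves only the leading coefficient in the limit, giving `r = 0`.
    have habs : Tendsto (fun k => |Y k|) L atTop := by
      rw [tendsto_atTop]
      intro M
      exact (hbd M).mono fun k hk => le_of_lt hk
    have hinv : Tendsto (fun k => (Y k)⁻¹) L (𝓝 0) := by
      rw [tendsto_zero_iff_abs_tendsto_zero]
      refine (tendsto_inv_atTop_zero.comp habs).congr fun k => ?_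
      simp [abs_inv]
    have hne : ∀ᶠ k in L, Y k ≠ 0 := by
      filter_upwards [habs.eventually_gt_atTop 0] with k hk
      exact abs_pos.1 hk
    have h1 : Tendsto (fun k => ∑ i ∈ Finset.range d, β i k * (Y k)⁻¹ ^ (d - i) + ρ k) L
        (𝓝 (∑ i ∈ Finset.range d, β₀ i * 0 ^ (d - i) + r)) := by
      refine Tendsto.add (tendsto_finsetSum _ fun i hi => ?_) hρ
      exact (hβ i (Finset.mem_range.1 hi)).mul (hinv.pow _)
    have h2 : ∑ i ∈ Finset.range d, β₀ i * (0 : ℝ) ^ (d - i) + r = r := by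
      rw [Finset.sum_eq_zero, zero_add]
      intro i hi
      have := Finset.mem_range.1 hi
      rw [zero_pow (by omega), mul_zero]
    rw [h2] at h1
    have h3 := hH.mul (hinv.pow d)
    rw [zero_mul] at h3
    refine hr (tendsto_nhds_unique (h1.congr' ?_) h3)
    filter_upwards [hne] with k hk
    rw [add_mul, Finset.sum_mul]
    congr 1
    · refine Finset.sum_congr rfl fun i hi => ?_
      have := Finset.mem_range.1 hi
      rw [show d = (d - i) + i by omega, pow_add, Nat.add_sub_cancel, inv_pow, inv_pow]
      field_simp
    · rw [inv_pow]; field_simp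

/-- If an analytic function of two variables, regular in the second one, is flat along a sequence
converging to the origin, then the sequence has contact of infinite order with a Puiseux arc on
which the function vanishes. -/
theorem exists_arc_of_isFlat {ι : Type*} (L : Ultrafilter ι) (d : ℕ) :
    ∀ f : ℝ × ℝ → ℝ, AnalyticAt ℝ f 0 → (∀ i < d, (dSnd^[i] f) 0 = 0) → (dSnd^[d] f) 0 ≠ 0 →
    ∀ x y : ι → ℝ, Tendsto x L (𝓝[>] 0) → Tendsto y L (𝓝 0) →
    IsFlat L x (fun i => f (x i, y i)) →
    ∃ (q : ℕ) (ψ : ℝ → ℝ) (σ : ι → ℝ), 0 < q ∧ AnalyticAt ℝ ψ 0 ∧ ψ 0 = 0 ∧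
      Tendsto σ L (𝓝[>] 0) ∧ (∀ᶠ i in L, σ i ^ q = x i) ∧
      (∀ᶠ s in 𝓝 (0 : ℝ), f (s ^ q, ψ s) = 0) ∧ IsFlat L σ (fun i => y i - ψ (σ i)) := by
  -- Induction on the order `d` in the second variable: remove the coefficient of order `d - 1`,
  -- substitute along an edge of the Newton polygon, recentre at the limit, and the order drops.
  induction d using Nat.strong_induction_on with
  | _ d IH =>
  intro f hf hf0 hfd x y hx hy hflat
  have hx0 : Tendsto x L (𝓝 0) := hx.mono_right nhdsWithin_le_nhds
  have hxpos : ∀ᶠ i in L, 0 < x i := hx.eventually self_mem_nhdsWithin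
  rcases Nat.eq_zero_or_pos d with hd0 | hd0
  · exfalso
    subst hd0
    have h1 : Tendsto (fun i => f (x i, y i)) L (𝓝 (f 0)) :=
      hf.continuousAt.tendsto.comp (hx0.prodMk_nhds hy)
    exact hfd (tendsto_nhds_unique h1 (hflat.tendsto_zero hx))
  have hdd : d - 1 + 1 = d := by omega
  -- Tschirnhausen shift: on `y = φ x` the derivative of order `d - 1` vanishes identically, so
  -- after the shift there is no term of degree `d - 1`.
  obtain ⟨φ, hφ, hφ0, hφe⟩ := (hf.iterate_dSnd (d - 1)).exists_implicit (hf0 _ (by omega))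
    (by rw [← Function.iterate_succ_apply' dSnd, Nat.succ_eq_add_one, hdd]; exact hfd)
  set f₂ : ℝ × ℝ → ℝ := fun z => f (z.1, z.2 + φ z.1) with hf₂
  have hφ' : AnalyticAt ℝ φ ((0 : ℝ × ℝ).1) := hφ
  have hsh : AnalyticAt ℝ (fun z : ℝ × ℝ => (z.1, z.2 + φ z.1)) 0 :=
    analyticAt_fst.prod (analyticAt_snd.add (hφ'.comp analyticAt_fst))
  have hf₂a : AnalyticAt ℝ f₂ 0 := by
    refine AnalyticAt.comp (g := f) (f := fun z : ℝ × ℝ => (z.1, z.2 + φ z.1)) ?_ hsh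
    simpa [hφ0, Prod.mk_zero_zero] using hf
  have hshift : ∀ n, dSnd^[n] f₂ =ᶠ[𝓝 0] fun z => (dSnd^[n] f) (z.1, z.2 + φ z.1) :=
    fun n => iterate_dSnd_shift hf hφ hφ0 n
  have hemb : Tendsto (fun x : ℝ => (x, (0 : ℝ))) (𝓝 0) (𝓝 (0 : ℝ × ℝ)) :=
    (by fun_prop : Continuous fun x : ℝ => (x, (0 : ℝ))).tendsto' _ _ rfl
  set a : ℕ → ℝ → ℝ := fun i x => (dSnd^[i] f₂) (x, 0) / i.factorial with ha
  have haA : ∀ i, AnalyticAt ℝ (a i) 0 := by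
    intro i
    have h1 : AnalyticAt ℝ (fun x : ℝ => (dSnd^[i] f₂) (x, 0)) 0 :=
      AnalyticAt.comp (g := dSnd^[i] f₂) (f := fun x : ℝ => (x, (0 : ℝ)))
        (hf₂a.iterate_dSnd i) (analyticAt_id.prod analyticAt_const)
    exact h1.div_const
  have ha0 : ∀ i < d, a i 0 = 0 := by
    intro i hi
    have := (hshift i).self_of_nhds
    simp only [ha]
    rw [show ((0 : ℝ), (0 : ℝ)) = 0 from rfl, this]
    simp [hφ0, Prod.mk_zero_zero, hf0 i hi]
  have had : ∀ᶠ x in 𝓝 (0 : ℝ), a (d - 1) x = 0 := by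
    filter_upwards [hemb.eventually (hshift (d - 1)), hφe] with x h1 h2
    simp only [ha, h1, zero_add, h2, zero_div]
  obtain ⟨R, hR, hR0, hRe⟩ := hf₂a.taylor_snd d
  have hRne : R 0 ≠ 0 := by
    have := (hshift d).self_of_nhds
    rw [hR0, this]
    simp only [Prod.fst_zero, Prod.snd_zero, hφ0, add_zero]
    exact div_ne_zero hfd (by exact_mod_cast d.factorial_ne_zero)
  set y₂ : ι → ℝ := fun i => y i - φ (x i) with hy₂
  have hφx : Tendsto (fun i => φ (x i)) L (𝓝 0) := by
    have := hφ.continuousAt.tendsto.comp hx0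
    rwa [hφ0] at this
  have hy₂0 : Tendsto y₂ L (𝓝 0) := by simpa using hy.sub hφx
  have hf₂f : ∀ i, f₂ (x i, y₂ i) = f (x i, y i) := fun i => by simp [hf₂, hy₂]
  have hxy : Tendsto (fun i => (x i, y₂ i)) L (𝓝 0) := hx0.prodMk_nhds hy₂0
  -- If every lower coefficient is zero, then `f₂ = y ^ d * R` with `R 0 ≠ 0`, so `y₂` itself is
  -- flat and the arc is `y = φ x`.
  by_cases hall : ∀ i < d, ∀ᶠ x in 𝓝 (0 : ℝ), a i x = 0
  · refine ⟨1, φ, x, one_pos, hφ, hφ0, hx, by simp, ?_, ?_⟩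
    · filter_upwards [hall 0 hd0] with s hs
      simp only [ha, Function.iterate_zero, id_eq, Nat.factorial_zero, Nat.cast_one, div_one,
        hf₂, zero_add] at hs
      simpa using hs
    · have hall' : ∀ᶠ x in 𝓝 (0 : ℝ), ∀ i ∈ Finset.range d, a i x = 0 := by
        rw [eventually_all_finset]
        exact fun i hi => hall i (Finset.mem_range.1 hi)
      refine IsFlat.of_pow_mul (d := d) (r := fun i => R (x i, y₂ i)) hd0
        (hR.continuousAt.tendsto.comp hxy) hRne ?_
      refine hflat.congr' ?_
      filter_upwards [hxy.eventually hRe, hx0.eventually hall'] with i h1 h2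
      rw [← hf₂f, h1, Finset.sum_eq_zero, zero_add]
      intro j hj
      have := h2 j hj
      simp only [ha] at this
      rw [this, zero_mul]
  push Not at hall
  obtain ⟨p, q, i₀, B, hp, hq, hi₀, hBa, hBe, hBi₀, hB0⟩ :=
    exists_newton_slope (fun i _ => haA i) ha0 (by simpa using hall)
  have hBd : B (d - 1) 0 = 0 := hB0 _ (by omega) had
  set s : ι → ℝ := fun i => x i ^ ((q : ℝ)⁻¹) with hs
  have hsq : ∀ᶠ i in L, s i ^ q = x i := by
    filter_upwards [hxpos] with i hi
    exact Real.rpow_inv_natCast_pow hi.le hq.ne'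
  have hspos : ∀ᶠ i in L, 0 < s i := hxpos.mono fun i hi => Real.rpow_pos_of_pos hi _
  have hs0 : Tendsto s L (𝓝 0) := by
    have hqp : (0 : ℝ) < (q : ℝ)⁻¹ := by positivity
    have h1 : ContinuousAt (fun x : ℝ => x ^ ((q : ℝ)⁻¹)) 0 :=
      Real.continuousAt_rpow_const _ _ (Or.inr hqp.le)
    have h2 := h1.tendsto.comp hx0
    rwa [Real.zero_rpow hqp.ne'] at h2
  have hsT : Tendsto s L (𝓝[>] 0) := tendsto_nhdsWithin_iff.2 ⟨hs0, hspos⟩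
  have hfact : ∀ s' Y : ℝ, (∀ i ∈ Finset.range d, a i (s' ^ q) = s' ^ (p * (d - i)) * B i s') →
      ∑ i ∈ Finset.range d, a i (s' ^ q) * (s' ^ p * Y) ^ i + (s' ^ p * Y) ^ d * R (s' ^ q, s' ^ p * Y)
      = s' ^ (p * d) * (∑ i ∈ Finset.range d, B i s' * Y ^ i + Y ^ d * R (s' ^ q, s' ^ p * Y)) := by
    intro s' Y h
    rw [mul_add, Finset.mul_sum]
    congr 1
    · refine Finset.sum_congr rfl fun i hi => ?_
      have hi' := Finset.mem_range.1 hi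
      rw [h i hi, mul_pow, ← pow_mul, show p * d = p * (d - i) + p * i by
        rw [← mul_add]; congr 1; omega, pow_add]
      ring
    · rw [mul_pow, ← pow_mul]; ring
  have hBe' : ∀ᶠ s in 𝓝 (0 : ℝ), ∀ i ∈ Finset.range d,
      a i (s ^ q) = s ^ (p * (d - i)) * B i s := by
    rw [eventually_all_finset]
    exact fun i hi => hBe i (Finset.mem_range.1 hi)
  -- In the variables `x = s ^ q`, `y₂ = s ^ p * Y` the factor `s ^ (p * d)` splits off, and the
  -- cofactor is still flat.
  set Y : ι → ℝ := fun i => y₂ i / s i ^ p with hY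
  have hYs : ∀ᶠ i in L, s i ^ p * Y i = y₂ i := by
    filter_upwards [hspos] with i hi
    simp only [hY]
    field_simp
  have hHflat : IsFlat L s (fun k => ∑ i ∈ Finset.range d, B i (s k) * Y k ^ i
      + Y k ^ d * R (x k, y₂ k)) := by
    refine IsFlat.of_mul_pow (k := p * d) hsT ?_
    refine (hflat.to_pow hq hsT hsq).congr' ?_
    filter_upwards [hYs, hsq, hxy.eventually hRe, hs0.eventually hBe'] with k h1 h2 h3 h4
    have h5 := hfact (s k) (Y k) h4
    rw [h1, h2] at h5
    rw [← h5, ← hf₂f, h3]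
  obtain ⟨c₀, hc₀⟩ := exists_tendsto_of_newton L (β := fun i k => B i (s k)) (β₀ := fun i => B i 0)
    (fun i hi => (hBa i hi).continuousAt.tendsto.comp hs0) hRne
    (hR.continuousAt.tendsto.comp hxy) (hHflat.tendsto_zero hsT)
  set ft : ℝ × ℝ → ℝ := fun z => ∑ i ∈ Finset.range d, B i z.1 * (c₀ + z.2) ^ i
    + (c₀ + z.2) ^ d * R (z.1 ^ q, z.1 ^ p * (c₀ + z.2)) with hft
  have hfta : AnalyticAt ℝ ft 0 := by
    have h1 : AnalyticAt ℝ (fun z : ℝ × ℝ => c₀ + z.2) 0 := analyticAt_const.add analyticAt_snd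
    refine AnalyticAt.add ?_ ((h1.pow d).mul ?_)
    · refine Finset.analyticAt_fun_sum _ fun i hi => AnalyticAt.mul ?_ (h1.pow i)
      exact AnalyticAt.comp (g := B i) (f := fun z : ℝ × ℝ => z.1) (x := 0)
        (hBa i (Finset.mem_range.1 hi)) analyticAt_fst
    · refine AnalyticAt.comp (g := R) (f := fun z : ℝ × ℝ => (z.1 ^ q, z.1 ^ p * (c₀ + z.2))) ?_ ?_
      · simpa [hq.ne', hp.ne', Prod.mk_zero_zero] using hR
      · exact (analyticAt_fst.pow q).prod ((analyticAt_fst.pow p).mul h1)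
  -- The edge polynomial lacks the term of degree `d - 1` but has a nonzero term of degree `i₀ < d`,
  -- so `c₀` is not a root of multiplicity `d`. The order of `ft` is therefore less than `d`, and
  -- the induction hypothesis applies to it.
  have hex : ∃ k, k < d ∧ (dSnd^[k] ft) 0 ≠ 0 := by
    obtain ⟨k, hk, hk'⟩ := exists_iteratedDeriv_ne_zero (b := fun i => B i 0) (c := c₀) hRne hd0
      hBd hi₀ hBi₀
    refine ⟨k, hk, ?_⟩
    rw [iterate_dSnd_zero_eq hfta]
    convert hk' using 3 with w
    simp [hft, hq.ne', hp.ne', Prod.mk_zero_zero]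
  classical
  obtain ⟨hkd, hk⟩ := Nat.find_spec hex
  have hkmin : ∀ i < Nat.find hex, (dSnd^[i] ft) 0 = 0 := by
    intro i hi
    by_contra hne
    exact Nat.find_min hex hi ⟨hi.trans hkd, hne⟩
  have hw0 : Tendsto (fun k => Y k - c₀) L (𝓝 0) := by simpa using hc₀.sub_const c₀
  obtain ⟨q', ψ', σ, hq', hψ', hψ'0, hσ, hσs, hψe, hψfl⟩ := IH _ hkd ft hfta hkmin hk s
    (fun k => Y k - c₀) hsT hw0 (by
      refine hHflat.congr' ?_
      filter_upwards [hYs, hsq] with k h1 h2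
      simp only [hft, add_sub_cancel, h1, h2])
  have hσ0 : Tendsto σ L (𝓝 0) := hσ.mono_right nhdsWithin_le_nhds
  have hpowt : ∀ n : ℕ, 0 < n → Tendsto (fun s : ℝ => s ^ n) (𝓝 0) (𝓝 0) := fun n hn =>
    (by fun_prop : Continuous fun s : ℝ => s ^ n).tendsto' _ _ (by simp [hn.ne'])
  -- The substitutions are undone: `s = τ ^ q'`, `x = s ^ q` and `y = φ x + s ^ p * (c₀ + ψ' τ)`.
  refine ⟨q' * q, fun τ => φ (τ ^ (q' * q)) + τ ^ (q' * p) * (c₀ + ψ' τ), σ, Nat.mul_pos hq' hq,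
    ?_, ?_, hσ, ?_, ?_, ?_⟩
  · refine AnalyticAt.add ?_ ((analyticAt_id.pow _).mul (analyticAt_const.add hψ'))
    refine AnalyticAt.comp (g := φ) (f := fun τ : ℝ => τ ^ (q' * q)) ?_ (analyticAt_id.pow _)
    simpa [hq.ne', hq'.ne'] using hφ
  · simp [hq.ne', hq'.ne', hp.ne', hφ0]
  · filter_upwards [hsq, hσs] with i h1 h2
    rw [pow_mul, h2, h1]
  · have hz : Tendsto (fun τ : ℝ => ((τ ^ q') ^ q, (τ ^ q') ^ p * (c₀ + ψ' τ))) (𝓝 0)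
        (𝓝 (0 : ℝ × ℝ)) := by
      refine Tendsto.prodMk_nhds ((hpowt q hq).comp (hpowt q' hq')) ?_
      have := ((hpowt p hp).comp (hpowt q' hq')).mul (hψ'.continuousAt.tendsto.const_add c₀)
      simpa using this
    filter_upwards [hψe, hz.eventually hRe, (hpowt q' hq').eventually hBe'] with τ h1 h2 h3
    have h4 := hfact (τ ^ q') (c₀ + ψ' τ) h3
    have h5 : f (τ ^ (q' * q), φ (τ ^ (q' * q)) + τ ^ (q' * p) * (c₀ + ψ' τ))
        = f₂ ((τ ^ q') ^ q, (τ ^ q') ^ p * (c₀ + ψ' τ)) := by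
      simp only [hf₂, ← pow_mul]
      rw [add_comm]
    rw [h5, h2]
    refine h4.trans ?_
    simp only [hft] at h1
    rw [h1, mul_zero]
  · have h1 := hψfl.mul_left (k := fun i => s i ^ p) (hs0.pow p)
    refine h1.congr' ?_
    filter_upwards [hsq, hσs, hYs] with i h1 h2 h3
    rw [pow_mul, pow_mul, h2, h1, mul_sub, mul_sub, h3]
    simp only [hy₂]
    ring

/-! ### A Łojasiewicz inequality on semianalytic sets -/

/-- An analytic function which is nonnegative up to flat terms along a sequence of positive numbers
tending to zero is nonnegative on a right neighbourhood of zero. -/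
theorem AnalyticAt.eventually_nonneg_of_isFlat {ι : Type*} {L : Filter ι} [L.NeBot] {G : ℝ → ℝ}
    (hG : AnalyticAt ℝ G 0) {σ g : ι → ℝ} (hσ : Tendsto σ L (𝓝[>] 0)) (hg : ∀ᶠ i in L, 0 ≤ g i)
    (hfl : IsFlat L σ fun i => g i - G (σ i)) : ∀ᶠ s in 𝓝[>] (0 : ℝ), 0 ≤ G s := by
  by_cases h0 : ∀ᶠ s in 𝓝 (0 : ℝ), G s = 0
  · exact (h0.filter_mono nhdsWithin_le_nhds).mono fun s hs => hs.ge
  obtain ⟨n, b, hb, hb0, hGb⟩ := hG.exists_eventuallyEq_pow_smul_nonzero_iff.2 h0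
  have hGb' : ∀ᶠ s in 𝓝 (0 : ℝ), G s = s ^ n * b s := by simpa using hGb
  rcases lt_or_gt_of_ne hb0 with hneg | hpos
  -- If `b 0 < 0`, then `G (σ i)` is negative of exact order `σ i ^ n`, while `g i - G (σ i)` is
  -- smaller than any power; so `g i` would be negative.
  · exfalso
    have hσ0 : Tendsto σ L (𝓝 0) := hσ.mono_right nhdsWithin_le_nhds
    have h1 : Tendsto (fun i => b (σ i)) L (𝓝 (b 0)) := hb.continuousAt.tendsto.comp hσ0
    have h3 : Tendsto (fun i => (g i - G (σ i)) / σ i ^ n) L (𝓝 0) := by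
      refine IsFlat.tendsto_zero hσ (IsFlat.of_mul_pow (k := n) hσ (hfl.congr' ?_))
      filter_upwards [hσ.eventually self_mem_nhdsWithin] with i hi
      have : (0 : ℝ) < σ i := hi
      field_simp
    have h4 := (h3.add h1)
    rw [zero_add] at h4
    have h5 := h4.eventually (gt_mem_nhds hneg)
    obtain ⟨i, hi1, hi2, hi3, hi4⟩ := (h5.and (hg.and
      ((hσ.eventually self_mem_nhdsWithin).and (hσ0.eventually hGb')))).exists
    have hp : (0 : ℝ) < σ i ^ n := pow_pos hi3 n
    rw [hi4] at hi1
    have : (g i - σ i ^ n * b (σ i)) / σ i ^ n + b (σ i) = g i / σ i ^ n := by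
      field_simp; ring
    rw [this] at hi1
    exact absurd hi1 (not_lt.2 (div_nonneg hi2 hp.le))
  · have h1 : ∀ᶠ s in 𝓝 (0 : ℝ), 0 < b s := hb.continuousAt.eventually (lt_mem_nhds hpos)
    filter_upwards [self_mem_nhdsWithin, h1.filter_mono nhdsWithin_le_nhds,
      hGb'.filter_mono nhdsWithin_le_nhds] with s hs h2 h3
    rw [h3]
    exact (mul_pos (pow_pos hs n) h2).le

/-- A nonzero analytic function is nonzero somewhere near the base point off a given line. -/
theorem AnalyticAt.exists_direction {h : ℝ × ℝ → ℝ} {p ζ : ℝ × ℝ} (hh : AnalyticAt ℝ h p)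
    (hne : ¬ ∀ᶠ z in 𝓝 p, h z = 0) (hζ : ζ ≠ 0) :
    ∃ e : ℝ × ℝ, ζ.1 * e.2 - ζ.2 * e.1 ≠ 0 ∧ ¬ ∀ᶠ w in 𝓝 (0 : ℝ), h (p + w • e) = 0 := by
  obtain ⟨r, hr, hball⟩ := Metric.eventually_nhds_iff_ball.1 hh.eventually_analyticAt
  obtain ⟨w₀, hw₀, hw₀b⟩ : ∃ w, h w ≠ 0 ∧ w ∈ Metric.ball p r :=
    ((not_eventually.1 hne).and_eventually (Metric.ball_mem_nhds p hr)).exists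
  -- Moving `w₀` perpendicularly to `ζ` changes its determinant with `ζ` at the rate `|ζ|²`, so a
  -- small move gives transversality and keeps `h` nonzero. By the identity theorem on the segment
  -- from `p`, `h` then does not vanish near `p` on this line.
  set m : ℝ → ℝ × ℝ := fun η => w₀ + η • (-ζ.2, ζ.1) with hm
  have hmc : Tendsto m (𝓝 0) (𝓝 w₀) :=
    (by fun_prop : Continuous m).tendsto' _ _ (by simp [hm])
  have hev : ∀ᶠ η in 𝓝 (0 : ℝ), h (m η) ≠ 0 ∧ m η ∈ Metric.ball p r := by
    refine (hmc.eventually ((hball _ hw₀b).continuousAt.eventually_ne hw₀)).and ?_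
    exact hmc.eventually (Metric.isOpen_ball.mem_nhds hw₀b)
  have hζ2 : ζ.1 ^ 2 + ζ.2 ^ 2 ≠ 0 := by
    intro h0
    have h1 : ζ.1 = 0 := by nlinarith [sq_nonneg ζ.1, sq_nonneg ζ.2]
    have h2 : ζ.2 = 0 := by nlinarith [sq_nonneg ζ.1, sq_nonneg ζ.2]
    exact hζ (Prod.ext h1 h2)
  obtain ⟨η, ⟨hη1, hη2⟩, hη3⟩ : ∃ η, (h (m η) ≠ 0 ∧ m η ∈ Metric.ball p r) ∧
      ζ.1 * (m η - p).2 - ζ.2 * (m η - p).1 ≠ 0 := by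
    have hdet : ∀ η, ζ.1 * (m η - p).2 - ζ.2 * (m η - p).1
        = (ζ.1 * (w₀ - p).2 - ζ.2 * (w₀ - p).1) + η * (ζ.1 ^ 2 + ζ.2 ^ 2) := by
      intro η; simp [hm]; ring
    by_cases hd : ζ.1 * (w₀ - p).2 - ζ.2 * (w₀ - p).1 = 0
    · obtain ⟨η, h1, h2⟩ := ((hev.filter_mono nhdsWithin_le_nhds).and
        (self_mem_nhdsWithin : {(0 : ℝ)}ᶜ ∈ 𝓝[≠] (0 : ℝ))).exists
      refine ⟨η, h1, ?_⟩
      rw [hdet, hd, zero_add]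
      exact mul_ne_zero h2 hζ2
    · refine ⟨0, hev.self_of_nhds, ?_⟩
      rw [hdet]; simpa using hd
  refine ⟨m η - p, hη3, fun hz => hη1 ?_⟩
  have hseg : ∀ w ∈ Icc (0 : ℝ) 1, p + w • (m η - p) ∈ Metric.ball p r := by
    intro w hw
    rw [mem_ball_iff_norm, add_sub_cancel_left, norm_smul, Real.norm_of_nonneg hw.1]
    rw [mem_ball_iff_norm] at hη2
    exact (mul_le_of_le_one_left (norm_nonneg _) hw.2).trans_lt hη2
  have hana : AnalyticOnNhd ℝ (fun w : ℝ => h (p + w • (m η - p))) (Icc 0 1) := by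
    intro w hw
    refine AnalyticAt.comp (g := h) (f := fun w : ℝ => p + w • (m η - p)) (hball _ (hseg w hw)) ?_
    exact analyticAt_const.add (analyticAt_id.smul analyticAt_const)
  have h1 := hana.eqOn_zero_of_preconnected_of_eventuallyEq_zero isPreconnected_Icc
    (left_mem_Icc.2 zero_le_one) hz (right_mem_Icc.2 zero_le_one)
  simpa using h1

/-- A Łojasiewicz inequality in the plane: an analytic function with an isolated zero on a closed
semianalytic set is bounded below there by a power of the distance to the zero. -/
theorem IsClosedSemianalyticAt.lojasiewicz {S : Set (ℝ × ℝ)} {p : ℝ × ℝ}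
    (hS : IsClosedSemianalyticAt S p) {h : ℝ × ℝ → ℝ} (hh : AnalyticAt ℝ h p)
    (hiso : ∀ᶠ z in 𝓝 p, z ∈ S → h z = 0 → z = p) :
    ∃ m : ℕ, ∀ᶠ z in 𝓝 p, z ∈ S → ‖z - p‖ ^ m ≤ |h z| := by
  by_contra! hcon
  have hsel : ∀ k : ℕ, ∃ z, z ∈ S ∧ |h z| < ‖z - p‖ ^ (k + 1) ∧ ‖z - p‖ < 1 / ((k : ℝ) + 1) := by
    intro k
    have h1 : ∀ᶠ z in 𝓝 p, ‖z - p‖ < 1 / ((k : ℝ) + 1) := by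
      have := Metric.ball_mem_nhds p (by positivity : (0 : ℝ) < 1 / ((k : ℝ) + 1))
      filter_upwards [this] with z hz
      rwa [mem_ball_iff_norm] at hz
    have h2 := hcon (k + 1)
    obtain ⟨z, ⟨h3, h4⟩, h5⟩ := (h2.and_eventually h1).exists
    exact ⟨z, h3, h4, h5⟩
  choose z hzS hzh hzn using hsel
  -- A nonprincipal ultrafilter makes the directions `(z k - p) / ‖z k - p‖` converge, and selects
  -- one of the finitely many systems of inequalities defining `S`.
  set L : Ultrafilter ℕ := hyperfilter ℕ with hL
  have hLT : (L : Filter ℕ) ≤ atTop := Nat.hyperfilter_le_atTop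
  set n : ℕ → ℝ := fun k => ‖z k - p‖ with hn
  have hnpos : ∀ k, 0 < n k := by
    intro k
    rcases (norm_nonneg (z k - p)).eq_or_lt with h0 | h0
    · have := hzh k
      rw [← h0, zero_pow (by omega)] at this
      exact absurd this (not_lt.2 (abs_nonneg _))
    · exact h0
  have hn0 : Tendsto n L (𝓝 0) := by
    refine Tendsto.mono_left ?_ hLT
    exact squeeze_zero (fun k => (hnpos k).le) (fun k => (hzn k).le)
      tendsto_one_div_add_atTop_nhds_zero_nat
  have hnT : Tendsto n L (𝓝[>] 0) :=
    tendsto_nhdsWithin_iff.2 ⟨hn0, Eventually.of_forall hnpos⟩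
  have hzp : Tendsto z L (𝓝 p) := tendsto_iff_norm_sub_tendsto_zero.2 hn0
  have hflat : IsFlat L n fun k => h (z k) := by
    intro N
    refine IsBigO.of_bound 1 ?_
    filter_upwards [hLT (eventually_ge_atTop N), hn0.eventually (gt_mem_nhds zero_lt_one)]
      with k hk hk1
    rw [one_mul, Real.norm_eq_abs, Real.norm_of_nonneg (pow_nonneg (hnpos k).le _)]
    exact (hzh k).le.trans (pow_le_pow_of_le_one (hnpos k).le hk1.le (by omega))
  have hne : ¬ ∀ᶠ z in 𝓝 p, h z = 0 := by
    intro h0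
    obtain ⟨k, h1, h2⟩ := (hzp.eventually (hiso.and h0)).exists
    have := h1 (hzS k) h2
    have h3 := hnpos k
    simp [hn, this] at h3
  obtain ⟨ζ, hζ, hζt⟩ := L.exists_tendsto_of_eventually_mem (isCompact_sphere (0 : ℝ × ℝ) 1)
    (f := fun k => (n k)⁻¹ • (z k - p)) (Eventually.of_forall fun k => by
      rw [mem_sphere_zero_iff_norm, norm_smul, norm_inv, Real.norm_of_nonneg (hnpos k).le]
      exact inv_mul_cancel₀ (hnpos k).ne')
  have hζ0 : ζ ≠ 0 := by
    rintro rfl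
    simp at hζ
  obtain ⟨e, hD, hnz⟩ := hh.exists_direction hne hζ0
  set D := ζ.1 * e.2 - ζ.2 * e.1 with hDdef
  set T : ℝ × ℝ → ℝ × ℝ := fun w => p + (w.1 • ζ + w.2 • e) with hT
  have hTa : ∀ w, AnalyticAt ℝ T w := fun w => analyticAt_const.add
    ((analyticAt_fst.smul analyticAt_const).add (analyticAt_snd.smul analyticAt_const))
  have hT0 : T 0 = p := by simp [hT]
  set f : ℝ × ℝ → ℝ := fun w => h (T w) with hf
  have hfa : AnalyticAt ℝ f 0 :=
    AnalyticAt.comp (g := h) (by rw [hT0]; exact hh) (hTa 0)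
  -- Coordinates of `z k - p` in the basis `ζ, e`. As `ζ` is the limit direction, `x k` is
  -- asymptotic to the distance `n k`, so flatness in one is flatness in the other. The choice of
  -- `e` gives `f (0, ·)` finite order at zero.
  set x : ℕ → ℝ := fun k => ((z k - p).1 * e.2 - (z k - p).2 * e.1) / D with hx
  set y : ℕ → ℝ := fun k => (ζ.1 * (z k - p).2 - ζ.2 * (z k - p).1) / D with hy
  have hTz : ∀ k, T (x k, y k) = z k := by
    intro k
    have h1 : x k * ζ.1 + y k * e.1 = (z k - p).1 := by
      simp only [hx, hy]; field_simp; rw [hDdef]; ring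
    have h2 : x k * ζ.2 + y k * e.2 = (z k - p).2 := by
      simp only [hx, hy]; field_simp; rw [hDdef]; ring
    refine Prod.ext ?_ ?_
    · simp [hT, h1]
    · simp [hT, h2]
  have hζ1 : Tendsto (fun k => (n k)⁻¹ * (z k - p).1) L (𝓝 ζ.1) :=
    (continuous_fst.tendsto ζ).comp hζt
  have hζ2 : Tendsto (fun k => (n k)⁻¹ * (z k - p).2) L (𝓝 ζ.2) :=
    (continuous_snd.tendsto ζ).comp hζt
  have hxn : Tendsto (fun k => x k / n k) L (𝓝 1) := by
    have h1 := ((hζ1.mul_const e.2).sub (hζ2.mul_const e.1)).div_const D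
    rw [← hDdef, div_self hD] at h1
    refine h1.congr fun k => ?_
    simp only [hx]
    have := (hnpos k).ne'
    field_simp
  have hz1 : Tendsto (fun k => (z k - p).1) L (𝓝 0) := by
    have := (continuous_fst.tendsto _).comp (hzp.sub_const p)
    rw [sub_self] at this
    exact this
  have hz2 : Tendsto (fun k => (z k - p).2) L (𝓝 0) := by
    have := (continuous_snd.tendsto _).comp (hzp.sub_const p)
    rw [sub_self] at this
    exact this
  have hx0 : Tendsto x L (𝓝 0) := by
    simpa [hx] using ((hz1.mul_const e.2).sub (hz2.mul_const e.1)).div_const D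
  have hy0 : Tendsto y L (𝓝 0) := by
    simpa [hy] using ((hz2.const_mul ζ.1).sub (hz1.const_mul ζ.2)).div_const D
  have hnx : ∀ᶠ k in L, n k ≤ 2 * x k := by
    filter_upwards [hxn.eventually (lt_mem_nhds (by norm_num : (1 / 2 : ℝ) < 1))] with k hk
    rw [lt_div_iff₀ (hnpos k)] at hk
    linarith
  have hxT : Tendsto x L (𝓝[>] 0) := by
    refine tendsto_nhdsWithin_iff.2 ⟨hx0, ?_⟩
    filter_upwards [hnx] with k hk
    have := hnpos k
    exact mem_Ioi.2 (by linarith)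
  have hfx : IsFlat L x fun k => f (x k, y k) := by
    intro N
    have h1 : (fun k => n k ^ N) =O[L] fun k => x k ^ N := by
      refine IsBigO.pow (IsBigO.of_bound 2 ?_) N
      filter_upwards [hnx] with k hk
      have := hnpos k
      rw [Real.norm_of_nonneg this.le, Real.norm_of_nonneg (by linarith)]
      exact hk
    refine ((hflat N).trans h1).congr' ?_ EventuallyEq.rfl
    exact Eventually.of_forall fun k => by simp only [hf, hTz]
  have hg : AnalyticAt ℝ (fun w : ℝ => f (0, w)) 0 :=
    AnalyticAt.comp (g := f) (f := fun w : ℝ => ((0 : ℝ), w)) hfa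
      (analyticAt_const.prod analyticAt_id)
  have hgt : analyticOrderAt (fun w : ℝ => f (0, w)) 0 ≠ ⊤ := by
    rw [Ne, analyticOrderAt_eq_top]
    simpa [hf, hT] using hnz
  obtain ⟨d, hd⟩ := ENat.ne_top_iff_exists.1 hgt
  obtain ⟨hd1, hd2⟩ := (analyticOrderAt_eq_nat_iff_iteratedDeriv_eq_zero hg).1 hd.symm
  obtain ⟨q, ψ, σ, hq, hψ, hψ0, hσ, hσx, hψe, hψf⟩ := exists_arc_of_isFlat L d f hfa
    (fun i hi => by rw [iterate_dSnd_zero_eq hfa, hd1 i hi])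
    (by rw [iterate_dSnd_zero_eq hfa]; exact hd2) x y hxT hy0 hfx
  have hσ0 : Tendsto σ L (𝓝 0) := hσ.mono_right nhdsWithin_le_nhds
  set Γ : ℝ → ℝ × ℝ := fun s => T (s ^ q, ψ s) with hΓ
  have hΓa : AnalyticAt ℝ Γ 0 := AnalyticAt.comp (g := T) (f := fun s : ℝ => (s ^ q, ψ s)) (hTa _)
    ((analyticAt_id.pow q).prod hψ)
  have hΓ0 : Γ 0 = p := by simp [hΓ, hψ0, hq.ne', Prod.mk_zero_zero, hT0]
  have hΓt : Tendsto Γ (𝓝 0) (𝓝 p) := by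
    have := hΓa.continuousAt.tendsto
    rwa [hΓ0] at this
  obtain ⟨M, N, g, hga, hgS⟩ := hS
  obtain ⟨i, hi⟩ : ∃ i, ∀ᶠ k in L, ∀ j, 0 ≤ g i j (z k) := by
    have h1 : ∀ᶠ k in L, ∃ i, ∀ j, 0 ≤ g i j (z k) := by
      filter_upwards [hzp.eventually hgS] with k hk
      exact hk.1 (hzS k)
    by_contra! hno
    have h2 : ∀ i, ∀ᶠ k in L, ∃ j, g i j (z k) < 0 := hno
    obtain ⟨k, hk1, hk2⟩ := (h1.and (eventually_all.2 h2)).exists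
    obtain ⟨i, hi⟩ := hk1
    obtain ⟨j, hj⟩ := hk2 i
    exact absurd (hi j) (not_le.2 hj)
  -- The points `z k` and `Γ (σ k)` differ by a flat amount, so the inequalities valid at `z k` pass
  -- to the whole arc for small `s > 0`.
  have hpos : ∀ j, ∀ᶠ s in 𝓝[>] (0 : ℝ), 0 ≤ g i j (Γ s) := by
    intro j
    have hG : AnalyticAt ℝ (fun s => g i j (Γ s)) 0 :=
      AnalyticAt.comp (g := g i j) (by rw [hΓ0]; exact hga i j) hΓa
    refine hG.eventually_nonneg_of_isFlat hσ (g := fun k => g i j (z k))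
      (hi.mono fun k hk => hk j) ?_
    have hstrict := (hga i j).hasStrictFDerivAt.isBigO_sub
    have hpair : Tendsto (fun k => (z k, Γ (σ k))) L (𝓝 (p, p)) :=
      hzp.prodMk_nhds (hΓt.comp hσ0)
    have h1 : (fun k => g i j (z k) - g i j (Γ (σ k))) =O[L] fun k => z k - Γ (σ k) :=
      hstrict.comp_tendsto hpair
    have h2 : (fun k => z k - Γ (σ k)) =O[L] fun k => y k - ψ (σ k) := by
      refine IsBigO.of_bound ‖e‖ ?_
      filter_upwards [hσx] with k hk
      have : z k - Γ (σ k) = (y k - ψ (σ k)) • e := by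
        rw [← hTz k]
        simp only [hΓ, hT, hk, sub_smul]
        abel
      rw [this, norm_smul, mul_comm]
    exact fun N => (h1.trans h2).trans (hψf N)
  obtain ⟨s, hs1, hs2, hs3, hs4, hs5⟩ := ((eventually_all.2 hpos).and
    ((hψe.filter_mono nhdsWithin_le_nhds).and
    (((hΓt.eventually hgS).filter_mono nhdsWithin_le_nhds).and
    (((hΓt.eventually hiso).filter_mono nhdsWithin_le_nhds).and
      (self_mem_nhdsWithin : Ioi (0 : ℝ) ∈ 𝓝[>] (0 : ℝ)))))).exists
  -- The arc consists of zeros of `h` in `S`, so it can only sit at `p`; but its coordinate along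
  -- `ζ` is `s ^ q`, which is not zero.
  have hΓp : Γ s = p := hs4 (hs3.2 ⟨i, hs1⟩) hs2
  have hlin : s ^ q • ζ + ψ s • e = 0 := by
    have : p + (s ^ q • ζ + ψ s • e) = p := hΓp
    simpa using this
  have hdet : s ^ q * D = 0 := by
    have h1 := congrArg Prod.fst hlin
    have h2 := congrArg Prod.snd hlin
    simp at h1 h2
    rw [hDdef]
    linear_combination e.2 * h1 - e.1 * h2
  exact mul_ne_zero (pow_pos hs5 q).ne' hD hdet

/-! ### Single branches and their limits -/

/-- The right branch of a Lorenz map: critical point `c`, parameter `v`, diffeomorphic part `φ` with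
derivative `ψ`. Left branches are brought into this form by the reflection `x ↦ 1 - x`. -/
structure Branch where
  c : ℝ
  v : ℝ
  φ : ℝ → ℝ
  ψ : ℝ → ℝ

namespace Branch

/-- Bounds satisfied by the branches of maps close to standard maps. -/
structure IsTame (B : Branch) : Prop where
  c_pos : 0 < B.c
  c_lt_one : B.c < 1
  v_nonneg : 0 ≤ B.v
  v_le_one : B.v ≤ 1
  map_zero : B.φ 0 = 0
  map_one : B.φ 1 = 1
  hasDeriv : ∀ x ∈ Icc (0 : ℝ) 1, HasDerivWithinAt B.φ (B.ψ x) (Icc 0 1) x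
  half_le : ∀ x ∈ Icc (0 : ℝ) 1, 1 / 2 ≤ B.ψ x
  le_two : ∀ x ∈ Icc (0 : ℝ) 1, B.ψ x ≤ 2
  lipschitz : ∀ x ∈ Icc (0 : ℝ) 1, ∀ y ∈ Icc (0 : ℝ) 1, |B.ψ x - B.ψ y| ≤ |x - y|

/-- The affine coordinate on `[c, 1]`. -/
noncomputable def coord (B : Branch) (x : ℝ) : ℝ := (x - B.c) / (1 - B.c)

/-- The branch before application of the diffeomorphic part. -/
noncomputable def core (α : ℝ) (B : Branch) (x : ℝ) : ℝ :=
  1 + B.v * (-1 + (B.coord x) ^ α)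

/-- The branch as a map. -/
noncomputable def map (α : ℝ) (B : Branch) (x : ℝ) : ℝ := B.φ (B.core α x)

/-- The derivative of the branch. -/
noncomputable def slope (α : ℝ) (B : Branch) (x : ℝ) : ℝ :=
  B.ψ (B.core α x) * (B.v * (α * (B.coord x) ^ (α - 1) / (1 - B.c)))

variable {α : ℝ} {B : Branch}

theorem coord_one (hB : B.IsTame) : B.coord 1 = 1 := by
  have := hB.c_lt_one
  exact div_self (by linarith)

theorem coord_c : B.coord B.c = 0 := by simp [coord]

theorem coord_mem (hB : B.IsTame) {x : ℝ} (hx : x ∈ Icc B.c 1) : B.coord x ∈ Icc (0 : ℝ) 1 := by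
  have h := hB.c_lt_one
  refine ⟨div_nonneg (by linarith [hx.1]) (by linarith), ?_⟩
  rw [coord, div_le_one (by linarith)]
  linarith [hx.2]

theorem coord_lt (hB : B.IsTame) {x y : ℝ} (hxy : x < y) : B.coord x < B.coord y := by
  have h := hB.c_lt_one
  exact div_lt_div_of_pos_right (by linarith) (by linarith)

theorem core_one (hB : B.IsTame) : B.core α 1 = 1 := by
  simp [core, coord_one hB]

theorem core_c (hα : 1 < α) : B.core α B.c = 1 - B.v := by
  rw [core, coord_c, Real.zero_rpow (by linarith)]; ring

theorem core_mem (hB : B.IsTame) (hα : 1 < α) {x : ℝ} (hx : x ∈ Icc B.c 1) :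
    B.core α x ∈ Icc (0 : ℝ) 1 := by
  have h := coord_mem hB hx
  have h0 : 0 ≤ B.coord x ^ α := Real.rpow_nonneg h.1 _
  have h1 : B.coord x ^ α ≤ 1 := Real.rpow_le_one h.1 h.2 (by linarith)
  have hv0 := hB.v_nonneg
  have hv1 := hB.v_le_one
  constructor
  · rw [core]; nlinarith
  · rw [core]; nlinarith

theorem core_strictMonoOn (hB : B.IsTame) (hα : 1 < α) (hv : 0 < B.v) :
    StrictMonoOn (B.core α) (Icc B.c 1) := by
  intro x hx y hy hxy
  have h := Real.rpow_lt_rpow (coord_mem hB hx).1 (coord_lt hB hxy) (by linarith : 0 < α)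
  simp only [core]
  have := mul_lt_mul_of_pos_left h hv
  linarith

theorem exists_slope_eq (hB : B.IsTame) {x y : ℝ} (hx : 0 ≤ x) (hxy : x < y) (hy : y ≤ 1) :
    ∃ ξ ∈ Ioo x y, B.φ y - B.φ x = B.ψ ξ * (y - x) := by
  have hsub : Icc x y ⊆ Icc 0 1 := Icc_subset_Icc hx hy
  obtain ⟨ξ, hξ, h⟩ := exists_hasDerivAt_eq_slope B.φ B.ψ hxy
    (fun z hz => ((hB.hasDeriv z (hsub hz)).continuousWithinAt.mono hsub))
    (fun z hz => (hB.hasDeriv z (hsub ⟨hz.1.le, hz.2.le⟩)).hasDerivAt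
      (Icc_mem_nhds (hx.trans_lt hz.1) (hz.2.trans_le hy)))
  refine ⟨ξ, hξ, ?_⟩
  rw [h]
  have : y - x ≠ 0 := by linarith
  field_simp

theorem half_mul_le_φ_sub (hB : B.IsTame) {x y : ℝ} (hx : 0 ≤ x) (hxy : x ≤ y) (hy : y ≤ 1) :
    (y - x) / 2 ≤ B.φ y - B.φ x := by
  rcases hxy.eq_or_lt with rfl | hxy
  · simp
  obtain ⟨ξ, hξ, h⟩ := exists_slope_eq hB hx hxy hy
  have := hB.half_le ξ ⟨hx.trans hξ.1.le, hξ.2.le.trans hy⟩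
  rw [h]; nlinarith

theorem φ_sub_le (hB : B.IsTame) {x y : ℝ} (hx : 0 ≤ x) (hxy : x ≤ y) (hy : y ≤ 1) :
    B.φ y - B.φ x ≤ 2 * (y - x) := by
  rcases hxy.eq_or_lt with rfl | hxy
  · simp
  obtain ⟨ξ, hξ, h⟩ := exists_slope_eq hB hx hxy hy
  have := hB.le_two ξ ⟨hx.trans hξ.1.le, hξ.2.le.trans hy⟩
  rw [h]; nlinarith

theorem φ_strictMonoOn (hB : B.IsTame) : StrictMonoOn B.φ (Icc 0 1) := by
  intro x hx y hy hxy
  have := half_mul_le_φ_sub hB hx.1 hxy.le hy.2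
  linarith

theorem φ_mem (hB : B.IsTame) {x : ℝ} (hx : x ∈ Icc (0 : ℝ) 1) : B.φ x ∈ Icc (0 : ℝ) 1 := by
  have h1 := half_mul_le_φ_sub hB le_rfl hx.1 hx.2
  have h2 := half_mul_le_φ_sub hB hx.1 hx.2 le_rfl
  rw [hB.map_zero] at h1
  rw [hB.map_one] at h2
  exact ⟨by linarith [hx.1], by linarith [hx.2]⟩

theorem map_fix_one (hB : B.IsTame) : B.map α 1 = 1 := by
  rw [map, core_one hB, hB.map_one]

theorem map_c (hα : 1 < α) : B.map α B.c = B.φ (1 - B.v) := by rw [map, core_c hα]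

theorem map_mem (hB : B.IsTame) (hα : 1 < α) {x : ℝ} (hx : x ∈ Icc B.c 1) :
    B.map α x ∈ Icc (0 : ℝ) 1 := φ_mem hB (core_mem hB hα hx)

theorem core_monotoneOn (hB : B.IsTame) (hα : 1 < α) : MonotoneOn (B.core α) (Icc B.c 1) := by
  rcases hB.v_nonneg.eq_or_lt with hv | hv
  · intro x _ y _ _
    simp [core, ← hv]
  · exact (core_strictMonoOn hB hα hv).monotoneOn

theorem map_monotoneOn (hB : B.IsTame) (hα : 1 < α) : MonotoneOn (B.map α) (Icc B.c 1) :=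
  fun _ hx _ hy hxy => (φ_strictMonoOn hB).monotoneOn (core_mem hB hα hx) (core_mem hB hα hy)
    (core_monotoneOn hB hα hx hy hxy)

theorem map_strictMonoOn (hB : B.IsTame) (hα : 1 < α) (hv : 0 < B.v) :
    StrictMonoOn (B.map α) (Icc B.c 1) :=
  fun _ hx _ hy hxy => φ_strictMonoOn hB (core_mem hB hα hx) (core_mem hB hα hy)
    (core_strictMonoOn hB hα hv hx hy hxy)

theorem hasDerivAt_core (hα : 1 < α) (x : ℝ) :
    HasDerivAt (B.core α) (B.v * (α * (B.coord x) ^ (α - 1) / (1 - B.c))) x := by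
  have h1 : HasDerivAt B.coord (1 / (1 - B.c)) x :=
    ((hasDerivAt_id x).sub_const B.c).div_const _
  have h2 := (Real.hasDerivAt_rpow_const (x := B.coord x) (p := α) (Or.inr hα.le)).comp x h1
  have h3 := ((h2.const_add (-1)).const_mul B.v).const_add 1
  refine h3.congr_deriv ?_
  ring

theorem hasDerivWithinAt_map (hB : B.IsTame) (hα : 1 < α) {x : ℝ} (hx : x ∈ Icc B.c 1) :
    HasDerivWithinAt (B.map α) (B.slope α x) (Icc B.c 1) x :=
  HasDerivWithinAt.comp x (hB.hasDeriv _ (core_mem hB hα hx))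
    (hasDerivAt_core hα x).hasDerivWithinAt fun _ hy => core_mem hB hα hy

theorem continuousOn_map (hB : B.IsTame) (hα : 1 < α) : ContinuousOn (B.map α) (Icc B.c 1) :=
  fun _ hx => (hasDerivWithinAt_map hB hα hx).continuousWithinAt

theorem continuousOn_φ (hB : B.IsTame) : ContinuousOn B.φ (Icc 0 1) :=
  fun x hx => (hB.hasDeriv x hx).continuousWithinAt

theorem continuousOn_ψ (hB : B.IsTame) : ContinuousOn B.ψ (Icc 0 1) := by
  intro x hx
  rw [ContinuousWithinAt, tendsto_iff_norm_sub_tendsto_zero]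
  have h : Tendsto (fun y => |y - x|) (𝓝[Icc 0 1] x) (𝓝 0) := by
    have : Tendsto (fun y => |y - x|) (𝓝 x) (𝓝 0) :=
      (by fun_prop : Continuous fun y => |y - x|).tendsto' _ _ (by simp)
    exact this.mono_left nhdsWithin_le_nhds
  refine squeeze_zero' (Eventually.of_forall fun _ => norm_nonneg _) ?_ h
  filter_upwards [self_mem_nhdsWithin] with y hy
  exact hB.lipschitz y hy x hx

/-- Without fixed points in the interior, the branch lies below the diagonal. -/
theorem map_le_self (hB : B.IsTame) (hα : 1 < α) (hc : B.map α B.c < B.c)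
    (hfix : ∀ x ∈ Ioo B.c 1, B.map α x ≠ x) {x : ℝ} (hx : x ∈ Icc B.c 1) : B.map α x ≤ x := by
  by_contra! hlt
  have hx1 : x < 1 := by
    rcases hx.2.eq_or_lt with h | h
    · rw [h, map_fix_one hB] at hlt
      exact absurd hlt (lt_irrefl _)
    · exact h
  have hcont : ContinuousOn (fun y => B.map α y - y) (Icc B.c x) :=
    ((continuousOn_map hB hα).mono (Icc_subset_Icc le_rfl hx.2)).sub continuousOn_id
  have h0 : (0 : ℝ) ∈ Ioo (B.map α B.c - B.c) (B.map α x - x) := ⟨by linarith, by linarith⟩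
  obtain ⟨y, hy, hy0⟩ := intermediate_value_Ioo hx.1 hcont h0
  exact hfix y ⟨hy.1, hy.2.trans hx1⟩ (by linarith [hy0])

/-- Convergence of branches along a filter, with uniform convergence of the diffeomorphic parts and
of their derivatives. -/
structure TendsTo {ι : Type*} (L : Filter ι) (B : ι → Branch) (B₀ : Branch) : Prop where
  c : Tendsto (fun i => (B i).c) L (𝓝 B₀.c)
  v : Tendsto (fun i => (B i).v) L (𝓝 B₀.v)
  φ : ∀ ε > 0, ∀ᶠ i in L, ∀ x ∈ Icc (0 : ℝ) 1, |(B i).φ x - B₀.φ x| < ε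
  ψ : ∀ ε > 0, ∀ᶠ i in L, ∀ x ∈ Icc (0 : ℝ) 1, |(B i).ψ x - B₀.ψ x| < ε

namespace TendsTo

variable {ι κ : Type*} {L : Filter ι} {𝓑 : ι → Branch}

theorem comp {K : Filter κ} {k : κ → ι} (h : TendsTo L 𝓑 B) (hk : Tendsto k K L) :
    TendsTo K (fun i => 𝓑 (k i)) B where
  c := h.c.comp hk
  v := h.v.comp hk
  φ := fun ε hε => hk.eventually (h.φ ε hε)
  ψ := fun ε hε => hk.eventually (h.ψ ε hε)

theorem mono {L' : Filter ι} (h : TendsTo L 𝓑 B) (hL : L' ≤ L) : TendsTo L' 𝓑 B :=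
  h.comp (tendsto_id'.2 hL)

theorem const : TendsTo L (fun _ => B) B where
  c := tendsto_const_nhds
  v := tendsto_const_nhds
  φ := fun ε hε => Eventually.of_forall fun _ _ _ => by simpa using hε
  ψ := fun ε hε => Eventually.of_forall fun _ _ _ => by simpa using hε

theorem tendsto_apply {F : ι → ℝ → ℝ} {F₀ : ℝ → ℝ} {s : Set ℝ}
    (hF : ∀ ε > 0, ∀ᶠ i in L, ∀ x ∈ s, |F i x - F₀ x| < ε) (hF₀ : ContinuousOn F₀ s)
    {X : ι → ℝ} {x : ℝ} (hX : Tendsto X L (𝓝 x)) (hXs : ∀ᶠ i in L, X i ∈ s) (hx : x ∈ s) :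
    Tendsto (fun i => F i (X i)) L (𝓝 (F₀ x)) := by
  have h1 : Tendsto (fun i => F₀ (X i)) L (𝓝 (F₀ x)) :=
    (hF₀ x hx).tendsto.comp (tendsto_nhdsWithin_iff.2 ⟨hX, hXs⟩)
  rw [Metric.tendsto_nhds] at h1 ⊢
  intro ε hε
  filter_upwards [h1 (ε / 2) (half_pos hε), hF (ε / 2) (half_pos hε), hXs] with i h2 h3 h4
  have h5 := h3 _ h4
  rw [Real.dist_eq] at h2 ⊢
  have := abs_sub_le (F i (X i)) (F₀ (X i)) (F₀ x)
  linarith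

theorem coord (h : TendsTo L 𝓑 B) (hB : B.IsTame) {X : ι → ℝ} {x : ℝ} (hX : Tendsto X L (𝓝 x)) :
    Tendsto (fun i => (𝓑 i).coord (X i)) L (𝓝 (B.coord x)) := by
  have := hB.c_lt_one
  exact (hX.sub h.c).div (tendsto_const_nhds.sub h.c) (by linarith)

theorem core (h : TendsTo L 𝓑 B) (hB : B.IsTame) (hα : 1 < α) {X : ι → ℝ} {x : ℝ}
    (hX : Tendsto X L (𝓝 x)) :
    Tendsto (fun i => (𝓑 i).core α (X i)) L (𝓝 (B.core α x)) :=
  (h.v.mul (((h.coord hB hX).rpow_const (Or.inr (by linarith))).const_add (-1))).const_add 1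

theorem mem_of_tendsto [L.NeBot] (h : TendsTo L 𝓑 B) {X : ι → ℝ} {x : ℝ}
    (hX : Tendsto X L (𝓝 x)) (hXs : ∀ᶠ i in L, X i ∈ Icc (𝓑 i).c 1) : x ∈ Icc B.c 1 :=
  ⟨le_of_tendsto_of_tendsto h.c hX (hXs.mono fun _ hi => hi.1),
    le_of_tendsto hX (hXs.mono fun _ hi => hi.2)⟩

theorem map [L.NeBot] (h : TendsTo L 𝓑 B) (hB : B.IsTame) (h𝓑 : ∀ i, (𝓑 i).IsTame) (hα : 1 < α)
    {X : ι → ℝ} {x : ℝ} (hX : Tendsto X L (𝓝 x)) (hXs : ∀ᶠ i in L, X i ∈ Icc (𝓑 i).c 1) :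
    Tendsto (fun i => (𝓑 i).map α (X i)) L (𝓝 (B.map α x)) :=
  tendsto_apply h.φ (continuousOn_φ hB) (h.core hB hα hX)
    (hXs.mono fun i hi => core_mem (h𝓑 i) hα hi) (core_mem hB hα (h.mem_of_tendsto hX hXs))

theorem ψ_core [L.NeBot] (h : TendsTo L 𝓑 B) (hB : B.IsTame) (h𝓑 : ∀ i, (𝓑 i).IsTame)
    (hα : 1 < α) {X : ι → ℝ} {x : ℝ} (hX : Tendsto X L (𝓝 x))
    (hXs : ∀ᶠ i in L, X i ∈ Icc (𝓑 i).c 1) :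
    Tendsto (fun i => (𝓑 i).ψ ((𝓑 i).core α (X i))) L (𝓝 (B.ψ (B.core α x))) :=
  tendsto_apply h.ψ (continuousOn_ψ hB) (h.core hB hα hX)
    (hXs.mono fun i hi => core_mem (h𝓑 i) hα hi) (core_mem hB hα (h.mem_of_tendsto hX hXs))

theorem slope [L.NeBot] (h : TendsTo L 𝓑 B) (hB : B.IsTame) (h𝓑 : ∀ i, (𝓑 i).IsTame)
    (hα : 1 < α) {X : ι → ℝ} {x : ℝ} (hX : Tendsto X L (𝓝 x))
    (hXs : ∀ᶠ i in L, X i ∈ Icc (𝓑 i).c 1) :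
    Tendsto (fun i => (𝓑 i).slope α (X i)) L (𝓝 (B.slope α x)) := by
  have hc := hB.c_lt_one
  refine (h.ψ_core hB h𝓑 hα hX hXs).mul (h.v.mul (Tendsto.div ?_ (tendsto_const_nhds.sub h.c)
    (by linarith)))
  exact ((h.coord hB hX).rpow_const (Or.inr (by linarith))).const_mul α

/-- By continuity every ultrafilter limit of `X` has image `B.map α x`, and injectivity of the limit
branch identifies it with `x`. In this sense inverse branches converge too. -/
theorem of_map [L.NeBot] (h : TendsTo L 𝓑 B) (hB : B.IsTame) (h𝓑 : ∀ i, (𝓑 i).IsTame)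
    (hα : 1 < α) (hv : 0 < B.v) {X : ι → ℝ} {x : ℝ} (hXs : ∀ᶠ i in L, X i ∈ Icc (𝓑 i).c 1)
    (hx : x ∈ Icc B.c 1) (hX : Tendsto (fun i => (𝓑 i).map α (X i)) L (𝓝 (B.map α x))) :
    Tendsto X L (𝓝 x) := by
  rw [tendsto_iff_ultrafilter]
  intro G hG
  have hXG : ∀ᶠ i in (G : Filter ι), X i ∈ Icc (𝓑 i).c 1 := hXs.filter_mono hG
  obtain ⟨x', -, hx'⟩ := G.exists_tendsto_of_eventually_mem (isCompact_Icc (a := (0 : ℝ)) (b := 1))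
    (f := X) (hXG.mono fun i hi => ⟨(h𝓑 i).c_pos.le.trans hi.1, hi.2⟩)
  have h1 := (h.mono hG).map hB h𝓑 hα hx' hXG
  have h2 := tendsto_nhds_unique h1 (hX.mono_left hG)
  have h3 := (map_strictMonoOn hB hα hv).injOn ((h.mono hG).mem_of_tendsto hx' hXG) hx h2
  rwa [h3] at hx'

theorem iterate [L.NeBot] (h : TendsTo L 𝓑 B) (hB : B.IsTame) (h𝓑 : ∀ i, (𝓑 i).IsTame)
    (hα : 1 < α) {X : ι → ℝ} {x : ℝ} (hX : Tendsto X L (𝓝 x)) {k : ℕ}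
    (hXs : ∀ j < k, ∀ᶠ i in L, ((𝓑 i).map α)^[j] (X i) ∈ Icc (𝓑 i).c 1) :
    Tendsto (fun i => ((𝓑 i).map α)^[k] (X i)) L (𝓝 ((B.map α)^[k] x)) := by
  induction k with
  | zero => exact hX
  | succ k ih =>
    simp only [Function.iterate_succ_apply']
    exact h.map hB h𝓑 hα (ih fun j hj => hXs j (by omega)) (hXs k (by omega))

/-- A limit of points which stay in `[c, 1]` for longer and longer times is the fixed point. -/
theorem eq_one_of_forall_iterate [L.NeBot] (h : TendsTo L 𝓑 B) (hB : B.IsTame)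
    (h𝓑 : ∀ i, (𝓑 i).IsTame) (hα : 1 < α) (hc : B.map α B.c < B.c)
    (hfix : ∀ x ∈ Ioo B.c 1, B.map α x ≠ x) {X : ι → ℝ} {x : ℝ} (hX : Tendsto X L (𝓝 x))
    (hXs : ∀ j : ℕ, ∀ᶠ i in L, ((𝓑 i).map α)^[j] (X i) ∈ Icc (𝓑 i).c 1) : x = 1 := by
  have hmem : ∀ j, (B.map α)^[j] x ∈ Icc B.c 1 := fun j =>
    h.mem_of_tendsto (h.iterate hB h𝓑 hα hX fun k _ => hXs k) (hXs j)
  -- The limit orbit stays in `[c, 1]` and decreases, since the branch lies below the diagonal. It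
  -- tends to a fixed point, which is not `c` because `B.map α B.c < B.c`; hence it tends to `1`,
  -- and its first term is already `1`.
  have hanti : Antitone fun j => (B.map α)^[j] x := antitone_nat_of_succ_le fun j => by
    rw [Function.iterate_succ_apply']
    exact map_le_self hB hα hc hfix (hmem j)
  obtain ⟨y, hy⟩ : ∃ y, Tendsto (fun j => (B.map α)^[j] x) atTop (𝓝 y) :=
    ⟨_, tendsto_atTop_ciInf hanti ⟨B.c, by rintro _ ⟨j, rfl⟩; exact (hmem j).1⟩⟩
  have hyI : y ∈ Icc B.c 1 := isClosed_Icc.mem_of_tendsto hy (Eventually.of_forall hmem)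
  have hfixy : B.map α y = y := by
    have h1 : Tendsto (fun j => B.map α ((B.map α)^[j] x)) atTop (𝓝 (B.map α y)) :=
      (continuousOn_map hB hα y hyI).tendsto.comp
        (tendsto_nhdsWithin_iff.2 ⟨hy, Eventually.of_forall hmem⟩)
    have h2 := (tendsto_add_atTop_iff_nat 1).2 hy
    simp only [Function.iterate_succ_apply'] at h2
    exact tendsto_nhds_unique h1 h2
  have hy1 : y = 1 := by
    by_contra hne
    rcases hyI.1.eq_or_lt with h1 | h1
    · rw [← h1] at hfixy
      linarith
    · exact hfix y ⟨h1, lt_of_le_of_ne hyI.2 hne⟩ hfixy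
  have h3 : y ≤ x := hanti.le_of_tendsto hy 0
  exact le_antisymm (hmem 0).2 (hy1 ▸ h3)

end TendsTo

end Branch

/-! ### Distortion and expansion along long orbits -/

namespace Branch

variable {α : ℝ} {B : Branch}

theorem exists_map_slope_eq (hB : B.IsTame) (hα : 1 < α) {x y : ℝ} (hx : B.c ≤ x) (hxy : x < y)
    (hy : y ≤ 1) : ∃ ξ ∈ Ioo x y, B.map α y - B.map α x = B.slope α ξ * (y - x) := by
  have hsub : Icc x y ⊆ Icc B.c 1 := Icc_subset_Icc hx hy
  obtain ⟨ξ, hξ, h⟩ := exists_hasDerivAt_eq_slope (B.map α) (B.slope α) hxy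
    ((continuousOn_map hB hα).mono hsub)
    (fun z hz => (hasDerivWithinAt_map hB hα (hsub ⟨hz.1.le, hz.2.le⟩)).hasDerivAt
      (Icc_mem_nhds (hx.trans_lt hz.1) (hz.2.trans_le hy)))
  refine ⟨ξ, hξ, ?_⟩
  rw [h]
  have : y - x ≠ 0 := by linarith
  field_simp

theorem slope_one (hB : B.IsTame) : B.slope α 1 = B.ψ 1 * (B.v * (α / (1 - B.c))) := by
  rw [slope, core_one hB, coord_one hB, Real.one_rpow, mul_one]

/-- The backward orbit of the critical point under a full branch. -/
theorem exists_backward_orbit (hB : B.IsTame) (hα : 1 < α) (hv : B.v = 1)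
    (hfix : ∀ x ∈ Ioo B.c 1, B.map α x ≠ x) :
    ∃ o : ℕ → ℝ, (∀ j, o j ∈ Ioo B.c 1) ∧ B.map α (o 0) = B.c ∧
      (∀ j, B.map α (o (j + 1)) = o j) ∧ Tendsto o atTop (𝓝 1) := by
  have hc0 : B.map α B.c = 0 := by rw [map_c hα, hv, sub_self, hB.map_zero]
  have hsurj : ∀ y : Ioo (0 : ℝ) 1, ∃ x ∈ Ioo B.c 1, B.map α x = y := by
    intro y
    have := intermediate_value_Ioo hB.c_lt_one.le (continuousOn_map hB hα)
    rw [hc0, map_fix_one hB] at this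
    exact this y.2
  choose g hg1 hg2 using hsurj
  have hmem : ∀ y, g y ∈ Ioo (0 : ℝ) 1 := fun y => ⟨hB.c_pos.trans (hg1 y).1, (hg1 y).2⟩
  -- The recursion runs in the subtype because preimages are chosen only for points of `(0, 1)`.
  set O : ℕ → Ioo (0 : ℝ) 1 := fun j => Nat.rec ⟨g ⟨B.c, hB.c_pos, hB.c_lt_one⟩, hmem _⟩
    (fun _ x => ⟨g x, hmem x⟩) j with hO
  have hOs : ∀ j, (O (j + 1) : ℝ) = g (O j) := fun j => rfl
  have hO0 : (O 0 : ℝ) = g ⟨B.c, hB.c_pos, hB.c_lt_one⟩ := rfl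
  have hOm : ∀ j, (O j : ℝ) ∈ Ioo B.c 1 := by
    intro j
    cases j with
    | zero => exact hg1 _
    | succ j => rw [hOs]; exact hg1 _
  have hOe : ∀ j, B.map α (O (j + 1)) = O j := fun j => by rw [hOs, hg2]
  refine ⟨fun j => O j, hOm, by beta_reduce; rw [hO0, hg2], hOe, ?_⟩
  have hmono : Monotone fun j => (O j : ℝ) := monotone_nat_of_le_succ fun j => by
    rw [← hOe j]
    exact map_le_self hB hα (by rw [hc0]; exact hB.c_pos) hfix
      ⟨(hOm (j + 1)).1.le, (hOm (j + 1)).2.le⟩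
  obtain ⟨y, hy⟩ : ∃ y, Tendsto (fun j => (O j : ℝ)) atTop (𝓝 y) :=
    ⟨_, tendsto_atTop_ciSup hmono ⟨1, by rintro _ ⟨j, rfl⟩; exact (hOm j).2.le⟩⟩
  have hyI : y ∈ Icc B.c 1 := isClosed_Icc.mem_of_tendsto hy
    (Eventually.of_forall fun j => Ioo_subset_Icc_self (hOm j))
  have hyc : B.c < y := (hOm 0).1.trans_le (hmono.ge_of_tendsto hy 0)
  have hfixy : B.map α y = y := by
    have h1 : Tendsto (fun j => B.map α (O j)) atTop (𝓝 (B.map α y)) :=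
      (continuousOn_map hB hα y hyI).tendsto.comp
        (tendsto_nhdsWithin_iff.2 ⟨hy, Eventually.of_forall fun j => Ioo_subset_Icc_self (hOm j)⟩)
    have h2 := (tendsto_add_atTop_iff_nat 1).2 h1
    simp only [hOe] at h2
    exact tendsto_nhds_unique h2 hy
  rcases hyI.2.eq_or_lt with h1 | h1
  · rwa [h1] at hy
  · exact absurd hfixy (hfix y ⟨hyc, h1⟩)

theorem iterate_mem (hB : B.IsTame) (hα : 1 < α) {y : ℝ} {a : ℕ} (hy1 : y ≤ 1)
    (hy : ∀ i < a, B.c ≤ (B.map α)^[i] y) {i : ℕ} (hi : i < a) :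
    (B.map α)^[i] y ∈ Icc B.c 1 := by
  induction i with
  | zero => exact ⟨hy 0 hi, hy1⟩
  | succ i ih =>
    refine ⟨hy _ hi, ?_⟩
    rw [Function.iterate_succ_apply']
    exact (map_mem hB hα (ih (by omega))).2

theorem abs_log_sub_log_le {x y : ℝ} (hx : 1 / 2 ≤ x) (hy : 1 / 2 ≤ y) :
    |Real.log x - Real.log y| ≤ 2 * |x - y| := by
  have key : ∀ x y : ℝ, 1 / 2 ≤ x → 1 / 2 ≤ y → Real.log x - Real.log y ≤ 2 * |x - y| := by
    intro x y hx hy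
    have hx0 : 0 < x := by linarith
    have hy0 : 0 < y := by linarith
    rw [← Real.log_div hx0.ne' hy0.ne']
    refine (Real.log_le_sub_one_of_pos (div_pos hx0 hy0)).trans ?_
    have h1 : x / y - 1 = (x - y) / y := by field_simp
    rw [h1, div_le_iff₀ hy0]
    have h2 := le_abs_self (x - y)
    have h3 := abs_nonneg (x - y)
    nlinarith
  rw [abs_le]
  refine ⟨?_, key x y hx hy⟩
  have := key y x hy hx
  rw [abs_sub_comm] at this
  linarith

/-- Logarithm of the ratio between the slope at `x` and the slope at the fixed point. -/
noncomputable def logSlope (α : ℝ) (B : Branch) (x : ℝ) : ℝ :=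
  Real.log (B.ψ (B.core α x)) - Real.log (B.ψ 1) + (α - 1) * Real.log (B.coord x)

theorem slope_eq_exp (hB : B.IsTame) (hα : 1 < α) {x : ℝ} (hx : x ∈ Ioc B.c 1) :
    B.slope α x = B.slope α 1 * Real.exp (B.logSlope α x) := by
  have h1 : 0 < B.ψ (B.core α x) := by
    linarith [hB.half_le _ (core_mem hB hα ⟨hx.1.le, hx.2⟩)]
  have h2 : 0 < B.ψ 1 := by linarith [hB.half_le 1 (by norm_num)]
  have h3 : 0 < B.coord x := div_pos (by linarith [hx.1]) (by linarith [hB.c_lt_one])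
  rw [logSlope, Real.exp_add, Real.exp_sub, Real.exp_log h1, Real.exp_log h2, slope_one hB, slope,
    Real.rpow_def_of_pos h3, mul_comm (α - 1)]
  field_simp

/-- Closeness to the fixed point makes the distortion summable along orbits tending to it. The term
`2 * α` combines the Lipschitz constant `2` of `log` on `[1/2, ∞)`, the constant `1` of `ψ`, and
Bernoulli's `1 - t ^ α ≤ α * (1 - t)`; the term `(α - 1) / s` comes from `-log t ≤ (1 - t) / t`. -/
theorem abs_logSlope_le (hB : B.IsTame) (hα : 1 < α) {x s : ℝ} (hx : x ∈ Icc B.c 1) (hs : 0 < s)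
    (hsx : s ≤ B.coord x) :
    |B.logSlope α x| ≤ (2 * α + (α - 1) / s) * ((1 - x) / (1 - B.c)) := by
  have hc := coord_mem hB hx
  have hc1 : 1 - B.coord x = (1 - x) / (1 - B.c) := by
    have : 1 - B.c ≠ 0 := by linarith [hB.c_lt_one]
    rw [coord]; field_simp; ring
  rw [← hc1]
  set t := B.coord x with ht
  have htpos : 0 < t := hs.trans_le hsx
  have hcm := core_mem hB hα hx
  have h1 : |Real.log (B.ψ (B.core α x)) - Real.log (B.ψ 1)| ≤ 2 * α * (1 - t) := by
    refine (abs_log_sub_log_le (hB.half_le _ hcm) (hB.half_le 1 (by norm_num))).trans ?_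
    have h2 := hB.lipschitz _ hcm 1 (by norm_num)
    rw [abs_of_nonpos (by linarith [hcm.2] : B.core α x - 1 ≤ 0)] at h2
    have h3 : 1 + α * (t - 1) ≤ t ^ α := by
      have := one_add_mul_self_le_rpow_one_add (s := t - 1) (by linarith) hα.le
      simpa using this
    have h4 : t ^ α ≤ 1 := Real.rpow_le_one hc.1 hc.2 (by linarith)
    have h5 : -(B.core α x - 1) = B.v * (1 - t ^ α) := by rw [core]; ring
    have h6 : B.v * (1 - t ^ α) ≤ 1 * (1 - t ^ α) :=
      mul_le_mul_of_nonneg_right hB.v_le_one (by linarith)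
    nlinarith
  have h2 : |(α - 1) * Real.log t| ≤ (α - 1) / s * (1 - t) := by
    rw [abs_mul, abs_of_pos (by linarith : 0 < α - 1), div_mul_eq_mul_div, mul_div_assoc]
    refine mul_le_mul_of_nonneg_left ?_ (by linarith)
    have h3 := Real.one_sub_inv_le_log_of_pos htpos
    rw [abs_of_nonpos (Real.log_nonpos hc.1 hc.2)]
    have h4 : (1 - t) / t ≤ (1 - t) / s :=
      div_le_div_of_nonneg_left (by linarith [hc.2]) hs hsx
    have h5 : (1 - t) / t = t⁻¹ - 1 := by field_simp
    linarith
  rw [logSlope]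
  refine (abs_add_le _ _).trans ?_
  rw [add_mul]
  exact add_le_add h1 h2

namespace TendsTo

variable {ι : Type*} {L : Filter ι} {𝓑 : ι → Branch}

theorem logSlope [L.NeBot] (h : TendsTo L 𝓑 B) (hB : B.IsTame) (h𝓑 : ∀ i, (𝓑 i).IsTame)
    (hα : 1 < α) {X : ι → ℝ} {x : ℝ} (hX : Tendsto X L (𝓝 x)) (hx : B.c < x)
    (hXs : ∀ᶠ i in L, X i ∈ Icc (𝓑 i).c 1) :
    Tendsto (fun i => (𝓑 i).logSlope α (X i)) L (𝓝 (B.logSlope α x)) := by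
  have hc := hB.c_lt_one
  have hm := h.mem_of_tendsto hX hXs
  have h1 : 0 < B.ψ (B.core α x) := by linarith [hB.half_le _ (core_mem hB hα hm)]
  have h2 : 0 < B.ψ 1 := by linarith [hB.half_le 1 (by norm_num)]
  have h3 : 0 < B.coord x := div_pos (by linarith) (by linarith)
  have h4 : Tendsto (fun i => (𝓑 i).ψ 1) L (𝓝 (B.ψ 1)) :=
    tendsto_apply h.ψ (continuousOn_ψ hB) tendsto_const_nhds
      (Eventually.of_forall fun _ => by norm_num) (by norm_num)
  exact (((h.ψ_core hB h𝓑 hα hX hXs).log h1.ne').sub (h4.log h2.ne')).add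
    (((h.coord hB hX).log h3.ne').const_mul _)

/-- Uniform expansion near the fixed point. -/
theorem exists_expanding [L.NeBot] (h : TendsTo L 𝓑 B) (hB : B.IsTame)
    (h𝓑 : ∀ i, (𝓑 i).IsTame) (hα : 1 < α) {μ : ℝ} (hμ : μ < B.slope α 1) :
    ∃ ρ > 0, ∀ᶠ i in L, ∀ x ∈ Icc (1 - ρ) 1, x ∈ Icc (𝓑 i).c 1 ∧ μ < (𝓑 i).slope α x := by
  -- Uniformity for `x` near `1` is expressed as convergence along the product filter `L ×ˢ 𝓝[≤] 1`.
  have hfst : Tendsto (Prod.fst : ι × ℝ → ι) (L ×ˢ 𝓝[≤] (1 : ℝ)) L := tendsto_fst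
  have hsnd : Tendsto (Prod.snd : ι × ℝ → ℝ) (L ×ˢ 𝓝[≤] (1 : ℝ)) (𝓝[≤] 1) := tendsto_snd
  have hsnd' := hsnd.mono_right nhdsWithin_le_nhds
  have hmem : ∀ᶠ z in L ×ˢ 𝓝[≤] (1 : ℝ), z.2 ∈ Icc (𝓑 z.1).c 1 := by
    have h1 := (h.c.comp hfst).eventually_lt hsnd' hB.c_lt_one
    filter_upwards [h1, hsnd.eventually self_mem_nhdsWithin] with z h2 h3
    exact ⟨h2.le, h3⟩
  have hsl := (h.comp hfst).slope hB (fun z => h𝓑 z.1) hα hsnd' hmem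
  have hev := hmem.and (hsl.eventually (lt_mem_nhds hμ))
  obtain ⟨pa, hpa, pb, hpb, hab⟩ := eventually_prod_iff.1 hev
  obtain ⟨l, hl, hls⟩ := (mem_nhdsLE_iff_exists_Icc_subset).1 hpb
  refine ⟨1 - l, by linarith, ?_⟩
  filter_upwards [hpa] with i hi x hx
  exact hab hi (hls ⟨by linarith [hx.1], hx.2⟩)

variable {o : ℕ → ℝ} {a : ι → ℕ} {Y : ι → ℝ}

/-- Orbits ending near the critical point shadow the backward orbit of the critical point. -/
theorem tendsto_backward [L.NeBot] (h : TendsTo L 𝓑 B) (hB : B.IsTame) (h𝓑 : ∀ i, (𝓑 i).IsTame)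
    (hα : 1 < α) (hv : B.v = 1) (ho : ∀ j, o j ∈ Ioo B.c 1) (ho0 : B.map α (o 0) = B.c)
    (hos : ∀ j, B.map α (o (j + 1)) = o j) (ha : Tendsto a L atTop)
    (hY : ∀ n, ∀ i < a n, ((𝓑 n).map α)^[i] (Y n) ∈ Icc (𝓑 n).c 1)
    (hend : Tendsto (fun n => ((𝓑 n).map α)^[a n] (Y n)) L (𝓝 B.c)) (j : ℕ) :
    Tendsto (fun n => ((𝓑 n).map α)^[a n - 1 - j] (Y n)) L (𝓝 (o j)) := by
  have hv' : 0 < B.v := by rw [hv]; exact one_pos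
  have hmem : ∀ j, ∀ᶠ n in L, ((𝓑 n).map α)^[a n - 1 - j] (Y n) ∈ Icc (𝓑 n).c 1 := fun j => by
    filter_upwards [ha.eventually_ge_atTop 1] with n hn
    exact hY n _ (by omega)
  -- Each step backwards uses `of_map`. The index `a n - 1 - j` counts back from the last time at
  -- which the orbit is known to lie in `[c, 1]`; truncated subtraction is harmless since `a n`
  -- tends to infinity.
  induction j with
  | zero =>
    refine h.of_map hB h𝓑 hα hv' (hmem 0) (Ioo_subset_Icc_self (ho 0)) ?_
    rw [ho0]
    refine hend.congr' ?_
    filter_upwards [ha.eventually_ge_atTop 1] with n hn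
    rw [← Function.iterate_succ_apply' (f := (𝓑 n).map α)]
    congr 1
    omega
  | succ j ih =>
    refine h.of_map hB h𝓑 hα hv' (hmem _) (Ioo_subset_Icc_self (ho _)) ?_
    rw [hos]
    refine ih.congr' ?_
    filter_upwards [ha.eventually_ge_atTop (j + 2)] with n hn
    rw [← Function.iterate_succ_apply' (f := (𝓑 n).map α)]
    congr 1
    omega

/-- Backward orbits converge to the fixed point at a uniform exponential rate. -/
theorem exists_exponential_bound [L.NeBot] (h : TendsTo L 𝓑 B) (hB : B.IsTame)
    (h𝓑 : ∀ i, (𝓑 i).IsTame) (hα : 1 < α) (hlam : 1 < B.slope α 1)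
    (hbelow : ∀ n, ∀ x ∈ Icc (𝓑 n).c 1, (𝓑 n).map α x ≤ x) (hot : Tendsto o atTop (𝓝 1))
    (hY : ∀ n, ∀ i < a n, ((𝓑 n).map α)^[i] (Y n) ∈ Icc (𝓑 n).c 1)
    (hback : ∀ j, Tendsto (fun n => ((𝓑 n).map α)^[a n - 1 - j] (Y n)) L (𝓝 (o j))) :
    ∃ C q : ℝ, 0 < C ∧ 0 < q ∧ q < 1 ∧
      ∀ᶠ n in L, ∀ j < a n, 1 - ((𝓑 n).map α)^[a n - 1 - j] (Y n) ≤ C * q ^ j := by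
  obtain ⟨μ, hμ1, hμ2⟩ := exists_between hlam
  have hμ0 : 0 < μ := by linarith
  obtain ⟨ρ, hρ, hexp⟩ := h.exists_expanding hB h𝓑 hα hμ2
  -- From `J` steps before the end backwards, the orbit lies in the region of expansion by `μ`; it
  -- cannot leave it backwards, being below the diagonal. The constant `μ ^ J` accounts for the `J`
  -- remaining steps, where the distance to `1` is bounded only by `1`.
  obtain ⟨J, hJ⟩ := (hot.eventually (lt_mem_nhds (by linarith : 1 - ρ < 1))).exists
  refine ⟨μ ^ J, μ⁻¹, by positivity, by positivity, inv_lt_one_of_one_lt₀ hμ1, ?_⟩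
  filter_upwards [hexp, (hback J).eventually (lt_mem_nhds hJ)] with n hn hnJ
  have hstep : ∀ j, j + 1 < a n → (𝓑 n).map α (((𝓑 n).map α)^[a n - 1 - (j + 1)] (Y n))
      = ((𝓑 n).map α)^[a n - 1 - j] (Y n) := by
    intro j hj
    rw [← Function.iterate_succ_apply' (f := (𝓑 n).map α)]
    congr 1
    omega
  have hle1 : ∀ j < a n, 1 - ((𝓑 n).map α)^[a n - 1 - j] (Y n) ≤ 1 := by
    intro j hj
    have := (hY n (a n - 1 - j) (by omega)).1
    linarith [(h𝓑 n).c_pos]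
  have hge : ∀ k, J + k < a n → 1 - ρ < ((𝓑 n).map α)^[a n - 1 - (J + k)] (Y n) := by
    intro k
    induction k with
    | zero => intro _; exact hnJ
    | succ k ih =>
      intro hk
      refine (ih (by omega)).trans_le ?_
      rw [← hstep (J + k) hk]
      exact hbelow n _ (hY n _ (by omega))
  have hk : ∀ k, J + k < a n → 1 - ((𝓑 n).map α)^[a n - 1 - (J + k)] (Y n) ≤ (μ⁻¹) ^ k := by
    intro k
    induction k with
    | zero => intro hk; simpa using hle1 J hk
    | succ k ih =>
      intro hk
      have h1 := ih (by omega)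
      have hmem := hY n (a n - 1 - (J + k + 1)) (by omega)
      have h2 : μ * (1 - ((𝓑 n).map α)^[a n - 1 - (J + k + 1)] (Y n)) ≤
          1 - ((𝓑 n).map α)^[a n - 1 - (J + k)] (Y n) := by
        rw [← hstep (J + k) hk]
        rcases hmem.2.eq_or_lt with heq | hlt
        · rw [heq, map_fix_one (h𝓑 n)]; simp
        · obtain ⟨ξ, hξ, hξe⟩ := exists_map_slope_eq (h𝓑 n) hα hmem.1 hlt le_rfl
          rw [map_fix_one (h𝓑 n)] at hξe
          rw [hξe]
          have h3 := (hn ξ ⟨((hge (k + 1) hk).trans hξ.1).le, hξ.2.le⟩).2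
          exact mul_le_mul_of_nonneg_right h3.le (by linarith)
      rw [pow_succ, mul_comm, ← div_eq_inv_mul, le_div_iff₀ hμ0, mul_comm]
      exact h2.trans h1
  intro j hj
  rcases le_total J j with hJj | hJj
  · obtain ⟨k, rfl⟩ := Nat.exists_eq_add_of_le hJj
    refine (hk k hj).trans (le_of_eq ?_)
    rw [pow_add, ← mul_assoc, ← mul_pow, mul_inv_cancel₀ hμ0.ne', one_pow, one_mul]
  · refine (hle1 j hj).trans ?_
    rw [inv_pow, ← div_eq_mul_inv, one_le_div (by positivity)]
    exact pow_le_pow_right₀ hμ1.le hJj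

end TendsTo

end Branch

namespace Branch

variable {α : ℝ} {B : Branch}

theorem iterate_lt_iterate (hB : B.IsTame) (hα : 1 < α) (hv : 0 < B.v) {y z : ℝ} {a : ℕ}
    (hyz : y < z) (hz : z ≤ 1) (hy : ∀ i < a, B.c ≤ (B.map α)^[i] y) {i : ℕ} (hi : i ≤ a) :
    (B.map α)^[i] y < (B.map α)^[i] z ∧ (B.map α)^[i] z ≤ 1 := by
  induction i with
  | zero => exact ⟨hyz, hz⟩
  | succ i ih =>
    obtain ⟨h1, h2⟩ := ih (by omega)
    rw [Function.iterate_succ_apply', Function.iterate_succ_apply']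
    have hm1 := iterate_mem hB hα (hyz.le.trans hz) hy (by omega : i < a)
    have hm2 : (B.map α)^[i] z ∈ Icc B.c 1 := ⟨hm1.1.trans h1.le, h2⟩
    exact ⟨map_strictMonoOn hB hα hv hm1 hm2 h1, (map_mem hB hα hm2).2⟩

/-- The expansion of a pair of nearby orbits, factored through intermediate slopes. -/
theorem exists_intermediate_points (hB : B.IsTame) (hα : 1 < α) (hv : 0 < B.v) {y z : ℝ} {a : ℕ}
    (hyz : y < z) (hz : z ≤ 1) (hy : ∀ i < a, B.c ≤ (B.map α)^[i] y) :
    ∃ ξ : ℕ → ℝ, (∀ i < a, ξ i ∈ Ioo ((B.map α)^[i] y) ((B.map α)^[i] z)) ∧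
      (B.map α)^[a] z - (B.map α)^[a] y
        = (z - y) * (B.slope α 1 ^ a * Real.exp (∑ i ∈ Finset.range a, B.logSlope α (ξ i))) := by
  have hex : ∀ i, ∃ ξ, i < a → ξ ∈ Ioo ((B.map α)^[i] y) ((B.map α)^[i] z) ∧
      (B.map α)^[i + 1] z - (B.map α)^[i + 1] y
        = B.slope α ξ * ((B.map α)^[i] z - (B.map α)^[i] y) := by
    intro i
    by_cases hi : i < a
    · obtain ⟨h1, h2⟩ := iterate_lt_iterate hB hα hv hyz hz hy hi.le
      obtain ⟨ξ, hξ, he⟩ := exists_map_slope_eq hB hα (hy i hi) h1 h2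
      refine ⟨ξ, fun _ => ⟨hξ, ?_⟩⟩
      rw [Function.iterate_succ_apply', Function.iterate_succ_apply', he]
    · exact ⟨0, fun h => absurd h hi⟩
  choose ξ hξ using hex
  refine ⟨ξ, fun i hi => (hξ i hi).1, ?_⟩
  have key : ∀ k ≤ a, (B.map α)^[k] z - (B.map α)^[k] y
      = (z - y) * (B.slope α 1 ^ k * Real.exp (∑ i ∈ Finset.range k, B.logSlope α (ξ i))) := by
    intro k
    induction k with
    | zero => simp
    | succ k ih =>
      intro hk
      have hka : k < a := by omega
      obtain ⟨h1, h2⟩ := hξ k hka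
      have h3 := (iterate_lt_iterate hB hα hv hyz hz hy hka.le).2
      rw [h2, ih (by omega), slope_eq_exp hB hα ⟨(hy k hka).trans_lt h1.1, h1.2.le.trans h3⟩,
        Finset.sum_range_succ, Real.exp_add, pow_succ]
      ring
  exact key a le_rfl

/-- The expansion along long orbits near a full branch is a power of the slope at the fixed point
times a factor which converges to a constant depending only on the limit branch. -/
theorem exists_expansion_factor (hB : B.IsTame) (hα : 1 < α) (hv : B.v = 1)
    (hfix : ∀ x ∈ Ioo B.c 1, B.map α x ≠ x) (hlam : 1 < B.slope α 1) :
    ∃ Λ > 0, ∀ (𝓑 : ℕ → Branch) (a : ℕ → ℕ) (y z : ℕ → ℝ), TendsTo atTop 𝓑 B →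
      (∀ n, (𝓑 n).IsTame) → (∀ n, 0 < (𝓑 n).v) →
      (∀ n, ∀ x ∈ Icc (𝓑 n).c 1, (𝓑 n).map α x ≤ x) → Tendsto a atTop atTop →
      (∀ n, y n < z n) → (∀ n, z n ≤ 1) →
      (∀ n, ∀ i < a n, (𝓑 n).c ≤ ((𝓑 n).map α)^[i] (y n)) →
      Tendsto (fun n => ((𝓑 n).map α)^[a n] (y n)) atTop (𝓝 B.c) →
      Tendsto (fun n => ((𝓑 n).map α)^[a n] (z n)) atTop (𝓝 B.c) →
      (∃ P : ℕ → ℝ, Tendsto P atTop (𝓝 Λ) ∧ ∀ n,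
        ((𝓑 n).map α)^[a n] (z n) - ((𝓑 n).map α)^[a n] (y n)
          = (z n - y n) * ((𝓑 n).slope α 1 ^ a n * P n)) ∧
      ∃ C q : ℝ, 0 < C ∧ 0 < q ∧ q < 1 ∧ ∀ᶠ n in atTop, 1 - z n ≤ C * q ^ a n := by
  obtain ⟨o, ho, ho0, hos, hot⟩ := exists_backward_orbit hB hα hv hfix
  -- The limit factor is the product, over the backward orbit of the critical point, of the slopes
  -- divided by the slope at the fixed point. It depends on the limit branch alone.
  refine ⟨Real.exp (∑' j, B.logSlope α (o j)), Real.exp_pos _, ?_⟩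
  intro 𝓑 a y z h h𝓑 hvn hbelow ha hyz hz hy hyend hzend
  have hlt := fun n i (hi : i ≤ a n) =>
    iterate_lt_iterate (h𝓑 n) hα (hvn n) (hyz n) (hz n) (hy n) hi
  have hym : ∀ n, ∀ i < a n, ((𝓑 n).map α)^[i] (y n) ∈ Icc (𝓑 n).c 1 := fun n i hi =>
    iterate_mem (h𝓑 n) hα ((hyz n).le.trans (hz n)) (hy n) hi
  have hzm : ∀ n, ∀ i < a n, ((𝓑 n).map α)^[i] (z n) ∈ Icc (𝓑 n).c 1 := fun n i hi =>
    ⟨(hy n i hi).trans (hlt n i hi.le).1.le, (hlt n i hi.le).2⟩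
  have hyb := h.tendsto_backward hB h𝓑 hα hv ho ho0 hos ha hym hyend
  have hzb := h.tendsto_backward hB h𝓑 hα hv ho ho0 hos ha hzm hzend
  obtain ⟨C, q, hC, hq0, hq1, hbd⟩ :=
    h.exists_exponential_bound hB h𝓑 hα hlam hbelow hot hym hyb
  constructor
  · choose ξ hξ hξe using fun n => exists_intermediate_points (h𝓑 n) hα (hvn n) (hyz n) (hz n) (hy n)
    refine ⟨fun n => Real.exp (∑ i ∈ Finset.range (a n), (𝓑 n).logSlope α (ξ n i)), ?_, hξe⟩
    refine (Real.continuous_exp.tendsto _).comp ?_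
    -- Counted from the end of the orbit and padded by zeros, the sums have termwise limits and a
    -- geometric majorant, so dominated convergence for series applies.
    set T : ℕ → ℕ → ℝ := fun n j =>
      if j < a n then (𝓑 n).logSlope α (ξ n (a n - 1 - j)) else 0 with hT
    have hsum : ∀ n, ∑' j, T n j = ∑ i ∈ Finset.range (a n), (𝓑 n).logSlope α (ξ n i) := by
      intro n
      rw [tsum_eq_sum (s := Finset.range (a n)), ← Finset.sum_range_reflect]
      · refine Finset.sum_congr rfl fun j hj => ?_
        have hj' := Finset.mem_range.1 hj
        simp only [hT]
        rw [if_pos (by omega), show a n - 1 - (a n - 1 - j) = j by omega]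
      · intro j hj
        simp only [hT]
        rw [if_neg (by simpa using hj)]
    simp only [← hsum]
    have hξt : ∀ j, Tendsto (fun n => ξ n (a n - 1 - j)) atTop (𝓝 (o j)) := by
      intro j
      refine tendsto_of_tendsto_of_tendsto_of_le_of_le' (hyb j) (hzb j) ?_ ?_
      · filter_upwards [ha.eventually_ge_atTop 1] with n hn
        exact (hξ n _ (by omega)).1.le
      · filter_upwards [ha.eventually_ge_atTop 1] with n hn
        exact (hξ n _ (by omega)).2.le
    have hξm : ∀ n, ∀ i < a n, ξ n i ∈ Icc (𝓑 n).c 1 := fun n i hi =>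
      ⟨(hy n i hi).trans (hξ n i hi).1.le, (hξ n i hi).2.le.trans (hlt n i hi.le).2⟩
    have hc1 := hB.c_lt_one
    -- All the intermediate points lie to the right of the last orbit point in `[c, 1]`, which
    -- converges to `o 0`. Half the coordinate of `o 0` thus bounds theirs from below and keeps the
    -- logarithms under control.
    set s := B.coord (o 0) / 2 with hs
    have hco : 0 < B.coord (o 0) := div_pos (by linarith [(ho 0).1]) (by linarith)
    have hs0 : 0 < s := half_pos hco
    refine tendsto_tsum_of_dominated_convergence
      (bound := fun j => (2 * α + (α - 1) / s) * (C * (2 / (1 - B.c))) * q ^ j) ?_ ?_ ?_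
    · exact (summable_geometric_of_lt_one hq0.le hq1).mul_left _
    · intro j
      have h1 : Tendsto (fun n => (𝓑 n).logSlope α (ξ n (a n - 1 - j))) atTop
          (𝓝 (B.logSlope α (o j))) := by
        refine h.logSlope hB h𝓑 hα (hξt j) (ho j).1 ?_
        filter_upwards [ha.eventually_ge_atTop 1] with n hn
        exact hξm n _ (by omega)
      refine h1.congr' ?_
      filter_upwards [ha.eventually_gt_atTop j] with n hn
      simp only [hT, hn, if_true]
    · have hcoord : ∀ᶠ n in atTop, s ≤ (𝓑 n).coord (((𝓑 n).map α)^[a n - 1 - 0] (y n)) :=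
        ((h.coord hB (hyb 0)).eventually (lt_mem_nhds (half_lt_self hco))).mono fun _ hn => hn.le
      have hcn : ∀ᶠ n in atTop, (1 - B.c) / 2 < 1 - (𝓑 n).c :=
        (tendsto_const_nhds.sub h.c).eventually (lt_mem_nhds (by linarith))
      filter_upwards [hbd, hcoord, hcn] with n h1 h2 h3 j
      by_cases hj : j < a n
      swap
      · simp only [hT, hj, if_false, norm_zero]
        have : 0 < α - 1 := by linarith
        have : 0 < 1 - B.c := by linarith
        positivity
      simp only [hT, hj, if_true]
      have hmono : ∀ k, k < a n → ((𝓑 n).map α)^[a n - 1 - 0] (y n) ≤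
          ((𝓑 n).map α)^[a n - 1 - k] (y n) := by
        intro k
        induction k with
        | zero => intro _; exact le_rfl
        | succ k ih =>
          intro hk
          refine (ih (by omega)).trans ?_
          have h4 : a n - 1 - k = (a n - 1 - (k + 1)) + 1 := by omega
          rw [h4, Function.iterate_succ_apply']
          exact hbelow n _ (hym n _ (by omega))
      have hji : a n - 1 - j < a n := by omega
      have h4 : ((𝓑 n).map α)^[a n - 1 - j] (y n) < ξ n (a n - 1 - j) := (hξ n _ hji).1
      have h5 : s ≤ (𝓑 n).coord (ξ n (a n - 1 - j)) :=
        h2.trans (coord_lt (h𝓑 n) ((hmono j hj).trans_lt h4)).le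
      rw [Real.norm_eq_abs]
      refine (abs_logSlope_le (h𝓑 n) hα (hξm n _ hji) hs0 h5).trans ?_
      rw [mul_assoc]
      refine mul_le_mul_of_nonneg_left ?_ (by
        have : 0 < α - 1 := by linarith
        positivity)
      have h6 := h1 j hj
      have h7 : 0 < 1 - (𝓑 n).c := by linarith
      rw [div_le_iff₀ h7]
      have h8 : C * q ^ j ≤ C * (2 / (1 - B.c)) * q ^ j * (1 - (𝓑 n).c) := by
        have h9 : 1 ≤ 2 / (1 - B.c) * (1 - (𝓑 n).c) := by
          rw [div_mul_eq_mul_div, le_div_iff₀ (by linarith)]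
          linarith
        have h10 : 0 ≤ C * q ^ j := by positivity
        calc C * q ^ j ≤ C * q ^ j * (2 / (1 - B.c) * (1 - (𝓑 n).c)) := le_mul_of_one_le_right h10 h9
          _ = _ := by ring
      linarith
  -- The starting point is the case `j = a n - 1` of the geometric bound; `C / q` restores the
  -- exponent `a n`.
  · refine ⟨C / q, q, div_pos hC hq0, hq0, hq1, ?_⟩
    filter_upwards [hbd, ha.eventually_ge_atTop 1] with n h1 h2
    have h3 := h1 (a n - 1) (by omega)
    rw [Nat.sub_self, Function.iterate_zero, id_eq] at h3
    have h4 : C / q * q ^ a n = C * q ^ (a n - 1) := by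
      obtain ⟨k, hk⟩ := Nat.exists_eq_add_of_le' h2
      rw [hk, pow_succ, Nat.add_sub_cancel]
      field_simp
    rw [h4]
    linarith [hyz n]

end Branch

/-! ### Pairs of branches linked by a return interval -/

namespace Branch

variable {α : ℝ} {B B' : Branch}

/-- The branches `B` and (after reflection) `B'` fit together to a Lorenz map with a return interval
`[1 - x', x]`: the part of the interval on the side of `B'` follows `B` for `a` steps and is then
mapped onto the return interval. -/
structure IsLinked (α : ℝ) (B B' : Branch) (x x' : ℝ) (a : ℕ) : Prop where
  c_add : B.c + B'.c = 1
  c_lt : B.c < x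
  le_one : x ≤ 1
  c_lt' : B'.c < x'
  le_one' : x' ≤ 1
  orbit : ∀ i < a, x < (B.map α)^[i] (1 - B'.map α x')
  left_end : (B.map α)^[a] (1 - B'.map α x') = 1 - x'
  right_end : (B.map α)^[a] (1 - B'.map α B'.c) = x

namespace IsLinked

variable {x x' : ℝ} {a : ℕ}

theorem map_le (h : IsLinked α B B' x x' a) (hB' : B'.IsTame) (hα : 1 < α) :
    1 - B'.map α x' ≤ 1 - B'.map α B'.c ∧ 1 - B'.map α B'.c ≤ 1 := by
  have hc : B'.c ∈ Icc B'.c 1 := ⟨le_rfl, hB'.c_lt_one.le⟩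
  have h1 := map_monotoneOn hB' hα hc ⟨h.c_lt'.le, h.le_one'⟩ h.c_lt'.le
  have h2 := (map_mem hB' hα hc).1
  exact ⟨by linarith, by linarith⟩

/-- Equal images would end at the same point after `a` steps, whereas `1 - x' < B.c < x`. -/
theorem map_lt (h : IsLinked α B B' x x' a) (hB' : B'.IsTame) (hα : 1 < α) :
    1 - B'.map α x' < 1 - B'.map α B'.c := by
  refine lt_of_le_of_ne (h.map_le hB' hα).1 fun heq => ?_
  have h1 := h.left_end
  rw [heq, h.right_end] at h1
  linarith [h.c_lt, h.c_lt', h.c_add]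

theorem orbit_mem (h : IsLinked α B B' x x' a) (hB : B.IsTame) (hB' : B'.IsTame) (hα : 1 < α)
    {i : ℕ} (hi : i < a) : (B.map α)^[i] (1 - B'.map α x') ∈ Icc B.c 1 := by
  have := h.map_le hB' hα
  exact iterate_mem hB hα (this.1.trans this.2) (fun i hi => (h.c_lt.trans (h.orbit i hi)).le) hi

/-- For a linked branch, the critical value lies above that of a trivial branch. -/
theorem map_c_lt (h : IsLinked α B B' x x' a) (hB' : B'.IsTame) (hα : 1 < α) (ha : 0 < a) :
    B'.map α B'.c < B'.c := by
  have h1 := h.orbit 0 ha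
  have h2 := (h.map_le hB' hα).1
  simp only [Function.iterate_zero, id_eq] at h1
  linarith [h.c_lt, h.c_add]

/-- Comparison of the two critical values when both branches are nearly trivial. -/
theorem sub_map_c_lt (h : IsLinked α B B' x x' a) (hB : B.IsTame) (hB' : B'.IsTame) (hα : 1 < α)
    (ha : 1 < a) : B.c - B.map α B.c < 2 * ((B'.c - B'.map α B'.c) / (1 - B.c)) ^ α := by
  have h2 := h.map_le hB' hα
  have hy := h.orbit_mem hB hB' hα (by omega : 0 < a)
  simp only [Function.iterate_zero, id_eq] at hy
  -- Since `a > 1`, the second orbit point is still above `B.c`, and by monotonicity so is the image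
  -- of `z`. The branch must therefore climb above `B.c` between `B.c` and `z`, but it rises there
  -- by at most `2 * B.coord z ^ α`.
  have h1 := h.orbit 1 ha
  simp only [Function.iterate_one] at h1
  set z := 1 - B'.map α B'.c with hz
  have hzm : z ∈ Icc B.c 1 := ⟨hy.1.trans h2.1, h2.2⟩
  have h3 := map_monotoneOn hB hα hy hzm h2.1
  have hcm : B.c ∈ Icc B.c 1 := ⟨le_rfl, hB.c_lt_one.le⟩
  have h4 := φ_sub_le hB (core_mem hB hα hcm).1 (core_monotoneOn hB hα hcm hzm hzm.1)
    (core_mem hB hα hzm).2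
  have hcz : B.coord z = (B'.c - B'.map α B'.c) / (1 - B.c) := by
    rw [coord, hz]; congr 1; linarith [h.c_add]
  have h5 : B.core α z - B.core α B.c = B.v * B.coord z ^ α := by
    rw [core_c hα, core]; ring
  have h6 : B.v * B.coord z ^ α ≤ 1 * B.coord z ^ α :=
    mul_le_mul_of_nonneg_right hB.v_le_one (Real.rpow_nonneg (coord_mem hB hzm).1 _)
  rw [← hcz]
  have h7 : B.map α z - B.map α B.c ≤ 2 * (B.core α z - B.core α B.c) := h4
  linarith [h.c_lt]

end IsLinked

/-- As `α > 1`, the left side is superlinear in `t`. This turns the power estimate between the two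
critical gaps into a strict inequality between them. -/
theorem exists_two_mul_rpow_lt (hα : 1 < α) {m : ℝ} (hm : 0 < m) :
    ∃ τ > 0, ∀ t ∈ Ioo (0 : ℝ) τ, 2 * (t / m) ^ α < t := by
  have h1 : Tendsto (fun t : ℝ => 2 * (t / m) ^ (α - 1) / m) (𝓝 0) (𝓝 0) := by
    have h2 : Tendsto (fun t : ℝ => t / m) (𝓝 0) (𝓝 0) :=
      (by fun_prop : Continuous fun t : ℝ => t / m).tendsto' _ _ (by simp)
    have h3 := ((h2.rpow_const (p := α - 1) (Or.inr (by linarith))).const_mul 2).div_const m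
    rwa [Real.zero_rpow (by linarith), mul_zero, zero_div] at h3
  obtain ⟨τ, hτ, hb⟩ := Metric.eventually_nhds_iff_ball.1 (h1.eventually (gt_mem_nhds one_pos))
  refine ⟨τ, hτ, fun t ht => ?_⟩
  have h4 := hb t (by rw [mem_ball_zero_iff, Real.norm_of_nonneg ht.1.le]; exact ht.2)
  have h5 : (t / m) ^ α = (t / m) ^ (α - 1) * (t / m) := by
    rw [← Real.rpow_add_one (div_pos ht.1 hm).ne', sub_add_cancel]
  calc 2 * (t / m) ^ α = (2 * (t / m) ^ (α - 1) / m) * t := by rw [h5]; ring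
    _ < 1 * t := mul_lt_mul_of_pos_right h4 ht.1
    _ = t := one_mul t

namespace TendsTo

variable {ι : Type*} {L : Filter ι} {𝓑 𝓑' : ι → Branch} {x x' : ι → ℝ} {a b : ι → ℕ}

/-- The first images of the return interval converge to the fixed point. -/
theorem tendsto_one_of_isLinked [L.NeBot] (h : TendsTo L 𝓑 B) (hB : B.IsTame)
    (h𝓑 : ∀ i, (𝓑 i).IsTame) (h𝓑' : ∀ i, (𝓑' i).IsTame) (hα : 1 < α) (hc : B.map α B.c < B.c)
    (hfix : ∀ y ∈ Ioo B.c 1, B.map α y ≠ y) (ha : Tendsto a L atTop)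
    (hl : ∀ i, IsLinked α (𝓑 i) (𝓑' i) (x i) (x' i) (a i)) :
    Tendsto (fun i => 1 - (𝓑' i).map α (x' i)) L (𝓝 1) := by
  rw [tendsto_iff_ultrafilter]
  intro G hG
  obtain ⟨y, -, hy⟩ := G.exists_tendsto_of_eventually_mem (isCompact_Icc (a := (0 : ℝ)) (b := 1))
    (f := fun i => 1 - (𝓑' i).map α (x' i)) (Eventually.of_forall fun i => by
      have := map_mem (h𝓑' i) hα ⟨(hl i).c_lt'.le, (hl i).le_one'⟩
      exact ⟨by linarith [this.2], by linarith [this.1]⟩)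
  have := (h.mono hG).eq_one_of_forall_iterate hB h𝓑 hα hc hfix hy fun j => by
    filter_upwards [(ha.mono_left hG).eventually_gt_atTop j] with i hi
    exact (hl i).orbit_mem (h𝓑 i) (h𝓑' i) hα hi
  rwa [this] at hy

/-- The reflected critical value of `𝓑'` is squeezed between the first image of an end of the return
interval and `1`. That image tends to `1` because its orbit stays in the domain of `𝓑` longer than
any fixed time. -/
theorem map_c_eq_zero_of_isLinked [L.NeBot] (h : TendsTo L 𝓑 B) (h' : TendsTo L 𝓑' B')
    (hB : B.IsTame) (hB' : B'.IsTame)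
    (h𝓑 : ∀ i, (𝓑 i).IsTame) (h𝓑' : ∀ i, (𝓑' i).IsTame) (hα : 1 < α) (hc : B.map α B.c < B.c)
    (hfix : ∀ y ∈ Ioo B.c 1, B.map α y ≠ y) (ha : Tendsto a L atTop)
    (hl : ∀ i, IsLinked α (𝓑 i) (𝓑' i) (x i) (x' i) (a i)) : B'.map α B'.c = 0 := by
  have h1 := h.tendsto_one_of_isLinked hB h𝓑 h𝓑' hα hc hfix ha hl
  have h2 : Tendsto (fun i => 1 - (𝓑' i).map α (𝓑' i).c) L (𝓝 1) :=
    tendsto_of_tendsto_of_tendsto_of_le_of_le h1 tendsto_const_nhds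
      (fun i => ((hl i).map_le (h𝓑' i) hα).1) (fun i => ((hl i).map_le (h𝓑' i) hα).2)
  have h3 := h'.map hB' h𝓑' hα h'.c
    (Eventually.of_forall fun i => ⟨le_rfl, (h𝓑' i).c_lt_one.le⟩)
  have h4 := tendsto_nhds_unique h2 (tendsto_const_nhds.sub h3)
  linarith

/-- Two branches which are limits of linked branches with long orbits cannot both be trivial. -/
theorem not_both_trivial [L.NeBot] (h : TendsTo L 𝓑 B) (h' : TendsTo L 𝓑' B')
    (hB : B.IsTame) (hB' : B'.IsTame)
    (h𝓑 : ∀ i, (𝓑 i).IsTame) (h𝓑' : ∀ i, (𝓑' i).IsTame) (hα : 1 < α)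
    (hc : B.map α B.c = B.c) (hc' : B'.map α B'.c = B'.c) (ha : Tendsto a L atTop)
    (hb : Tendsto b L atTop) (hl : ∀ i, IsLinked α (𝓑 i) (𝓑' i) (x i) (x' i) (a i))
    (hl' : ∀ i, IsLinked α (𝓑' i) (𝓑 i) (x' i) (x i) (b i)) : False := by
  have key : ∀ {B : Branch} {𝓑 : ι → Branch}, TendsTo L 𝓑 B → B.IsTame → (∀ i, (𝓑 i).IsTame) →
      B.map α B.c = B.c → Tendsto (fun i => (𝓑 i).c - (𝓑 i).map α (𝓑 i).c) L (𝓝 0) := by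
    intro B 𝓑 h hB h𝓑 hc
    have h3 := h.c.sub (h.map hB h𝓑 hα h.c
      (Eventually.of_forall fun i => ⟨le_rfl, (h𝓑 i).c_lt_one.le⟩))
    rwa [hc, sub_self] at h3
  have hη := key h hB h𝓑 hc
  have hη' := key h' hB' h𝓑' hc'
  set m := min ((1 - B.c) / 2) ((1 - B'.c) / 2) with hm
  have hm0 : 0 < m := lt_min (by linarith [hB.c_lt_one]) (by linarith [hB'.c_lt_one])
  obtain ⟨τ, hτ, hτb⟩ := exists_two_mul_rpow_lt hα hm0
  have hcm : ∀ᶠ i in L, m < 1 - (𝓑 i).c := (tendsto_const_nhds.sub h.c).eventually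
    (lt_mem_nhds ((min_le_left _ _).trans_lt (by linarith [hB.c_lt_one])))
  have hcm' : ∀ᶠ i in L, m < 1 - (𝓑' i).c := (tendsto_const_nhds.sub h'.c).eventually
    (lt_mem_nhds ((min_le_right _ _).trans_lt (by linarith [hB'.c_lt_one])))
  obtain ⟨i, ⟨hi1, hi2⟩, hi3, hi4, hi5, hi6⟩ := (((ha.eventually_gt_atTop 1).and
    (hb.eventually_gt_atTop 1)).and (hcm.and (hcm'.and
    ((hη.eventually (gt_mem_nhds hτ)).and (hη'.eventually (gt_mem_nhds hτ)))))).exists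
  have hp' : 0 < (𝓑' i).c - (𝓑' i).map α (𝓑' i).c := by
    linarith [(hl i).map_c_lt (h𝓑' i) hα (by omega)]
  have hp : 0 < (𝓑 i).c - (𝓑 i).map α (𝓑 i).c := by
    linarith [(hl' i).map_c_lt (h𝓑 i) hα (by omega)]
  -- With `η`, `η'` the gaps between critical point and critical value, one comparison gives `η < 2
  -- (η' / m) ^ α < η'`, and the symmetric one gives `η' < η`.
  have h1 := (hl i).sub_map_c_lt (h𝓑 i) (h𝓑' i) hα hi1
  have h2 := (hl' i).sub_map_c_lt (h𝓑' i) (h𝓑 i) hα hi2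
  have h3 : ((𝓑' i).c - (𝓑' i).map α (𝓑' i).c) / (1 - (𝓑 i).c)
      ≤ ((𝓑' i).c - (𝓑' i).map α (𝓑' i).c) / m :=
    div_le_div_of_nonneg_left hp'.le hm0 hi3.le
  have h4 : ((𝓑 i).c - (𝓑 i).map α (𝓑 i).c) / (1 - (𝓑' i).c)
      ≤ ((𝓑 i).c - (𝓑 i).map α (𝓑 i).c) / m :=
    div_le_div_of_nonneg_left hp.le hm0 hi4.le
  have h5 := Real.rpow_le_rpow (div_nonneg hp'.le (by linarith)) h3 (by linarith : 0 ≤ α)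
  have h6 := Real.rpow_le_rpow (div_nonneg hp.le (by linarith)) h4 (by linarith : 0 ≤ α)
  have h7 := hτb _ ⟨hp, hi5⟩
  have h8 := hτb _ ⟨hp', hi6⟩
  linarith

/-- Limits of linked branches with long orbits are full. -/
theorem full_of_isLinked [L.NeBot] (h : TendsTo L 𝓑 B) (h' : TendsTo L 𝓑' B')
    (hB : B.IsTame) (hB' : B'.IsTame)
    (h𝓑 : ∀ i, (𝓑 i).IsTame) (h𝓑' : ∀ i, (𝓑' i).IsTame) (hα : 1 < α)
    (hc : B.map α B.c ≤ B.c) (hc' : B'.map α B'.c ≤ B'.c)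
    (hfix : ∀ y ∈ Ioo B.c 1, B.map α y ≠ y) (hfix' : ∀ y ∈ Ioo B'.c 1, B'.map α y ≠ y)
    (ha : Tendsto a L atTop)
    (hb : Tendsto b L atTop) (hl : ∀ i, IsLinked α (𝓑 i) (𝓑' i) (x i) (x' i) (a i))
    (hl' : ∀ i, IsLinked α (𝓑' i) (𝓑 i) (x' i) (x i) (b i)) :
    B.map α B.c = 0 ∧ B'.map α B'.c = 0 := by
  -- A nontrivial limit branch makes the other one full, hence nontrivial, and the argument then
  -- runs back. A trivial `B` beside a nontrivial `B'` is impossible: `B'` would force the critical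
  -- value of `B` to be `0`.
  rcases hc.lt_or_eq with h1 | h1
  · have h2 := h.map_c_eq_zero_of_isLinked h' hB hB' h𝓑 h𝓑' hα h1 hfix ha hl
    refine ⟨?_, h2⟩
    exact h'.map_c_eq_zero_of_isLinked h hB' hB h𝓑' h𝓑 hα (by rw [h2]; exact hB'.c_pos) hfix' hb hl'
  · rcases hc'.lt_or_eq with h2 | h2
    · have h3 := h'.map_c_eq_zero_of_isLinked h hB' hB h𝓑' h𝓑 hα h2 hfix' hb hl'
      linarith [hB.c_pos]
    · exact (h.not_both_trivial h' hB hB' h𝓑 h𝓑' hα h1 h2 ha hb hl hl').elim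

/-- Near a full map, the return intervals shrink to the critical point. -/
theorem tendsto_c_of_isLinked [L.NeBot] (h : TendsTo L 𝓑 B) (h' : TendsTo L 𝓑' B')
    (hB : B.IsTame) (hB' : B'.IsTame)
    (h𝓑 : ∀ i, (𝓑 i).IsTame) (h𝓑' : ∀ i, (𝓑' i).IsTame) (hα : 1 < α)
    (hv : B.v = 1) (hv' : B'.v = 1) (hfix : ∀ y ∈ Ioo B.c 1, B.map α y ≠ y)
    (ha : Tendsto a L atTop) (hl : ∀ i, IsLinked α (𝓑 i) (𝓑' i) (x i) (x' i) (a i)) :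
    Tendsto x' L (𝓝 B'.c) := by
  have hc : ∀ {B : Branch}, B.IsTame → B.v = 1 → B.map α B.c = 0 := by
    intro B hB hv
    rw [map_c hα, hv, sub_self, hB.map_zero]
  have h1 := h.tendsto_one_of_isLinked hB h𝓑 h𝓑' hα (by rw [hc hB hv]; exact hB.c_pos) hfix ha hl
  refine h'.of_map hB' h𝓑' hα (by rw [hv']; exact one_pos)
    (Eventually.of_forall fun i => ⟨(hl i).c_lt'.le, (hl i).le_one'⟩)
    ⟨le_rfl, hB'.c_lt_one.le⟩ ?_
  rw [hc hB' hv']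
  have h2 := h1.const_sub 1
  simpa using h2

/-- Behaviour of the branches at the critical point near a full branch. -/
theorem exists_cusp_factor (h : TendsTo L 𝓑 B) (hB : B.IsTame) (h𝓑 : ∀ i, (𝓑 i).IsTame)
    (hα : 1 < α) (hv : B.v = 1) (hvn : ∀ i, 0 < (𝓑 i).v) (hx : Tendsto x L (𝓝 B.c))
    (hxs : ∀ i, x i ∈ Ioc (𝓑 i).c 1) :
    ∃ Q : ι → ℝ, Tendsto Q L (𝓝 (B.ψ 0)) ∧
      ∀ i, (𝓑 i).map α (x i) - (𝓑 i).map α (𝓑 i).c = Q i * (𝓑 i).coord (x i) ^ α := by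
  have hcm : ∀ i, (𝓑 i).c ∈ Icc (𝓑 i).c 1 := fun i => ⟨le_rfl, (h𝓑 i).c_lt_one.le⟩
  have hxm : ∀ i, x i ∈ Icc (𝓑 i).c 1 := fun i => ⟨(hxs i).1.le, (hxs i).2⟩
  choose ξ hξ hξe using fun i => exists_slope_eq (h𝓑 i) (core_mem (h𝓑 i) hα (hcm i)).1
    (core_strictMonoOn (h𝓑 i) hα (hvn i) (hcm i) (hxm i) (hxs i).1)
    (core_mem (h𝓑 i) hα (hxm i)).2
  refine ⟨fun i => (𝓑 i).ψ (ξ i) * (𝓑 i).v, ?_, fun i => ?_⟩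
  · have h1 := h.core hB hα h.c
    have h2 := h.core hB hα hx
    have h3 : B.core α B.c = 0 := by rw [core_c hα, hv, sub_self]
    rw [h3] at h1 h2
    have h4 : Tendsto ξ L (𝓝 0) := tendsto_of_tendsto_of_tendsto_of_le_of_le h1 h2
      (fun i => (hξ i).1.le) (fun i => (hξ i).2.le)
    have h5 := tendsto_apply h.ψ (continuousOn_ψ hB) h4 (Eventually.of_forall fun i =>
      ⟨(core_mem (h𝓑 i) hα (hcm i)).1.trans (hξ i).1.le,
        (hξ i).2.le.trans (core_mem (h𝓑 i) hα (hxm i)).2⟩) (by norm_num)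
    simpa [hv] using h5.mul h.v
  · refine (hξe i).trans ?_
    rw [core_c hα, Branch.core]
    ring

end TendsTo

/-- Asymptotics of the length of the return interval of linked branches near a full map. -/
theorem exists_return_factor (hB : B.IsTame) (hB' : B'.IsTame) (hα : 1 < α) (hv : B.v = 1)
    (hv' : B'.v = 1) (hfix : ∀ y ∈ Ioo B.c 1, B.map α y ≠ y) (hlam : 1 < B.slope α 1) :
    ∃ A > 0, ∀ (𝓑 𝓑' : ℕ → Branch) (a : ℕ → ℕ) (x x' : ℕ → ℝ), TendsTo atTop 𝓑 B →
      TendsTo atTop 𝓑' B' → (∀ n, (𝓑 n).IsTame) → (∀ n, (𝓑' n).IsTame) →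
      (∀ n, 0 < (𝓑 n).v) → (∀ n, 0 < (𝓑' n).v) →
      (∀ n, ∀ x ∈ Icc (𝓑 n).c 1, (𝓑 n).map α x ≤ x) → Tendsto a atTop atTop →
      (∀ n, IsLinked α (𝓑 n) (𝓑' n) (x n) (x' n) (a n)) →
      Tendsto x atTop (𝓝 B.c) → Tendsto x' atTop (𝓝 B'.c) → B.c + B'.c = 1 →
      (∃ P : ℕ → ℝ, Tendsto P atTop (𝓝 A) ∧ ∀ n, x n + x' n - 1
          = P n * (𝓑' n).coord (x' n) ^ α * (𝓑 n).slope α 1 ^ a n) ∧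
      ∃ C q : ℝ, 0 < C ∧ 0 < q ∧ q < 1 ∧ ∀ᶠ n in atTop, 1 - (𝓑' n).v ≤ C * q ^ a n := by
  obtain ⟨Λ, hΛ, hmain⟩ := exists_expansion_factor hB hα hv hfix hlam
  have hψ0 : 0 < B'.ψ 0 := by linarith [hB'.half_le 0 (by norm_num)]
  -- The cusp of `B'` contributes `B'.ψ 0`, and the passage of `B` near its fixed point contributes
  -- `Λ`.
  refine ⟨B'.ψ 0 * Λ, mul_pos hψ0 hΛ, ?_⟩
  intro 𝓑 𝓑' a x x' h h' h𝓑 h𝓑' hvn hvn' hbelow ha hl hx hx' hcc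
  obtain ⟨⟨P, hP, hPe⟩, C, q, hC, hq0, hq1, hbd⟩ := hmain 𝓑 a
    (fun n => 1 - (𝓑' n).map α (x' n)) (fun n => 1 - (𝓑' n).map α (𝓑' n).c) h h𝓑 hvn hbelow ha
    (fun n => (hl n).map_lt (h𝓑' n) hα) (fun n => ((hl n).map_le (h𝓑' n) hα).2)
    (fun n i hi => ((hl n).orbit_mem (h𝓑 n) (h𝓑' n) hα hi).1)
    (by
      simp only [fun n => (hl n).left_end]
      have := hx'.const_sub 1
      rwa [show 1 - B'.c = B.c by linarith] at this)
    (by simpa only [fun n => (hl n).right_end] using hx)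
  constructor
  · obtain ⟨Q, hQ, hQe⟩ := h'.exists_cusp_factor hB' h𝓑' hα hv' hvn' hx'
      (fun n => ⟨(hl n).c_lt', (hl n).le_one'⟩)
    refine ⟨fun n => Q n * P n, hQ.mul hP, fun n => ?_⟩
    have h1 := hPe n
    rw [(hl n).left_end, (hl n).right_end] at h1
    have h2 : 1 - (𝓑' n).map α (𝓑' n).c - (1 - (𝓑' n).map α (x' n))
        = Q n * (𝓑' n).coord (x' n) ^ α := by rw [← hQe n]; ring
    rw [h2] at h1
    linear_combination h1
  -- The distance from the first image of the critical point to `1` is `φ (1 - v)`, which is at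
  -- least `(1 - v) / 2`.
  · refine ⟨2 * C, q, by positivity, hq0, hq1, ?_⟩
    filter_upwards [hbd] with n hn
    have h1 := half_mul_le_φ_sub (h𝓑' n) le_rfl (by linarith [(h𝓑' n).v_le_one] : 0 ≤ 1 - (𝓑' n).v)
      (by linarith [(h𝓑' n).v_nonneg])
    rw [(h𝓑' n).map_zero, ← map_c hα] at h1
    linarith

end Branch

/-! ### Lorenz maps as pairs of branches -/

theorem IsDiffeoPart.hasDerivWithinAt {φ : ℝ → ℝ} (h : IsDiffeoPart φ) {x : ℝ}
    (hx : x ∈ Icc (0 : ℝ) 1) : HasDerivWithinAt φ (iD 1 φ x) (Icc 0 1) x := by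
  rw [iD, iteratedDerivWithin_one]
  exact ((h.contDiff.differentiableOn (by norm_num)) x hx).hasDerivWithinAt

theorem IsDiffeoPart.abs_iD_one_sub_le {φ : ℝ → ℝ} (h : IsDiffeoPart φ)
    (hφ : ∀ x ∈ Icc (0 : ℝ) 1, |iD 2 φ x| ≤ 1) {x y : ℝ}
    (hx : x ∈ Icc (0 : ℝ) 1) (hy : y ∈ Icc (0 : ℝ) 1) : |iD 1 φ x - iD 1 φ y| ≤ |x - y| := by
  have hd : ∀ z ∈ Icc (0 : ℝ) 1, HasDerivWithinAt (iD 1 φ) (iD 2 φ z) (Icc 0 1) z := by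
    intro z hz
    have h1 : DifferentiableOn ℝ (iteratedDerivWithin 1 φ (Icc 0 1)) (Icc (0 : ℝ) 1) :=
      h.contDiff.differentiableOn_iteratedDerivWithin (by norm_num) (uniqueDiffOn_Icc zero_lt_one)
    have h2 := (h1 z hz).hasDerivWithinAt
    rw [← iteratedDerivWithin_succ] at h2
    exact h2
  have := (convex_Icc (0 : ℝ) 1).norm_image_sub_le_of_norm_hasDerivWithin_le hd
    (C := 1) (fun z hz => hφ z hz) hy hx
  simpa using this

namespace LorenzMap

variable {α : ℝ}

/-- The right branch. -/
noncomputable def rightBranch (f : LorenzMap α) : Branch := ⟨f.c, f.v, f.φp, iD 1 f.φp⟩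

/-- The left branch, reflected by `x ↦ 1 - x`. -/
noncomputable def leftBranch (f : LorenzMap α) : Branch :=
  ⟨1 - f.c, f.u, fun y => 1 - f.φm (1 - y), fun y => iD 1 f.φm (1 - y)⟩

theorem rightBranch_map (f : LorenzMap α) : f.rightBranch.map α = f.right := rfl

/-- Conjugation by `x ↦ 1 - x` moves the left branch at its fixed point `0` to a right branch at
`1`, so that each estimate is proved for one side only. -/
theorem leftBranch_map (f : LorenzMap α) (x : ℝ) : f.leftBranch.map α (1 - x) = 1 - f.left x := by
  simp only [Branch.map, Branch.core, Branch.coord, leftBranch, left]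
  have h1 : (1 - x - (1 - f.c)) / (1 - (1 - f.c)) = (f.c - x) / f.c := by
    congr 1 <;> ring
  rw [h1]
  congr 2
  ring

theorem leftBranch_map' (f : LorenzMap α) (x : ℝ) : f.leftBranch.map α x = 1 - f.left (1 - x) := by
  rw [← leftBranch_map, sub_sub_cancel]

variable {f : LorenzMap α} {δ : ℝ}

theorem CloseToStandard.rightBranch (hf : f.CloseToStandard δ) (hδ : δ ≤ 1 / 2) :
    f.rightBranch.IsTame where
  c_pos := f.c_mem.1
  c_lt_one := f.c_mem.2
  v_nonneg := f.v_mem.1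
  v_le_one := f.v_mem.2
  map_zero := f.φp_diffeo.map_zero
  map_one := f.φp_diffeo.map_one
  hasDeriv := fun _ hx => f.φp_diffeo.hasDerivWithinAt hx
  half_le := fun x hx => by
    have := (abs_le.1 (hf f.φp (by simp) x hx).2.1).1
    show 1 / 2 ≤ iD 1 f.φp x
    linarith
  le_two := fun x hx => by
    have := (abs_le.1 (hf f.φp (by simp) x hx).2.1).2
    show iD 1 f.φp x ≤ 2
    linarith
  lipschitz := fun x hx y hy => f.φp_diffeo.abs_iD_one_sub_le
    (fun z hz => (hf f.φp (by simp) z hz).2.2.trans (by linarith)) hx hy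

theorem CloseToStandard.leftBranch (hf : f.CloseToStandard δ) (hδ : δ ≤ 1 / 2) :
    f.leftBranch.IsTame where
  c_pos := by show 0 < 1 - f.c; linarith [f.c_mem.2]
  c_lt_one := by show 1 - f.c < 1; linarith [f.c_mem.1]
  v_nonneg := f.u_mem.1
  v_le_one := f.u_mem.2
  map_zero := by show 1 - f.φm (1 - 0) = 0; rw [sub_zero, f.φm_diffeo.map_one, sub_self]
  map_one := by show 1 - f.φm (1 - 1) = 1; rw [sub_self, f.φm_diffeo.map_zero, sub_zero]
  hasDeriv := fun x hx => by
    have hx' : 1 - x ∈ Icc (0 : ℝ) 1 := ⟨by linarith [hx.2], by linarith [hx.1]⟩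
    have h1 : HasDerivWithinAt (fun y : ℝ => 1 - y) (-1) (Icc 0 1) x := by
      simpa using ((hasDerivAt_id x).const_sub 1).hasDerivWithinAt
    have h2 := ((f.φm_diffeo.hasDerivWithinAt hx').comp x h1
      (fun y hy => ⟨by linarith [hy.2], by linarith [hy.1]⟩)).const_sub 1
    refine h2.congr_deriv ?_
    simp [LorenzMap.leftBranch]
  half_le := fun x hx => by
    have hx' : 1 - x ∈ Icc (0 : ℝ) 1 := ⟨by linarith [hx.2], by linarith [hx.1]⟩
    have := (abs_le.1 (hf f.φm (by simp) _ hx').2.1).1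
    show 1 / 2 ≤ iD 1 f.φm (1 - x)
    linarith
  le_two := fun x hx => by
    have hx' : 1 - x ∈ Icc (0 : ℝ) 1 := ⟨by linarith [hx.2], by linarith [hx.1]⟩
    have := (abs_le.1 (hf f.φm (by simp) _ hx').2.1).2
    show iD 1 f.φm (1 - x) ≤ 2
    linarith
  lipschitz := fun x hx y hy => by
    have := f.φm_diffeo.abs_iD_one_sub_le
      (fun z hz => (hf f.φm (by simp) z hz).2.2.trans (by linarith))
      (x := 1 - x) (y := 1 - y) ⟨by linarith [hx.2], by linarith [hx.1]⟩
      ⟨by linarith [hy.2], by linarith [hy.1]⟩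
    rw [show 1 - x - (1 - y) = y - x by ring, abs_sub_comm y x] at this
    exact this

theorem OnlyFixesEndpoints.rightBranch (hf : f.OnlyFixesEndpoints) :
    ∀ x ∈ Ioo f.rightBranch.c 1, f.rightBranch.map α x ≠ x := by
  intro x hx heq
  have hx' : f.c < x := hx.1
  have h0 := f.c_mem.1
  have h1 : f.toFun x = x := by
    rw [toFun, if_neg (not_lt.2 hx'.le), ← rightBranch_map, heq]
  rcases hf x ⟨by linarith, hx.2.le⟩ hx'.ne' h1 with h | h
  · linarith
  · exact hx.2.ne h

theorem OnlyFixesEndpoints.leftBranch (hf : f.OnlyFixesEndpoints) :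
    ∀ x ∈ Ioo f.leftBranch.c 1, f.leftBranch.map α x ≠ x := by
  intro x hx heq
  have hx' : 1 - f.c < x := hx.1
  have hx1 := hx.2
  have h0 := f.c_mem.2
  rw [leftBranch_map'] at heq
  have h1 : f.toFun (1 - x) = 1 - x := by
    rw [toFun, if_pos (by linarith)]
    linarith
  rcases hf (1 - x) ⟨by linarith, by linarith⟩ (by intro h; linarith) h1 with h | h <;> linarith

theorem isFull_iff : f.IsFull ↔
    f.rightBranch.map α f.rightBranch.c = 0 ∧ f.leftBranch.map α f.leftBranch.c = 0 := by
  have h1 : f.leftBranch.map α f.leftBranch.c = 1 - f.left f.c := leftBranch_map f f.c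
  have h2 : f.rightBranch.map α f.rightBranch.c = f.right f.c := rfl
  rw [h1, h2, IsFull, sub_eq_zero, and_comm, eq_comm (a := (1 : ℝ))]

theorem map_c_le (hf : f.Nontrivial ∨ f.HasTrivialBranch) :
    f.rightBranch.map α f.rightBranch.c ≤ f.rightBranch.c ∧
      f.leftBranch.map α f.leftBranch.c ≤ f.leftBranch.c := by
  have h1 : f.leftBranch.map α f.leftBranch.c = 1 - f.left f.c := leftBranch_map f f.c
  have h2 : f.rightBranch.map α f.rightBranch.c = f.right f.c := rfl
  rw [h1, h2]
  have h3 : f.leftBranch.c = 1 - f.c := rfl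
  have h4 : f.rightBranch.c = f.c := rfl
  rw [h3, h4]
  rcases hf with h | h
  · exact ⟨h.1.le, by linarith [h.2]⟩
  · exact ⟨h.1, by linarith [h.2.1]⟩

theorem continuousOn_left (f : LorenzMap α) (hα : 1 < α) :
    ContinuousOn f.left (Icc 0 f.c) := by
  have hc := f.c_mem.1
  refine f.φm_diffeo.contDiff.continuousOn.comp ?_ ?_
  · refine Continuous.continuousOn ?_
    refine continuous_const.mul (continuous_const.sub (Continuous.rpow_const (by fun_prop) ?_))
    exact fun _ => Or.inr (by linarith)
  · intro x hx
    have h0 : 0 ≤ (f.c - x) / f.c := div_nonneg (by linarith [hx.2]) hc.le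
    have h1 : (f.c - x) / f.c ≤ 1 := by rw [div_le_one hc]; linarith [hx.1]
    have h2 := Real.rpow_nonneg h0 α
    have h3 := Real.rpow_le_one h0 h1 (by linarith : 0 ≤ α)
    have hu := f.u_mem
    exact ⟨mul_nonneg hu.1 (by linarith), by nlinarith [hu.1, hu.2]⟩

theorem continuousOn_right (f : LorenzMap α) (hα : 1 < α) :
    ContinuousOn f.right (Icc f.c 1) := by
  have hc := f.c_mem.2
  refine f.φp_diffeo.contDiff.continuousOn.comp ?_ ?_
  · refine Continuous.continuousOn ?_
    refine continuous_const.add (continuous_const.mul (continuous_const.add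
      (Continuous.rpow_const (by fun_prop) ?_)))
    exact fun _ => Or.inr (by linarith)
  · intro x hx
    have h0 : 0 ≤ (x - f.c) / (1 - f.c) := div_nonneg (by linarith [hx.1]) (by linarith)
    have h1 : (x - f.c) / (1 - f.c) ≤ 1 := by rw [div_le_one (by linarith)]; linarith [hx.2]
    have h2 := Real.rpow_nonneg h0 α
    have h3 := Real.rpow_le_one h0 h1 (by linarith : 0 ≤ α)
    have hv := f.v_mem
    exact ⟨by nlinarith [hv.1, hv.2], by nlinarith [hv.1, hv.2]⟩

theorem left_zero (f : LorenzMap α) : f.left 0 = 0 := by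
  rw [left, sub_zero, div_self f.c_mem.1.ne', Real.one_rpow, sub_self, mul_zero,
    f.φm_diffeo.map_zero]

theorem right_one (f : LorenzMap α) : f.right 1 = 1 := by
  rw [right, div_self (by linarith [f.c_mem.2]), Real.one_rpow, neg_add_cancel, mul_zero, add_zero,
    f.φp_diffeo.map_one]

theorem derivWithin_toFun_one (hf : f.rightBranch.IsTame) (hα : 1 < α) :
    derivWithin f.toFun (Icc 0 1) 1 = f.rightBranch.slope α 1 := by
  have hc := f.c_mem
  have h1 := Branch.hasDerivWithinAt_map hf hα (x := 1) ⟨hf.c_lt_one.le, le_rfl⟩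
  have h2 : HasDerivWithinAt f.toFun (f.rightBranch.slope α 1) (Icc f.c 1) 1 := by
    refine h1.congr (fun x hx => ?_) ?_
    · have hx' : f.c ≤ x := hx.1
      rw [toFun, if_neg (not_lt.2 hx'), rightBranch_map]
    · rw [toFun, if_neg (not_lt.2 hc.2.le), rightBranch_map]
  have h3 : HasDerivWithinAt f.toFun (f.rightBranch.slope α 1) (Icc 0 1) 1 := by
    refine h2.mono_of_mem_nhdsWithin ?_
    have : Ici f.c ∈ 𝓝 (1 : ℝ) := Ici_mem_nhds hc.2
    filter_upwards [mem_nhdsWithin_of_mem_nhds this, self_mem_nhdsWithin] with x h4 h5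
    exact ⟨h4, h5.2⟩
  exact h3.derivWithin (uniqueDiffOn_Icc zero_lt_one 1 (by norm_num))

theorem derivWithin_toFun_zero (hf : f.leftBranch.IsTame) (hα : 1 < α) :
    derivWithin f.toFun (Icc 0 1) 0 = f.leftBranch.slope α 1 := by
  have hc := f.c_mem
  have h1 := Branch.hasDerivWithinAt_map hf hα (x := 1 - 0)
    ⟨by rw [sub_zero]; exact hf.c_lt_one.le, by norm_num⟩
  have h0 : HasDerivWithinAt (fun y : ℝ => 1 - y) (-1) (Ico 0 f.c) 0 := by
    simpa using ((hasDerivAt_id (0 : ℝ)).const_sub 1).hasDerivWithinAt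
  have h2 := (h1.comp (0 : ℝ) h0 (fun x hx => by
    have h3 : f.leftBranch.c = 1 - f.c := rfl
    exact ⟨by rw [h3]; linarith [hx.2], by linarith [hx.1]⟩)).const_sub 1
  have h3 : HasDerivWithinAt f.toFun (f.leftBranch.slope α 1) (Ico 0 f.c) 0 := by
    refine (h2.congr (fun x hx => ?_) ?_).congr_deriv (by simp)
    · rw [toFun, if_pos hx.2, Function.comp, leftBranch_map, sub_sub_cancel]
    · rw [toFun, if_pos hc.1, Function.comp, leftBranch_map, sub_sub_cancel]
  have h4 : HasDerivWithinAt f.toFun (f.leftBranch.slope α 1) (Icc 0 1) 0 := by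
    refine h3.mono_of_mem_nhdsWithin ?_
    have : Iio f.c ∈ 𝓝 (0 : ℝ) := Iio_mem_nhds hc.1
    filter_upwards [mem_nhdsWithin_of_mem_nhds this, self_mem_nhdsWithin] with x h4 h5
    exact ⟨h5.1, h4⟩
  exact h4.derivWithin (uniqueDiffOn_Icc zero_lt_one 0 (by norm_num))

end LorenzMap

/-! ### From full renormalizations to linked branches -/

/-- The first return is known only off the critical point, where the map is not defined. The
identity for the critical value follows by letting `w` decrease to `B'.c` and using continuity of
the extended branches. -/
theorem Branch.isLinked_of_tendsto {α : ℝ} (hα : 1 < α) {B B' : Branch} (hB : B.IsTame)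
    (hB' : B'.IsTame) {x x' : ℝ} {a : ℕ} {G : ℝ → ℝ} (hc : B.c + B'.c = 1) (hx : B.c < x)
    (hx1 : x ≤ 1) (hx' : B'.c < x') (hx1' : x' ≤ 1)
    (horb : ∀ w ∈ Ioc B'.c x', ∀ i < a, x < (B.map α)^[i] (1 - B'.map α w))
    (hG : ∀ w ∈ Ioc B'.c x', (B.map α)^[a] (1 - B'.map α w) = G w) (hG1 : G x' = 1 - x')
    (hGt : Tendsto G (𝓝[Ioc B'.c x'] B'.c) (𝓝 x)) : B.IsLinked α B' x x' a := by
  refine ⟨hc, hx, hx1, hx', hx1', horb x' ⟨hx', le_rfl⟩, by rw [hG x' ⟨hx', le_rfl⟩, hG1], ?_⟩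
  have hne : (𝓝[Ioc B'.c x'] B'.c).NeBot := by
    rw [nhdsWithin_Ioc_eq_nhdsGT hx']; infer_instance
  have hIcc : Ioc B'.c x' ⊆ Icc B'.c 1 := fun w hw => ⟨hw.1.le, hw.2.trans hx1'⟩
  have hX : Tendsto (fun w => 1 - B'.map α w) (𝓝[Ioc B'.c x'] B'.c) (𝓝 (1 - B'.map α B'.c)) :=
    (((continuousOn_map hB' hα) B'.c ⟨le_rfl, hB'.c_lt_one.le⟩).mono hIcc).tendsto.const_sub 1
  have h1 := (TendsTo.const (L := 𝓝[Ioc B'.c x'] B'.c) (B := B)).iterate hB (fun _ => hB) hα hX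
    (k := a) (fun j hj => by
      filter_upwards [self_mem_nhdsWithin] with w hw
      exact iterate_mem hB hα (by linarith [(map_mem hB' hα (hIcc hw)).1])
        (fun i hi => (hx.trans (horb w hw i hi)).le) hj)
  refine tendsto_nhds_unique (h1.congr' ?_) hGt
  filter_upwards [self_mem_nhdsWithin] with w hw
  exact hG w hw

namespace LorenzMap

variable {α : ℝ} {f g : LorenzMap α}

theorem iterate_toFun_left {x : ℝ} {a : ℕ} (hx : x < f.c)
    (h : ∀ i, 1 ≤ i → i ≤ a → f.c < f.toFun^[i] x) {i : ℕ} (hi : i ≤ a) :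
    f.toFun^[i + 1] x = f.right^[i] (f.left x) := by
  induction i with
  | zero => simp [toFun, hx]
  | succ i ih =>
    rw [Function.iterate_succ_apply', Function.iterate_succ_apply' (f := f.right),
      ← ih (by omega), toFun, if_neg (not_lt.2 (h (i + 1) (by omega) hi).le)]

theorem iterate_toFun_right {x : ℝ} {b : ℕ} (hx : f.c < x)
    (h : ∀ i, 1 ≤ i → i ≤ b → f.toFun^[i] x < f.c) {i : ℕ} (hi : i ≤ b) :
    f.toFun^[i + 1] x = f.left^[i] (f.right x) := by
  induction i with
  | zero => simp [toFun, not_lt.2 hx.le]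
  | succ i ih =>
    rw [Function.iterate_succ_apply', Function.iterate_succ_apply' (f := f.left),
      ← ih (by omega), toFun, if_pos (h (i + 1) (by omega) hi)]

theorem iterate_leftBranch_map (f : LorenzMap α) (i : ℕ) (x : ℝ) :
    (f.leftBranch.map α)^[i] (1 - x) = 1 - f.left^[i] x := by
  have h : Function.Semiconj (fun x => 1 - x) f.left (f.leftBranch.map α) :=
    fun x => (leftBranch_map f x).symm
  exact (h.iterate_right i x).symm

/-- A first return time is unique, so the one provided by the monotone type agrees with the one
defining the return map. -/
theorem IsReturnMap.iterate_eq {l r x : ℝ} {n : ℕ} (h : f.IsReturnMap l r g) (hx : x ∈ Icc l r)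
    (hxc : x ≠ f.c) (hn : 0 < n) (hret : f.toFun^[n] x ∈ Icc l r)
    (hno : ∀ i, 1 ≤ i → i < n → f.toFun^[i] x ∉ Icc l r) :
    f.toFun^[n] x = l + (r - l) * g.toFun ((x - l) / (r - l)) := by
  obtain ⟨m, hm0, hm1, hm2, hm3⟩ := h.firstReturn x hx hxc
  have hmn : m = n := by
    rcases lt_trichotomy m n with h1 | h1 | h1
    · exact absurd hm1 (hno m hm0 h1)
    · exact h1
    · exact absurd hret (hm2 n hn h1)
  subst hmn
  have hlr : r - l ≠ 0 := by linarith [h.l_lt, h.lt_r]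
  rw [← hm3]
  field_simp
  ring

/-- A renormalizable map with full renormalization consists of linked branches. -/
theorem RenormalizesTo.isLinked {a b : ℕ} (h : f.RenormalizesTo a b g) (hg : g.IsFull)
    (hα : 1 < α) (hR : f.rightBranch.IsTame) (hL : f.leftBranch.IsTame) :
    ∃ l r : ℝ, l < f.c ∧ f.c < r ∧ g.c = (f.c - l) / (r - l) ∧
      f.rightBranch.IsLinked α f.leftBranch r (1 - l) a ∧
      f.leftBranch.IsLinked α f.rightBranch (1 - l) r b := by
  obtain ⟨l, r, ⟨hret, -⟩, -, -, hl, hr⟩ := h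
  have hlc := hret.l_lt
  have hcr := hret.lt_r
  have hlr : 0 < r - l := by linarith
  have hgc := hret.crit
  refine ⟨l, r, hlc, hcr, hgc, ?_, ?_⟩
  · have hBc : f.leftBranch.c = 1 - f.c := rfl
    have hmem : ∀ w ∈ Ioc f.leftBranch.c (1 - l), 1 - w ∈ Ico l f.c := fun w hw =>
      ⟨by linarith [hw.2], by have := hw.1; rw [hBc] at this; linarith⟩
    have hmap : ∀ w, 1 - f.leftBranch.map α w = f.left (1 - w) := fun w => by
      rw [leftBranch_map', sub_sub_cancel]
    have hcomp : ∀ w ∈ Ioc f.leftBranch.c (1 - l), ∀ i ≤ a,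
        f.right^[i] (1 - f.leftBranch.map α w) = f.toFun^[i + 1] (1 - w) := by
      intro w hw i hi
      rw [hmap, iterate_toFun_left (hmem w hw).2
        (fun j hj1 hj2 => ((hl _ (hmem w hw)).2 j hj1 hj2).2) hi]
    refine Branch.isLinked_of_tendsto hα hR hL
      (G := fun w => l + (r - l) * g.left ((1 - w - l) / (r - l))) ?_ hcr hret.r_le_one ?_ ?_
      ?_ ?_ ?_ ?_
    · rw [hBc]; exact add_sub_cancel f.c 1
    · rw [hBc]; linarith
    · linarith [hret.l_nonneg]
    · intro w hw i hi
      rw [rightBranch_map, hcomp w hw i hi.le]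
      obtain ⟨h1, h2⟩ := (hl _ (hmem w hw)).2 (i + 1) (by omega) (by omega)
      by_contra! h3
      exact h1 ⟨by linarith, h3⟩
    · intro w hw
      have hw' := hmem w hw
      rw [rightBranch_map, hcomp w hw a le_rfl, hret.iterate_eq ⟨hw'.1, by linarith [hw'.2]⟩
        hw'.2.ne (by omega) (hl _ hw').1 (fun i h1 h2 => ((hl _ hw').2 i h1 (by omega)).1), toFun,
        if_pos]
      rw [hgc]
      exact div_lt_div_of_pos_right (by linarith [hw'.2]) hlr
    -- The end `l` returns to itself because the renormalization fixes `0`.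
    · rw [sub_sub_cancel, sub_self, zero_div, left_zero]; ring
    · have hgm : ∀ w ∈ Ioc f.leftBranch.c (1 - l), (1 - w - l) / (r - l) ∈ Icc 0 g.c := by
        intro w hw
        have hw' := hmem w hw
        refine ⟨div_nonneg (by linarith [hw'.1]) hlr.le, ?_⟩
        rw [hgc]
        exact div_le_div_of_nonneg_right (by linarith [hw'.2]) hlr.le
      have h1 : Tendsto (fun w => (1 - w - l) / (r - l))
          (𝓝[Ioc f.leftBranch.c (1 - l)] f.leftBranch.c) (𝓝[Icc 0 g.c] g.c) := by
        refine tendsto_nhdsWithin_iff.2 ⟨?_, ?_⟩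
        · have : Tendsto (fun w => (1 - w - l) / (r - l)) (𝓝 f.leftBranch.c) (𝓝 g.c) :=
            (by fun_prop : Continuous fun w => (1 - w - l) / (r - l)).tendsto' _ _
              (by rw [hBc, hgc, sub_sub_cancel])
          exact this.mono_left nhdsWithin_le_nhds
        · filter_upwards [self_mem_nhdsWithin] with w hw
          exact hgm w hw
      have h2 := ((continuousOn_left g hα g.c ⟨g.c_mem.1.le, le_rfl⟩).tendsto.comp h1)
      -- Fullness enters here: the left critical value of `g` is `1`, so points near `c` on the left
      -- return near `r`.
      rw [hg.1] at h2
      have h3 := (h2.const_mul (r - l)).const_add l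
      rw [mul_one, add_sub_cancel] at h3
      exact h3
  · have hBc : f.leftBranch.c = 1 - f.c := rfl
    have hcomp : ∀ w ∈ Ioc f.c r, ∀ i ≤ b,
        (f.leftBranch.map α)^[i] (1 - f.rightBranch.map α w) = 1 - f.toFun^[i + 1] w := by
      intro w hw i hi
      rw [rightBranch_map, iterate_leftBranch_map, iterate_toFun_right hw.1
        (fun j hj1 hj2 => ((hr _ hw).2 j hj1 hj2).2) hi]
    refine Branch.isLinked_of_tendsto hα hL hR
      (G := fun w => 1 - (l + (r - l) * g.right ((w - l) / (r - l)))) ?_ ?_ ?_ hcr hret.r_le_one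
      ?_ ?_ ?_ ?_
    · rw [hBc]; exact sub_add_cancel 1 f.c
    · rw [hBc]; linarith
    · linarith [hret.l_nonneg]
    · intro w hw i hi
      rw [hcomp w hw i hi.le]
      obtain ⟨h1, h2⟩ := (hr _ hw).2 (i + 1) (by omega) (by omega)
      by_contra! h3
      exact h1 ⟨by linarith, by linarith⟩
    · intro w hw
      have hw' : w ∈ Ioc f.c r := hw
      rw [hcomp w hw b le_rfl, hret.iterate_eq ⟨by linarith [hw'.1], hw'.2⟩
        hw'.1.ne' (by omega) (hr _ hw).1 (fun i h1 h2 => ((hr _ hw).2 i h1 (by omega)).1), toFun,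
        if_neg]
      rw [hgc, not_lt]
      exact div_le_div_of_nonneg_right (by linarith [hw'.1]) hlr.le
    · rw [div_self hlr.ne', right_one]; ring
    · have hgm : ∀ w ∈ Ioc f.c r, (w - l) / (r - l) ∈ Icc g.c 1 := by
        intro w hw
        refine ⟨?_, (div_le_one hlr).2 (by linarith [hw.2])⟩
        rw [hgc]
        exact div_le_div_of_nonneg_right (by linarith [hw.1]) hlr.le
      have h1 : Tendsto (fun w => (w - l) / (r - l)) (𝓝[Ioc f.c r] f.c) (𝓝[Icc g.c 1] g.c) := by
        refine tendsto_nhdsWithin_iff.2 ⟨?_, ?_⟩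
        · have : Tendsto (fun w => (w - l) / (r - l)) (𝓝 f.c) (𝓝 g.c) :=
            (by fun_prop : Continuous fun w => (w - l) / (r - l)).tendsto' _ _ (by rw [hgc])
          exact this.mono_left nhdsWithin_le_nhds
        · filter_upwards [self_mem_nhdsWithin] with w hw
          exact hgm w hw
      have h2 := ((continuousOn_right g hα g.c ⟨le_rfl, g.c_mem.2.le⟩).tendsto.comp h1)
      rw [hg.2] at h2
      have h3 := ((h2.const_mul (r - l)).const_add l).const_sub 1
      rw [mul_zero, add_zero] at h3
      exact h3

end LorenzMap

/-! ### Continuity and analyticity in the parameter -/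

section Family

variable {α : ℝ} {U : Set (ℝ × ℝ)} {F : ℝ × ℝ → LorenzMap α} {ι : Type*} {L : Filter ι}
  {t : ι → ℝ × ℝ} {t₀ : ℝ × ℝ}

theorem AnalyticParam.tendsto {E : Type*} [NormedAddCommGroup E] [NormedSpace ℝ E]
    {h : ℝ × ℝ → E} (hh : AnalyticParam U h) (ht : Tendsto t L (𝓝 t₀)) (htU : ∀ i, t i ∈ U)
    (ht₀ : t₀ ∈ U) : Tendsto (fun i => h (t i)) L (𝓝 (h t₀)) := by
  obtain ⟨H, hH, he⟩ := hh
  rw [← he ht₀]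
  refine ((hH t₀ ht₀).continuousAt.tendsto.comp ht).congr fun i => he (htU i)

theorem AnalyticDiffeoParam.eventually_lt {φ : ℝ × ℝ → ℝ → ℝ} (hφ : AnalyticDiffeoParam U φ)
    {k : ℕ} (hk : k ≤ 3) (ht : Tendsto t L (𝓝 t₀)) (htU : ∀ i, t i ∈ U) (ht₀ : t₀ ∈ U) {ε : ℝ}
    (hε : 0 < ε) :
    ∀ᶠ i in L, ∀ x ∈ Icc (0 : ℝ) 1, |iD k (φ (t i)) x - iD k (φ t₀) x| < ε := by
  obtain ⟨J, hJ, he⟩ := hφ k hk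
  have h1 := (hJ t₀ ht₀).continuousAt.tendsto.comp ht
  filter_upwards [(Metric.tendsto_nhds.1 h1) ε hε] with i hi x hx
  rw [← he _ (htU i) ⟨x, hx⟩, ← he _ ht₀ ⟨x, hx⟩, ← Real.dist_eq]
  exact (ContinuousMap.dist_apply_le_dist _).trans_lt hi

theorem AnalyticDiffeoParam.analyticParam_iD {φ : ℝ × ℝ → ℝ → ℝ} (hφ : AnalyticDiffeoParam U φ)
    {k : ℕ} (hk : k ≤ 3) {x : ℝ} (hx : x ∈ Icc (0 : ℝ) 1) :
    AnalyticParam U fun t => iD k (φ t) x := by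
  obtain ⟨J, hJ, he⟩ := hφ k hk
  refine ⟨fun t => J t ⟨x, hx⟩, fun t ht => ?_, fun t ht => he t ht ⟨x, hx⟩⟩
  exact ((ContinuousMap.evalCLM ℝ (⟨x, hx⟩ : Icc (0 : ℝ) 1)).analyticAt _).comp (hJ t ht)

theorem IsAnalyticFamily.rightBranch_tendsTo (hF : IsAnalyticFamily U F)
    (ht : Tendsto t L (𝓝 t₀)) (htU : ∀ i, t i ∈ U) (ht₀ : t₀ ∈ U) :
    Branch.TendsTo L (fun i => (F (t i)).rightBranch) (F t₀).rightBranch where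
  c := hF.c.tendsto ht htU ht₀
  v := hF.v.tendsto ht htU ht₀
  φ := fun ε hε => by
    simpa [iD, LorenzMap.rightBranch] using
      hF.φp.eventually_lt (k := 0) (by norm_num) ht htU ht₀ hε
  ψ := fun ε hε => hF.φp.eventually_lt (by norm_num) ht htU ht₀ hε

theorem IsAnalyticFamily.leftBranch_tendsTo (hF : IsAnalyticFamily U F)
    (ht : Tendsto t L (𝓝 t₀)) (htU : ∀ i, t i ∈ U) (ht₀ : t₀ ∈ U) :
    Branch.TendsTo L (fun i => (F (t i)).leftBranch) (F t₀).leftBranch where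
  c := (hF.c.tendsto ht htU ht₀).const_sub 1
  v := hF.u.tendsto ht htU ht₀
  φ := fun ε hε => by
    filter_upwards [hF.φm.eventually_lt (k := 0) (by norm_num) ht htU ht₀ hε] with i hi x hx
    have := hi (1 - x) ⟨by linarith [hx.2], by linarith [hx.1]⟩
    simp only [iD, iteratedDerivWithin_zero] at this
    show |1 - (F (t i)).φm (1 - x) - (1 - (F t₀).φm (1 - x))| < ε
    rw [abs_sub_comm]
    convert this using 2
    ring
  ψ := fun ε hε => by
    filter_upwards [hF.φm.eventually_lt (k := 1) (by norm_num) ht htU ht₀ hε] with i hi x hx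
    exact hi (1 - x) ⟨by linarith [hx.2], by linarith [hx.1]⟩

theorem AnalyticParam.mul {g h : ℝ × ℝ → ℝ} (hg : AnalyticParam U g) (hh : AnalyticParam U h) :
    AnalyticParam U fun t => g t * h t := by
  obtain ⟨G, hG, heG⟩ := hg
  obtain ⟨H, hH, heH⟩ := hh
  exact ⟨fun t => G t * H t, fun t ht => (hG t ht).mul (hH t ht),
    fun t ht => by simp only [heG ht, heH ht]⟩

theorem AnalyticParam.const_div {h : ℝ × ℝ → ℝ} (hh : AnalyticParam U h) (h0 : ∀ t ∈ U, h t ≠ 0)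
    (k : ℝ) : AnalyticParam U fun t => k / h t := by
  obtain ⟨H, hH, heH⟩ := hh
  exact ⟨fun t => k / H t, fun t ht => analyticAt_const.div (hH t ht) (by rw [heH ht]; exact h0 t ht),
    fun t ht => by simp only [heH ht]⟩

theorem AnalyticParam.const_sub {h : ℝ × ℝ → ℝ} (hh : AnalyticParam U h) (k : ℝ) :
    AnalyticParam U fun t => k - h t := by
  obtain ⟨H, hH, heH⟩ := hh
  exact ⟨fun t => k - H t, fun t ht => analyticAt_const.sub (hH t ht),
    fun t ht => by simp only [heH ht]⟩

theorem AnalyticParam.isBigO_sub {h : ℝ × ℝ → ℝ} (hh : AnalyticParam U h)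
    (ht : Tendsto t L (𝓝 t₀)) (htU : ∀ i, t i ∈ U) (ht₀ : t₀ ∈ U) :
    (fun i => h (t i) - h t₀) =O[L] fun i => ‖t i - t₀‖ := by
  obtain ⟨H, hH, heH⟩ := hh
  have h1 := ((hH t₀ ht₀).differentiableAt.isBigO_sub.comp_tendsto ht).norm_right
  refine h1.congr (fun i => ?_) fun i => rfl
  simp only [Function.comp, heH (htU i), heH ht₀]

/-- By `slope_one` the multiplier is `φ'(1) * v * α / (1 - c)`. Its analyticity is used only for the
bound `O(‖t - t₀‖)` on its variation. -/
theorem IsAnalyticFamily.rightSlope (hF : IsAnalyticFamily U F)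
    (htame : ∀ t ∈ U, (F t).rightBranch.IsTame) :
    AnalyticParam U fun t => (F t).rightBranch.slope α 1 := by
  have h1 : AnalyticParam U fun t => iD 1 (F t).φp 1 * ((F t).v * (α / (1 - (F t).c))) :=
    (hF.φp.analyticParam_iD (by norm_num) (by norm_num)).mul (hF.v.mul
      ((hF.c.const_sub 1).const_div (fun t _ => by linarith [(F t).c_mem.2]) α))
  obtain ⟨H, hH, heH⟩ := h1
  exact ⟨H, hH, fun t ht => by rw [heH ht]; exact (Branch.slope_one (htame t ht)).symm⟩

theorem IsAnalyticFamily.leftSlope (hF : IsAnalyticFamily U F)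
    (htame : ∀ t ∈ U, (F t).leftBranch.IsTame) :
    AnalyticParam U fun t => (F t).leftBranch.slope α 1 := by
  have h1 : AnalyticParam U fun t => iD 1 (F t).φm (1 - 1) *
      ((F t).u * (α / (1 - (1 - (F t).c)))) :=
    (hF.φm.analyticParam_iD (by norm_num) (by norm_num)).mul (hF.u.mul
      (((hF.c.const_sub 1).const_sub 1).const_div (fun t _ => by linarith [(F t).c_mem.1]) α))
  obtain ⟨H, hH, heH⟩ := h1
  exact ⟨H, hH, fun t ht => by rw [heH ht]; exact (Branch.slope_one (htame t ht)).symm⟩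

end Family

/-! ### Exponential closeness to the full map -/

/-- Powers of sequences converging to a nonzero limit faster than the exponents grow. -/
theorem tendsto_div_pow_one {s d : ℕ → ℝ} {s₀ : ℝ} (hs₀ : 0 < s₀) {k : ℕ → ℕ}
    (hs : Tendsto s atTop (𝓝 s₀)) (hO : (fun n => s n - s₀) =O[atTop] d)
    (hk : Tendsto (fun n => (k n : ℝ) * d n) atTop (𝓝 0)) :
    Tendsto (fun n => (s n / s₀) ^ k n) atTop (𝓝 1) := by
  have h1 : Tendsto (fun n => s n / s₀) atTop (𝓝 1) := by
    have := hs.div_const s₀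
    rwa [div_self hs₀.ne'] at this
  have h2 : (fun n => Real.log (s n / s₀)) =O[atTop] d := by
    have h3 : (fun x => Real.log x - Real.log 1) =O[𝓝 1] fun x : ℝ => x - 1 :=
      (Real.differentiableAt_log one_ne_zero).isBigO_sub
    have h4 := h3.comp_tendsto h1
    simp only [Real.log_one, sub_zero] at h4
    refine h4.trans ?_
    refine (hO.const_mul_left (s₀⁻¹)).congr_left fun n => ?_
    simp only [Function.comp]
    field_simp
  have h3 : Tendsto (fun n => (k n : ℝ) * Real.log (s n / s₀)) atTop (𝓝 0) :=
    ((isBigO_refl (fun n => (k n : ℝ)) atTop).mul h2).trans_tendsto hk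
  have h4 := (Real.continuous_exp.tendsto 0).comp h3
  rw [Real.exp_zero] at h4
  refine h4.congr' ?_
  filter_upwards [h1.eventually (lt_mem_nhds one_pos)] with n hn
  rw [Function.comp, mul_comm, Real.exp_mul, Real.exp_log hn, Real.rpow_natCast]

theorem tendsto_zero_of_pow {x : ℕ → ℝ} {m : ℕ} (hm : m ≠ 0) (hx : ∀ n, 0 ≤ x n)
    (h : Tendsto (fun n => x n ^ m) atTop (𝓝 0)) : Tendsto x atTop (𝓝 0) := by
  have hm0 : (0 : ℝ) < (m : ℝ)⁻¹ := by positivity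
  have h1 := h.rpow_const (p := (m : ℝ)⁻¹) (Or.inr hm0.le)
  rw [Real.zero_rpow hm0.ne'] at h1
  exact h1.congr fun n => Real.pow_rpow_inv_natCast (hx n) hm

/-- A sequence some power of which is exponentially small in `a` and `b` is `o(1 / (a + b))`, if `a`
and `b` are comparable. -/
theorem tendsto_mul_of_exponential {x : ℕ → ℝ} {m : ℕ} (hx : ∀ n, 0 ≤ x n)
    (hx0 : Tendsto x atTop (𝓝 0)) {a b : ℕ → ℕ} {K C C' q q' : ℝ} (hK : 0 < K) (hC : 0 < C)
    (hC' : 0 < C') (hq : 0 < q) (hq1 : q < 1) (hq' : 0 < q') (hq1' : q' < 1)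
    (ha : Tendsto a atTop atTop) (hab : ∀ n, (a n : ℝ) ≤ K * b n) (hba : ∀ n, (b n : ℝ) ≤ K * a n)
    (hbd : ∀ᶠ n in atTop, x n ^ m ≤ C * q ^ a n + C' * q' ^ b n) :
    Tendsto (fun n => ((a n + b n : ℕ) : ℝ) * x n) atTop (𝓝 0) := by
  set Q := max q q' with hQ
  have hQ0 : 0 < Q := lt_max_of_lt_left hq
  have hQ1 : Q < 1 := max_lt hq1 hq1'
  -- Comparability gives `a + b ≤ (1 + K) * a` and `a + b ≤ (1 + K) * b`, so `Q ^ a` and `Q ^ b` are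
  -- both at most `ρ ^ (a + b)`.
  set ρ := Q ^ (1 / (1 + K)) with hρ
  have hρ0 : 0 < ρ := Real.rpow_pos_of_pos hQ0 _
  have hρ1 : ρ < 1 := Real.rpow_lt_one hQ0.le hQ1 (by positivity)
  have key : ∀ (N k : ℕ), (N : ℝ) ≤ (1 + K) * k → Q ^ k ≤ ρ ^ N := by
    intro N k hNk
    rw [hρ, ← Real.rpow_natCast, ← Real.rpow_natCast, ← Real.rpow_mul hQ0.le]
    refine Real.rpow_le_rpow_of_exponent_ge hQ0 hQ1.le ?_
    rw [one_div, inv_mul_le_iff₀ (by positivity)]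
    exact hNk
  have hN : Tendsto (fun n => a n + b n) atTop atTop :=
    tendsto_atTop_mono (fun n => Nat.le_add_right _ _) ha
  -- The exponent `m + 1` covers `m = 0` as well; `x ^ (m + 1) ≤ x ^ m` once `x < 1`.
  refine tendsto_zero_of_pow (m := m + 1) (by omega) (fun n => mul_nonneg (by positivity) (hx n)) ?_
  have h1 : Tendsto (fun n => (C + C') * ((((a n + b n : ℕ) : ℝ)) ^ (m + 1) * ρ ^ (a n + b n)))
      atTop (𝓝 0) := by
    have := ((tendsto_pow_const_mul_const_pow_of_abs_lt_one (m + 1)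
      (by rw [abs_of_pos hρ0]; exact hρ1)).comp hN).const_mul (C + C')
    rwa [mul_zero] at this
  refine squeeze_zero' (Eventually.of_forall fun n =>
    pow_nonneg (mul_nonneg (by positivity) (hx n)) _) ?_ h1
  filter_upwards [hbd, hx0.eventually (gt_mem_nhds one_pos)] with n h2 h3
  have h4 : x n ^ (m + 1) ≤ (C + C') * ρ ^ (a n + b n) := by
    have h5 : q ^ a n ≤ ρ ^ (a n + b n) :=
      (pow_le_pow_left₀ hq.le (le_max_left _ _) _).trans (key _ _ (by
        push_cast; linarith [hba n]))
    have h6 : q' ^ b n ≤ ρ ^ (a n + b n) :=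
      (pow_le_pow_left₀ hq'.le (le_max_right _ _) _).trans (key _ _ (by
        push_cast; linarith [hab n]))
    have h7 : x n ^ (m + 1) ≤ x n ^ m := pow_le_pow_of_le_one (hx n) h3.le (by omega)
    nlinarith
  rw [mul_pow]
  have h5 : 0 ≤ ((a n + b n : ℕ) : ℝ) ^ (m + 1) := by positivity
  nlinarith

namespace Branch

variable {α : ℝ} {B : Branch}

theorem v_eq_one_of_map_c (hB : B.IsTame) (hα : 1 < α) (h : B.map α B.c = 0) : B.v = 1 := by
  rw [map_c hα, ← hB.map_zero] at h
  have := (φ_strictMonoOn hB).injOn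
    ⟨by linarith [hB.v_le_one], by linarith [hB.v_nonneg]⟩ (by norm_num) h
  linarith

theorem v_pos_of_map_c_lt (hB : B.IsTame) (hα : 1 < α) (h : B.map α B.c < B.c) : 0 < B.v := by
  refine lt_of_le_of_ne hB.v_nonneg fun h0 => ?_
  rw [map_c hα, ← h0, sub_zero, hB.map_one] at h
  linarith [hB.c_lt_one]

/-- The bound on `δ` gives `ψ 1 ≥ 1 - δ ≥ (α + 1) / (2 * α)`, so the slope `ψ 1 * α / (1 - c)` is at
least `(α + 1) / 2 > 1`. -/
theorem one_lt_slope_one (hB : B.IsTame) (hα : 1 < α) (hv : B.v = 1) {δ : ℝ}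
    (hδ : δ ≤ (α - 1) / (2 * α)) (hψ : |B.ψ 1 - 1| ≤ δ) : 1 < B.slope α 1 := by
  rw [slope_one hB, hv, one_mul]
  have h1 : (α + 1) / (2 * α) ≤ B.ψ 1 := by
    have h2 := (abs_le.1 hψ).1
    have h3 : (α + 1) / (2 * α) = 1 - (α - 1) / (2 * α) := by field_simp; ring
    linarith
  have hc := hB.c_pos
  have hc1 := hB.c_lt_one
  have h4 : α ≤ α / (1 - B.c) := by
    rw [le_div_iff₀ (by linarith)]; nlinarith
  calc (1 : ℝ) < (α + 1) / (2 * α) * α := by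
        rw [div_mul_eq_mul_div, lt_div_iff₀ (by linarith)]; nlinarith
    _ ≤ B.ψ 1 * (α / (1 - B.c)) :=
        mul_le_mul h1 h4 (by linarith) (le_trans (by positivity) h1)

end Branch

/-- The Łojasiewicz inequality is applied to `(1 - u) ^ 2 + (1 - v) ^ 2`, whose zeros are the
solutions of `u = v = 1`; the squares are dropped since `u` and `v` lie in `[0, 1]` on `U`. -/
theorem IsAnalyticallyUniqueFull.exists_norm_pow_le {α : ℝ} {U : Set (ℝ × ℝ)}
    {F : ℝ × ℝ → LorenzMap α} {p : ℝ × ℝ} (h : IsAnalyticallyUniqueFull U F p) :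
    ∃ m : ℕ, ∀ᶠ t in 𝓝 p, t ∈ U → ‖t - p‖ ^ m ≤ (1 - (F t).u) + (1 - (F t).v) := by
  obtain ⟨S, u, v, hUS, hS, hu, hv, huv, hiso⟩ := h
  obtain ⟨m, hm⟩ := hS.lojasiewicz (h := fun z => (1 - u z) ^ 2 + (1 - v z) ^ 2)
    (((analyticAt_const.sub hu).pow 2).add ((analyticAt_const.sub hv).pow 2)) (by
      filter_upwards [hiso] with z hz hzS h0
      have h1 : 1 - u z = 0 := by nlinarith [sq_nonneg (1 - u z), sq_nonneg (1 - v z)]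
      have h2 : 1 - v z = 0 := by nlinarith [sq_nonneg (1 - u z), sq_nonneg (1 - v z)]
      exact hz hzS (by linarith) (by linarith))
  refine ⟨m, ?_⟩
  filter_upwards [hm] with t ht htU
  refine (ht (hUS htU)).trans ?_
  rw [abs_of_nonneg (by positivity), (huv t htU).1, (huv t htU).2]
  have h1 := (F t).u_mem
  have h2 := (F t).v_mem
  nlinarith [h1.1, h1.2, h2.1, h2.2]

/-- Parameters of renormalizable maps with long return times and full renormalization converge to
the parameter of the full map. -/
theorem tendsto_full_parameter {α δ : ℝ} (hα : 1 < α) {U : Set (ℝ × ℝ)} {F : ℝ × ℝ → LorenzMap α}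
    {p : ℝ × ℝ} (hF : IsLorenzFamily U F) (hA : IsAnalyticFamily U F)
    (hδ : δ ≤ 1 / 2) (hcl : ∀ t ∈ U, (F t).CloseToStandard δ) (hp : IsUniqueFull U F p)
    {t : ℕ → ℝ × ℝ} (htU : ∀ n, t n ∈ U) {l r : ℕ → ℝ} {a b : ℕ → ℕ} (ha : Tendsto a atTop atTop)
    (hb : Tendsto b atTop atTop)
    (hl : ∀ n, (F (t n)).rightBranch.IsLinked α (F (t n)).leftBranch (r n) (l n) (a n))
    (hl' : ∀ n, (F (t n)).leftBranch.IsLinked α (F (t n)).rightBranch (l n) (r n) (b n)) :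
    Tendsto t atTop (𝓝 p) := by
  -- By compactness it is enough to treat cluster points; each is a full map by `full_of_isLinked`,
  -- hence equals `p` by uniqueness.
  refine hF.compact.tendsto_nhds_of_unique_mapClusterPt (Eventually.of_forall htU) ?_
  intro s hs hcp
  obtain ⟨G, hG, hGt⟩ := mapClusterPt_iff_ultrafilter.1 hcp
  have hle := LorenzMap.map_c_le ((hF.nontrivial s hs).imp_right fun h => h.2)
  have h1 := (hA.rightBranch_tendsTo hGt htU hs).full_of_isLinked
    (hA.leftBranch_tendsTo hGt htU hs) ((hcl s hs).rightBranch hδ) ((hcl s hs).leftBranch hδ)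
    (fun n => (hcl _ (htU n)).rightBranch hδ) (fun n => (hcl _ (htU n)).leftBranch hδ) hα
    hle.1 hle.2 (hF.fixes s hs).rightBranch (hF.fixes s hs).leftBranch (ha.mono_left hG)
    (hb.mono_left hG) hl hl'
  exact hp.2.2 s hs (LorenzMap.isFull_iff.2 h1)

/-! ### The limit of the ratio -/

/-- Algebraic form of the ratio of the two parts of the return interval. -/
theorem ratio_eq {α : ℝ} (hα : 1 < α) {c c₀ s s' P P' A A' κ κ₀ lam lam₀ : ℝ} {a b : ℕ}
    (hc : c ∈ Ioo (0 : ℝ) 1) (hc₀ : c₀ ∈ Ioo (0 : ℝ) 1) (hs : 0 < s) (hs' : 0 < s') (hP : 0 < P)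
    (hP' : 0 < P') (hA : 0 < A) (hA' : 0 < A') (hκ : 0 < κ) (hκ₀ : 0 < κ₀) (hlam : 0 < lam)
    (hlam₀ : 0 < lam₀) (h : P * s' ^ α * lam ^ a = P' * s ^ α * κ ^ b) :
    (c * s') / ((1 - c) * s) *
        (c₀ / (1 - c₀) * (A' / A * (κ₀ ^ b / lam₀ ^ a)) ^ (1 / α))⁻¹
      = (c / (1 - c)) / (c₀ / (1 - c₀)) *
        ((P' / P) / (A' / A) * ((κ / κ₀) ^ b / (lam / lam₀) ^ a)) ^ (1 / α) := by
  have hc1 : 0 < 1 - c := by linarith [hc.2]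
  have hc2 : 0 < 1 - c₀ := by linarith [hc₀.2]
  have hcp := hc.1
  have hcp₀ := hc₀.1
  have h1 : s' / s = (P' * κ ^ b / (P * lam ^ a)) ^ (1 / α) := by
    have h2 : (s' / s) ^ α = P' * κ ^ b / (P * lam ^ a) := by
      rw [Real.div_rpow hs'.le hs.le, div_eq_div_iff (Real.rpow_pos_of_pos hs α).ne' (by positivity)]
      linarith
    rw [← h2, ← Real.rpow_mul (by positivity), mul_one_div_cancel (by linarith), Real.rpow_one]
  have h3 : (P' / P) / (A' / A) * ((κ / κ₀) ^ b / (lam / lam₀) ^ a)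
      = (P' * κ ^ b / (P * lam ^ a)) / (A' / A * (κ₀ ^ b / lam₀ ^ a)) := by
    rw [div_pow, div_pow]
    field_simp
  rw [h3, Real.div_rpow (by positivity) (by positivity), ← h1]
  have h4 : 0 < (A' / A * (κ₀ ^ b / lam₀ ^ a)) ^ (1 / α) := Real.rpow_pos_of_pos (by positivity) _
  field_simp

/-- This is the sequential form of the theorem. The constant is fixed before the sequences and `K`
are given, since it depends only on the two branches of `F p`. -/
theorem exists_ratio_limit {α δ : ℝ} (hα : 1 < α) (hδ : δ ≤ (α - 1) / (2 * α))
    {U : Set (ℝ × ℝ)} {F : ℝ × ℝ → LorenzMap α}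
    {p : ℝ × ℝ} (hF : IsLorenzFamily U F) (hA : IsAnalyticFamily U F)
    (hcl : ∀ t ∈ U, (F t).CloseToStandard δ) (hp : IsUniqueFull U F p)
    (hpa : IsAnalyticallyUniqueFull U F p) :
    ∃ γ > 0, ∀ K > 0, ∀ (a b : ℕ → ℕ) (t : ℕ → ℝ × ℝ) (g : ℕ → LorenzMap α),
      Tendsto a atTop atTop → Tendsto b atTop atTop → (∀ n, 0 < a n) → (∀ n, 0 < b n) →
      (∀ n, (a n : ℝ) ≤ K * b n) → (∀ n, (b n : ℝ) ≤ K * a n) → (∀ n, t n ∈ U) →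
      (∀ n, (F (t n)).RenormalizesTo (a n) (b n) (g n)) → (∀ n, (g n).IsFull) →
      Tendsto (fun n => (g n).c / (1 - (g n).c) *
        ((F p).c / (1 - (F p).c) *
          (γ * (derivWithin (F p).toFun (Set.Icc 0 1) 0 ^ b n /
            derivWithin (F p).toFun (Set.Icc 0 1) 1 ^ a n)) ^ (1 / α))⁻¹) atTop (𝓝 1) := by
  have hδ2 : δ ≤ 1 / 2 := by
    refine hδ.trans ?_
    rw [div_le_div_iff₀ (by linarith) (by norm_num)]
    linarith
  have hRt : ∀ t ∈ U, (F t).rightBranch.IsTame := fun t ht => (hcl t ht).rightBranch hδ2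
  have hLt : ∀ t ∈ U, (F t).leftBranch.IsTame := fun t ht => (hcl t ht).leftBranch hδ2
  have hpU := hp.1
  set R := (F p).rightBranch with hR
  set L := (F p).leftBranch with hL
  have hRT : R.IsTame := hRt p hpU
  have hLT : L.IsTame := hLt p hpU
  obtain ⟨hfR, hfL⟩ := LorenzMap.isFull_iff.1 hp.2.1
  have hRv : R.v = 1 := Branch.v_eq_one_of_map_c hRT hα hfR
  have hLv : L.v = 1 := Branch.v_eq_one_of_map_c hLT hα hfL
  have hRfix := (hF.fixes p hpU).rightBranch
  have hLfix := (hF.fixes p hpU).leftBranch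
  have hRs : 1 < R.slope α 1 := Branch.one_lt_slope_one hRT hα hRv hδ
    (hcl p hpU (F p).φp (by simp) 1 (by norm_num)).2.1
  have hLs : 1 < L.slope α 1 := Branch.one_lt_slope_one hLT hα hLv hδ
    (hcl p hpU (F p).φm (by simp) (1 - 1) (by norm_num)).2.1
  obtain ⟨A, hA0, hAm⟩ := Branch.exists_return_factor hRT hLT hα hRv hLv hRfix hRs
  obtain ⟨A', hA0', hAm'⟩ := Branch.exists_return_factor hLT hRT hα hLv hRv hLfix hLs
  refine ⟨A' / A, div_pos hA0' hA0, ?_⟩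
  intro K hK a b t g ha hb ha0 hb0 hab hba htU hren hgf
  choose l r hlc hcr hgc hlk hlk' using fun n => (hren n).isLinked (hgf n) hα
    (hRt _ (htU n)) (hLt _ (htU n))
  have ht := tendsto_full_parameter hα hF hA hδ2 hcl hp htU ha hb hlk hlk'
  have hRn := hA.rightBranch_tendsTo ht htU hpU
  have hLn := hA.leftBranch_tendsTo ht htU hpU
  have hRtn : ∀ n, (F (t n)).rightBranch.IsTame := fun n => hRt _ (htU n)
  have hLtn : ∀ n, (F (t n)).leftBranch.IsTame := fun n => hLt _ (htU n)
  have hl' := hRn.tendsto_c_of_isLinked hLn hRT hLT hRtn hLtn hα hRv hLv hRfix ha hlk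
  have hr' := hLn.tendsto_c_of_isLinked hRn hLT hRT hLtn hRtn hα hLv hRv hLfix hb hlk'
  have hRc : ∀ n, (F (t n)).rightBranch.map α (F (t n)).rightBranch.c < (F (t n)).rightBranch.c :=
    fun n => (hlk' n).map_c_lt (hRtn n) hα (hb0 n)
  have hLc : ∀ n, (F (t n)).leftBranch.map α (F (t n)).leftBranch.c < (F (t n)).leftBranch.c :=
    fun n => (hlk n).map_c_lt (hLtn n) hα (ha0 n)
  have hRvn := fun n => Branch.v_pos_of_map_c_lt (hRtn n) hα (hRc n)
  have hLvn := fun n => Branch.v_pos_of_map_c_lt (hLtn n) hα (hLc n)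
  have hcc : R.c + L.c = 1 := add_sub_cancel (F p).c 1
  obtain ⟨⟨P, hP, hPe⟩, C, q, hC, hq0, hq1, hbd⟩ := hAm _ _ a r (fun n => 1 - l n) hRn hLn hRtn hLtn
    hRvn hLvn (fun n x hx => Branch.map_le_self (hRtn n) hα (hRc n)
      (hF.fixes _ (htU n)).rightBranch hx) ha hlk hr' hl' hcc
  obtain ⟨⟨P', hP', hPe'⟩, C', q', hC', hq0', hq1', hbd'⟩ := hAm' _ _ b (fun n => 1 - l n) r hLn hRn
    hLtn hRtn hLvn hRvn (fun n x hx => Branch.map_le_self (hLtn n) hα (hLc n)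
      (hF.fixes _ (htU n)).leftBranch hx) hb hlk' hl' hr' (by rw [add_comm]; exact hcc)
  obtain ⟨m, hm⟩ := hpa.exists_norm_pow_le
  have hnorm : Tendsto (fun n => ‖t n - p‖) atTop (𝓝 0) := tendsto_iff_norm_sub_tendsto_zero.1 ht
  -- The passage near `1` bounds `1 - u` by `C * q ^ a`, the passage near `0` bounds `1 - v` by `C'
  -- * q' ^ b`, and the Łojasiewicz inequality transfers both to the parameter. The aim is to
  -- exchange the multipliers of `F (t n)` for those of `F p` inside the powers.
  have hexp : ∀ᶠ n in atTop, ‖t n - p‖ ^ m ≤ C * q ^ a n + C' * q' ^ b n := by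
    filter_upwards [ht.eventually hm, hbd, hbd'] with n h1 h2 h3
    exact (h1 (htU n)).trans (add_le_add h2 h3)
  have hfast := tendsto_mul_of_exponential (fun n => norm_nonneg (t n - p)) hnorm hK hC hC' hq0 hq1
    hq0' hq1' ha hab hba hexp
  have hfa : Tendsto (fun n => (a n : ℝ) * ‖t n - p‖) atTop (𝓝 0) :=
    squeeze_zero (fun n => by positivity) (fun n => mul_le_mul_of_nonneg_right
      (by push_cast; linarith [(Nat.cast_nonneg (b n) : (0 : ℝ) ≤ b n)]) (norm_nonneg _)) hfast
  have hfb : Tendsto (fun n => (b n : ℝ) * ‖t n - p‖) atTop (𝓝 0) :=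
    squeeze_zero (fun n => by positivity) (fun n => mul_le_mul_of_nonneg_right
      (by push_cast; linarith [(Nat.cast_nonneg (a n) : (0 : ℝ) ≤ a n)]) (norm_nonneg _)) hfast
  have hsR := hA.rightSlope hRt
  have hsL := hA.leftSlope hLt
  have hsRt := hsR.tendsto ht htU hpU
  have hsLt := hsL.tendsto ht htU hpU
  have hpowR := tendsto_div_pow_one (by linarith : 0 < R.slope α 1) hsRt
    (hsR.isBigO_sub ht htU hpU) hfa
  have hpowL := tendsto_div_pow_one (by linarith : 0 < L.slope α 1) hsLt
    (hsL.isBigO_sub ht htU hpU) hfb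
  have hct : Tendsto (fun n => (F (t n)).c) atTop (𝓝 (F p).c) := hA.c.tendsto ht htU hpU
  have hpc := (F p).c_mem
  have hpc1 : 0 < 1 - (F p).c := by linarith [hpc.2]
  have hlim : Tendsto (fun n => ((F (t n)).c / (1 - (F (t n)).c)) / ((F p).c / (1 - (F p).c)) *
      ((P' n / P n) / (A' / A) * (((F (t n)).leftBranch.slope α 1 / L.slope α 1) ^ b n /
        ((F (t n)).rightBranch.slope α 1 / R.slope α 1) ^ a n)) ^ (1 / α)) atTop (𝓝 1) := by
    have h1 := (hct.div (hct.const_sub 1) hpc1.ne').div_const ((F p).c / (1 - (F p).c))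
    rw [div_self (div_pos hpc.1 hpc1).ne'] at h1
    have h2 := ((hP'.div hP hA0.ne').div_const (A' / A)).mul (hpowL.div hpowR one_ne_zero)
    rw [div_self (div_pos hA0' hA0).ne', div_one, one_mul] at h2
    have h3 := h1.mul (h2.rpow_const (p := 1 / α) (Or.inl one_ne_zero))
    rwa [Real.one_rpow, one_mul] at h3
  refine hlim.congr' ?_
  filter_upwards [hP.eventually (lt_mem_nhds hA0), hP'.eventually (lt_mem_nhds hA0'),
    hsRt.eventually (lt_mem_nhds (by linarith : 0 < R.slope α 1)),
    hsLt.eventually (lt_mem_nhds (by linarith : 0 < L.slope α 1))] with n h1 h2 h3 h4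
  have hcn := (F (t n)).c_mem
  have hcn1 : 0 < 1 - (F (t n)).c := by linarith [hcn.2]
  have hcr' := hcr n
  have hlc' := hlc n
  rw [LorenzMap.derivWithin_toFun_zero hLT hα, LorenzMap.derivWithin_toFun_one hRT hα]
  set s := (F (t n)).rightBranch.coord (r n) with hs
  set s' := (F (t n)).leftBranch.coord (1 - l n) with hs'
  have hse : s = (r n - (F (t n)).c) / (1 - (F (t n)).c) := rfl
  have hse' : s' = ((F (t n)).c - l n) / (F (t n)).c := by
    show (1 - l n - (1 - (F (t n)).c)) / (1 - (1 - (F (t n)).c)) = _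
    congr 1 <;> ring
  have hspos : 0 < s := by rw [hse]; exact div_pos (by linarith) hcn1
  have hspos' : 0 < s' := by rw [hse']; exact div_pos (by linarith) hcn.1
  -- Both sides are the length `r n - l n` of the return interval, computed through its left and its
  -- right part.
  have heq : P n * s' ^ α * (F (t n)).rightBranch.slope α 1 ^ a n
      = P' n * s ^ α * (F (t n)).leftBranch.slope α 1 ^ b n := by
    rw [← hPe n, ← hPe' n]; ring
  rw [← ratio_eq hα hcn hpc hspos hspos' h1 h2 hA0 hA0' h4 (by linarith) h3 (by linarith) heq]
  congr 1
  have h5 : (F (t n)).c * s' = (F (t n)).c - l n := by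
    rw [hse']; have := hcn.1; field_simp
  have h6 : (1 - (F (t n)).c) * s = r n - (F (t n)).c := by
    rw [hse]; field_simp
  rw [h5, h6, hgc n]
  have h7 : r n - l n ≠ 0 := by linarith
  have h8 : r n - (F (t n)).c ≠ 0 := by linarith
  have h9 : 1 - ((F (t n)).c - l n) / (r n - l n) = (r n - (F (t n)).c) / (r n - l n) := by
    field_simp; ring
  rw [h9]
  field_simp

theorem mainTheorem3 (α : ℝ) (hα : 1 < α) :
    ∃ δ : ℝ, 0 < δ ∧
      ∀ (U : Set (ℝ × ℝ)) (F : ℝ × ℝ → LorenzMap α) (p : ℝ × ℝ),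
        IsLorenzFamily U F → IsAnalyticFamily U F →
        (∀ t ∈ U, (F t).CloseToStandard δ) →
        IsUniqueFull U F p → IsAnalyticallyUniqueFull U F p →
        ∃ γ : ℝ, 0 < γ ∧ ∀ ε : ℝ, 0 < ε → ∀ K : ℝ, 0 < K → ∃ N : ℕ, 1 ≤ N ∧
          ∀ a b : ℕ, N ≤ a → N ≤ b →
            1 / K ≤ (a : ℝ) / (b : ℝ) → (a : ℝ) / (b : ℝ) ≤ K →
            ∀ (D : Set (ℝ × ℝ)) (t : ℝ × ℝ) (g : LorenzMap α),
              IsIsland U F a b D → IsFullVertex U F a b D t g →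
              1 - ε ≤ g.c / (1 - g.c) *
                  ((F p).c / (1 - (F p).c) *
                    (γ * (derivWithin (F p).toFun (Set.Icc 0 1) 0 ^ b /
                          derivWithin (F p).toFun (Set.Icc 0 1) 1 ^ a)) ^ (1 / α))⁻¹ ∧
              g.c / (1 - g.c) *
                  ((F p).c / (1 - (F p).c) *
                    (γ * (derivWithin (F p).toFun (Set.Icc 0 1) 0 ^ b /
                          derivWithin (F p).toFun (Set.Icc 0 1) 1 ^ a)) ^ (1 / α))⁻¹
                ≤ 1 + ε := by
  -- This `δ` is below `1 / 2`, which makes the branches tame, and is small enough for the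
  -- multipliers of the full map to exceed `1`.
  refine ⟨(α - 1) / (2 * α), div_pos (by linarith) (by linarith), ?_⟩
  intro U F p hF hA hcl hp hpa
  obtain ⟨γ, hγ, hlim⟩ := exists_ratio_limit hα le_rfl hF hA hcl hp hpa
  refine ⟨γ, hγ, fun ε hε K hK => ?_⟩
  by_contra! hcon
  -- Counterexamples for every `N = n + 1` form a sequence with `a, b → ∞`, which the sequential
  -- form rules out.
  choose a b haN hbN hab1 hab2 D t g hD hv hbad using fun n : ℕ => hcon (n + 1) (by omega)
  have ha0 : ∀ n, 0 < a n := fun n => by have := haN n; omega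
  have hb0 : ∀ n, 0 < b n := fun n => by have := hbN n; omega
  have hb0' : ∀ n, (0 : ℝ) < b n := fun n => by exact_mod_cast hb0 n
  have h := hlim K hK a b t g
    (tendsto_atTop_mono (fun n => (Nat.le_succ n).trans (haN n)) tendsto_id)
    (tendsto_atTop_mono (fun n => (Nat.le_succ n).trans (hbN n)) tendsto_id) ha0 hb0
    (fun n => (div_le_iff₀ (hb0' n)).1 (hab2 n))
    (fun n => by
      have h1 := (div_le_div_iff₀ hK (hb0' n)).1 (hab1 n)
      linarith)
    (fun n => (hv n).2.1) (fun n => (hv n).2.2.1) (fun n => (hv n).2.2.2)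
  obtain ⟨n, h1, h2⟩ := ((h.eventually (lt_mem_nhds (by linarith : 1 - ε < 1))).and
    (h.eventually (gt_mem_nhds (by linarith : 1 < 1 + ε)))).exists
  exact absurd (hbad n h1.le) (not_lt.2 h2.le)
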